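/- Let $k$ be a field of characteristic $0$ and let $W$ be a $\mathbb Z$-graded $k$-vector space. For a finite set $S$, an $S$-graph is a connected acyclic graph with vertex set $S$ in which every edge is oriented; $\mathcal{G}r(n)$ is the vector space freely generated by the $\{1,\dots,n\}$-graphs. Put $$\overline{\mathbb G}(W)=\bigoplus_n\overline{\mathbb G}{}^n(W),\qquad \overline{\mathbb G}{}^n(W)=\bigl(\mathcal{G}r(n)\otimes W^{\otimes n}\bigr)_{\Sigma_n},$$ where $\Sigma_n$ relabels the vertices of graphs and simultaneously permutes the tensor factors with Koszul signs. The cobracket $]\cdot[\,:\overline{\mathbb G}(W)\to\overline{\mathbb G}(W)\otimes\overline{\mathbb G}(W)$ sends a labelled graph $G$ to $\sum_e \bigl((-1)^{\kappa_1} G_1^{\hat e}\otimes G_2^{\hat e}-(-1)^{\kappa_2} G_2^{\hat e}\otimes G_1^{\hat e}\bigr)$, where $e$ runs over the edges of $G$, removing $e$ leaves the components $G_1^{\hat e}$ and $G_2^{\hat e}$, $e$ points from $G_1^{\hat e}$ to $G_2^{\hat e}$, the vertices of each component are renumbered preserving their order and keep their labels, and $(-1)^{\kappa_i}$ is the Koszul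 sign of the corresponding reordering of the vectors of $W$. Let $\mathrm{Arn}^n(W)\subset\overline{\mathbb G}{}^n(W)$ be the span of the classes of $r\otimes w$, where $w\in W^{\otimes n}$ and $r\in\mathcal{G}r(n)$ is either a sum $G+G'$ of two graphs which differ by reversing one edge (arrow-reversing), or a sum $G_1+G_2+G_3$ of three graphs which agree except that they contain, respectively, the edges $\{a\to b,\ b\to c\}$, $\{b\to c,\ c\to a\}$, $\{c\to a,\ a\to b\}$ on three vertices $a,b,c$ (Arnold). Put $\overline{\mathbb E}{}^n(W)=\overline{\mathbb G}{}^n(W)/\mathrm{Arn}^n(W)$ and $\overline{\mathbb E}(W)=\bigoplus_n\overline{\mathbb E}{}^n(W)$; if $W$ is concentrated in positive degrees, this is the space underlying the cofree Lie coalgebra on $W$. For a graded vector space $A=\bigoplus_{n\ge0} A^n$ with a linear map $\delta:A\to A\otimes A$ define subspaces $K^n\subset A^n$ inductively: $K^1=0$, and for $n\neq 1$ let $K^n$ be the kernel of the map $$A^n\to\Bigl(\bigoplus_{m<n}A^m/K^m\Bigr)\otimes\Bigl(\bigoplus_{m<n}A^m/K^m\Bigr)$$ obtained from $\delta$ by projecting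 to weights $<n$ and to the quotients. Call $\bigoplus_n A^n/K^n$ the inductive quotient of $A$ by the kernel of $\delta$. Let $]\overline{\mathbb G}(W)[$ be the inductive quotient of $\overline{\mathbb G}(W)$ by the kernel of the cobracket, with subspaces $K^n$. Then: 1. $K^n=\mathrm{Arn}^n(W)$ for all $n$. 2. For all $n\ne 1$, the kernel of the map $\overline{\mathbb G}{}^n(W)\to\overline{\mathbb E}(W)\otimes\overline{\mathbb E}(W)$ induced by the cobracket is exactly $\mathrm{Arn}^n(W)$. 3. The identity of $\overline{\mathbb G}(W)$ induces an isomorphism $\overline{\mathbb E}(W)\cong\,]\overline{\mathbb G}(W)[$. 4. Let $TW=\bigoplus_{n\ge0}W^{\otimes n}$ be the cotensor coalgebra with its deconcatenation coproduct $\Delta$ and anti-cocommutative coproduct $\Delta-\tau\Delta$, where $\tau$ is the twisting map with Koszul sign. Then $\overline{\mathbb E}(W)$ is isomorphic to the inductive quotient of $TW$ by the kernel of $\Delta-\tau\Delta$, through an isomorphism which, for every $n\ge1$, sends the class of the long graph $1\to2\to\cdots\to n$ with vertices labelled $w_1,\dots,w_n$ to the class of $w_1\otimes\cdots\otimes w_n$.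 -/

import Mathlib

open scoped TensorProduct DirectSum
set_option maxSynthPendingDepth 3

/-! ### Oriented trees with a given vertex set -/

/-- An `S`-graph: a connected oriented acyclic graph with vertex set `S`.
`Edge a b` says that there is an edge from `a` to `b`; each edge has one orientation, and the
underlying undirected graph is connected and acyclic. -/
@[ext]
structure SGraph (S : Type) where
  Edge : S → S → Prop
  asymm : ∀ a b, Edge a b → ¬ Edge b a
  isTree : (SimpleGraph.fromRel Edge).IsTree

namespace SGraph

variable {S T : Type}

/-- Relabelling the vertices of a graph along a bijection. -/
def map (f : S ≃ T) (G : SGraph S) : SGraph T where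
  Edge x y := G.Edge (f.symm x) (f.symm y)
  asymm x y h := G.asymm _ _ h
  isTree := by
    refine (SimpleGraph.Iso.isTree_iff (G := SimpleGraph.fromRel G.Edge) ⟨f, ?_⟩).1 G.isTree
    intro a b
    simp [SimpleGraph.fromRel_adj]

theorem ne_of_edge (G : SGraph S) {a b : S} (h : G.Edge a b) : a ≠ b := by
  rintro rfl
  exact G.asymm _ _ h h

/-- The underlying undirected graph of `G` with the edge from `a` to `b` removed. -/
def cut (G : SGraph S) (a b : S) : SimpleGraph S :=
  SimpleGraph.fromRel fun x y => G.Edge x y ∧ ¬ (x = a ∧ y = b)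

theorem cut_eq (G : SGraph S) {a b : S} (h : G.Edge a b) :
    G.cut a b = (SimpleGraph.fromRel G.Edge).deleteEdges {s(a, b)} := by
  ext x y
  have h1 := G.asymm a b h
  have h2 := G.asymm x y
  simp only [cut, SimpleGraph.fromRel_adj, SimpleGraph.deleteEdges_adj, Set.mem_singleton_iff,
    Sym2.eq_iff]
  constructor
  · rintro ⟨hne, ⟨he, hn⟩ | ⟨he, hn⟩⟩
    · refine ⟨⟨hne, Or.inl he⟩, ?_⟩
      rintro (⟨rfl, rfl⟩ | ⟨rfl, rfl⟩)
      · exact hn ⟨rfl, rfl⟩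
      · exact h1 he
    · refine ⟨⟨hne, Or.inr he⟩, ?_⟩
      rintro (⟨rfl, rfl⟩ | ⟨rfl, rfl⟩)
      · exact h1 he
      · exact hn ⟨rfl, rfl⟩
  · rintro ⟨⟨hne, he | he⟩, hn⟩
    · exact ⟨hne, Or.inl ⟨he, fun hh => hn (Or.inl hh)⟩⟩
    · exact ⟨hne, Or.inr ⟨he, fun hh => hn (Or.inr ⟨hh.2, hh.1⟩)⟩⟩

theorem cut_isAcyclic (G : SGraph S) {a b : S} (h : G.Edge a b) : (G.cut a b).IsAcyclic := by
  rw [cut_eq G h]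
  exact G.isTree.isAcyclic.anti (SimpleGraph.deleteEdges_le _)

theorem cut_map (f : S ≃ T) (G : SGraph S) (a b x y : S) :
    ((G.map f).cut (f a) (f b)).Reachable (f x) (f y) ↔ (G.cut a b).Reachable x y := by
  refine SimpleGraph.Iso.reachable_iff (φ := (⟨f, ?_⟩ : G.cut a b ≃g (G.map f).cut (f a) (f b)))
  intro u v
  simp [cut, map, SimpleGraph.fromRel_adj]

variable [Fintype S] [Fintype T]

open Classical in
/-- The vertices of the connected component of `v` after removing the edge from `a` to `b`. -/
noncomputable def side (G : SGraph S) (a b v : S) : Finset S :=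
  Finset.univ.filter fun x => (G.cut a b).Reachable v x

theorem mem_side (G : SGraph S) (a b v x : S) :
    x ∈ G.side a b v ↔ (G.cut a b).Reachable v x := by
  simp [side]

/-- The connected component of `v` after removing the edge from `a` to `b`, as a graph. -/
def piece (G : SGraph S) {a b : S} (h : G.Edge a b) (v : S) : SGraph (G.side a b v) where
  Edge x y := G.Edge x y ∧ ¬ ((x : S) = a ∧ (y : S) = b)
  asymm x y hxy hyx := G.asymm _ _ hxy.1 hyx.1
  isTree := by
    have ht := (G.cut_isAcyclic h).isTree_connectedComponent
      ((G.cut a b).connectedComponentMk v)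
    refine (SimpleGraph.Iso.isTree_iff ⟨Equiv.subtypeEquivRight ?_, ?_⟩).1 ht
    · intro x
      rw [mem_side]
      exact ⟨fun hx => (SimpleGraph.ConnectedComponent.exact hx).symm,
        fun hx => SimpleGraph.ConnectedComponent.sound hx.symm⟩
    · rintro ⟨x, hx⟩ ⟨y, hy⟩
      constructor
      · rintro ⟨hne, h'⟩
        exact ⟨fun e => hne (Subtype.ext e), h'⟩
      · rintro ⟨hne, h'⟩
        exact ⟨fun e => hne (congrArg Subtype.val e), h'⟩

/-- Removing an edge separates the vertices into the component of its source and the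
component of its target. -/
theorem isCompl_side (G : SGraph S) {a b : S} (h : G.Edge a b) :
    ∀ x, x ∈ G.side a b a ↔ x ∉ G.side a b b := by
  have hadj : (SimpleGraph.fromRel G.Edge).Adj a b := by
    rw [SimpleGraph.fromRel_adj]
    exact ⟨G.ne_of_edge h, Or.inl h⟩
  have hbr := SimpleGraph.isBridge_iff.1
    ((SimpleGraph.isAcyclic_iff_forall_adj_isBridge.1 G.isTree.isAcyclic) hadj)
  rw [← cut_eq G h] at hbr
  have hcover : ∀ x y, (SimpleGraph.fromRel G.Edge).Walk x y →
      ((G.cut a b).Reachable a y ∨ (G.cut a b).Reachable b y) →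
      ((G.cut a b).Reachable a x ∨ (G.cut a b).Reachable b x) := by
    intro x y p
    induction p with
    | nil => exact id
    | @cons u v w huv p ih =>
      intro hw
      have hv := ih hw
      by_cases he : s(u, v) = s(a, b)
      · rcases Sym2.eq_iff.1 he with ⟨rfl, rfl⟩ | ⟨rfl, rfl⟩
        · exact Or.inl (SimpleGraph.Reachable.refl _)
        · exact Or.inr (SimpleGraph.Reachable.refl _)
      · have : (G.cut a b).Adj v u := by
          rw [cut_eq G h, SimpleGraph.deleteEdges_adj]
          exact ⟨huv.symm, fun hh => he (Sym2.eq_swap.trans hh)⟩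
        exact hv.imp (fun r => r.trans this.reachable) (fun r => r.trans this.reachable)
  intro x
  rw [mem_side, mem_side]
  constructor
  · intro ha hb
    exact hbr (ha.trans hb.symm)
  · intro hb
    obtain ⟨p⟩ := G.isTree.1.preconnected x a
    exact (hcover x a p (Or.inl (SimpleGraph.Reachable.refl _))).resolve_right hb

theorem mem_side_map (f : S ≃ T) (G : SGraph S) (a b v x : S) :
    x ∈ G.side a b v ↔ f x ∈ (G.map f).side (f a) (f b) (f v) := by
  rw [mem_side, mem_side, cut_map]

/-- The long graph `0 → 1 → ⋯ → n`. -/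
def long (n : ℕ) : SGraph (Fin (n + 1)) where
  Edge i j := (i : ℕ) + 1 = j
  asymm i j h h' := by omega
  isTree := by
    have hg : (SimpleGraph.fromRel fun i j : Fin (n + 1) => (i : ℕ) + 1 = j) =
        SimpleGraph.pathGraph (n + 1) := by
      ext i j
      rw [SimpleGraph.pathGraph_adj, SimpleGraph.fromRel_adj]
      constructor
      · rintro ⟨-, h⟩
        exact h
      · intro h
        refine ⟨?_, h⟩
        rintro rfl
        omega
    rw [hg, SimpleGraph.isTree_iff_connected_and_card]
    refine ⟨SimpleGraph.pathGraph_connected n, ?_⟩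
    have hb : Function.Bijective (fun i : Fin n =>
        (⟨s(i.castSucc, i.succ), by
          rw [SimpleGraph.mem_edgeSet, SimpleGraph.pathGraph_adj]
          left
          simp⟩ : (SimpleGraph.pathGraph (n + 1)).edgeSet)) := by
      constructor
      · intro i j hij
        have h1 := congrArg Subtype.val hij
        rcases Sym2.eq_iff.1 h1 with ⟨h2, -⟩ | ⟨h2, h3⟩
        · exact Fin.castSucc_injective _ h2
        · have h4 := congrArg Fin.val h2
          have h5 := congrArg Fin.val h3
          simp at h4 h5
          omega
      · rintro ⟨e, he⟩
        induction e using Sym2.ind with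
        | _ x y =>
          have he' := he
          rw [SimpleGraph.mem_edgeSet, SimpleGraph.pathGraph_adj] at he'
          rcases he' with h | h
          · refine ⟨⟨x, by omega⟩, Subtype.ext (Sym2.eq_iff.2 (Or.inl ⟨rfl, Fin.ext ?_⟩))⟩
            simpa using h
          · refine ⟨⟨y, by omega⟩, Subtype.ext (Sym2.eq_iff.2 (Or.inr ⟨rfl, Fin.ext ?_⟩))⟩
            simpa using h
    rw [← Nat.card_congr (Equiv.ofBijective _ hb)]
    simp

end SGraph

/-! ### Koszul signs and graded tensor powers -/

section Koszul

variable {S T U : Type} [Fintype S] [LinearOrder S] [Fintype T] [LinearOrder T] [LinearOrder U]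

/-- The Koszul sign of the rearrangement `f` of homogeneous elements, where position `i` holds
an element of parity `d i`: a factor `-1` for each pair of odd elements whose order changes. -/
def koszulSign (f : S ≃ T) (d : S → ZMod 2) : ℤ :=
  ∏ p : S × S, if p.1 < p.2 ∧ f p.2 < f p.1 ∧ d p.1 = 1 ∧ d p.2 = 1 then -1 else 1

theorem koszulSign_trans (f : S ≃ T) (g : T ≃ U) (d : S → ZMod 2) :
    koszulSign (f.trans g) d = koszulSign f d * koszulSign g (fun t => d (f.symm t)) := by
  have h1 : koszulSign g (fun t => d (f.symm t)) = ∏ p : S × S,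
      if f p.1 < f p.2 ∧ g (f p.2) < g (f p.1) ∧ d p.1 = 1 ∧ d p.2 = 1 then (-1 : ℤ) else 1 := by
    refine (Fintype.prod_equiv (f.prodCongr f) _ _ ?_).symm
    intro p
    simp
  have h2 : koszulSign g (fun t => d (f.symm t)) =
      (∏ p : S × S, if p.1 < p.2 ∧ f p.1 < f p.2 ∧ g (f p.2) < g (f p.1) ∧ d p.1 = 1 ∧ d p.2 = 1
        then (-1 : ℤ) else 1) *
      ∏ p : S × S, if p.1 < p.2 ∧ f p.2 < f p.1 ∧ g (f p.1) < g (f p.2) ∧ d p.1 = 1 ∧ d p.2 = 1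
        then (-1 : ℤ) else 1 := by
    have h3 : (∏ p : S × S, if p.1 < p.2 ∧ f p.2 < f p.1 ∧ g (f p.1) < g (f p.2) ∧ d p.1 = 1 ∧
        d p.2 = 1 then (-1 : ℤ) else 1) = ∏ p : S × S, if p.2 < p.1 ∧ f p.1 < f p.2 ∧
        g (f p.2) < g (f p.1) ∧ d p.2 = 1 ∧ d p.1 = 1 then (-1 : ℤ) else 1 := by
      refine Fintype.prod_equiv (Equiv.prodComm S S) _ _ ?_
      intro p
      exact if_congr (by simp [and_comm]) rfl rfl
    rw [h1, h3, ← Finset.prod_mul_distrib]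
    refine Finset.prod_congr rfl fun p _ => ?_
    rcases lt_trichotomy p.1 p.2 with h | h | h
    · simp [h, not_lt_of_gt h]
    · simp [h]
    · simp [h, not_lt_of_gt h, and_comm]
  rw [h2, koszulSign, koszulSign, ← Finset.prod_mul_distrib, ← Finset.prod_mul_distrib]
  refine Finset.prod_congr rfl fun p _ => ?_
  by_cases h : p.1 < p.2
  swap
  · simp [h]
  by_cases hd : d p.1 = 1 ∧ d p.2 = 1
  swap
  · have hd' : ∀ P Q : Prop, ¬ (P ∧ Q ∧ d p.1 = 1 ∧ d p.2 = 1) := fun P Q hh => hd hh.2.2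
    have hd2 : ∀ P Q R : Prop, ¬ (P ∧ Q ∧ R ∧ d p.1 = 1 ∧ d p.2 = 1) :=
      fun P Q R hh => hd hh.2.2.2
    rw [if_neg (hd' _ _), if_neg (hd' _ _), if_neg (hd2 _ _ _), if_neg (hd2 _ _ _)]
    simp
  have hf : f p.1 ≠ f p.2 := fun e => h.ne (f.injective e)
  have hg : g (f p.1) ≠ g (f p.2) := fun e => hf (g.injective e)
  rcases lt_or_gt_of_ne hf with h' | h' <;> rcases lt_or_gt_of_ne hg with h'' | h'' <;>
    simp [h, hd, h', h'', not_lt_of_gt h', not_lt_of_gt h'']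

theorem koszulSign_sumCongr {A B A' B' : Type} [Fintype A] [LinearOrder A] [Fintype B]
    [LinearOrder B] [LinearOrder A'] [LinearOrder B']
    (f : A ≃ A') (g : B ≃ B') (d : A ⊕ₗ B → ZMod 2) :
    koszulSign (S := A ⊕ₗ B) (T := A' ⊕ₗ B')
        ((ofLex.trans (f.sumCongr g)).trans toLex) d =
      koszulSign f (fun a => d (toLex (Sum.inl a))) *
        koszulSign g (fun b => d (toLex (Sum.inr b))) := by
  have key : ∀ F : (A ⊕ₗ B) × (A ⊕ₗ B) → ℤ, ∏ p, F p =
      ((∏ p : A × A, F (toLex (Sum.inl p.1), toLex (Sum.inl p.2))) *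
        (∏ p : A × B, F (toLex (Sum.inl p.1), toLex (Sum.inr p.2)))) *
      ((∏ p : B × A, F (toLex (Sum.inr p.1), toLex (Sum.inl p.2))) *
        (∏ p : B × B, F (toLex (Sum.inr p.1), toLex (Sum.inr p.2)))) := by
    intro F
    have e1 : ∀ G : A ⊕ₗ B → ℤ, ∏ x, G x =
        (∏ a, G (toLex (Sum.inl a))) * ∏ b, G (toLex (Sum.inr b)) := by
      intro G
      rw [← Fintype.prod_sum_type (fun x : A ⊕ B => G (toLex x))]
      exact (Fintype.prod_equiv toLex _ _ fun _ => rfl).symm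
    simp only [Fintype.prod_prod_type, e1, Finset.prod_mul_distrib]
  rw [koszulSign, key, koszulSign, koszulSign]
  have z1 : (∏ p : A × B, if (toLex (Sum.inl p.1) : A ⊕ₗ B) < toLex (Sum.inr p.2) ∧
      ((ofLex.trans (f.sumCongr g)).trans toLex : A ⊕ₗ B ≃ A' ⊕ₗ B') (toLex (Sum.inr p.2)) <
        ((ofLex.trans (f.sumCongr g)).trans toLex : A ⊕ₗ B ≃ A' ⊕ₗ B') (toLex (Sum.inl p.1)) ∧
      d (toLex (Sum.inl p.1)) = 1 ∧ d (toLex (Sum.inr p.2)) = 1 then (-1 : ℤ) else 1) = 1 := by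
    refine Finset.prod_eq_one fun p _ => if_neg ?_
    rintro ⟨-, h, -⟩
    exact Sum.Lex.not_inr_lt_inl h
  have z2 : (∏ p : B × A, if (toLex (Sum.inr p.1) : A ⊕ₗ B) < toLex (Sum.inl p.2) ∧
      ((ofLex.trans (f.sumCongr g)).trans toLex : A ⊕ₗ B ≃ A' ⊕ₗ B') (toLex (Sum.inl p.2)) <
        ((ofLex.trans (f.sumCongr g)).trans toLex : A ⊕ₗ B ≃ A' ⊕ₗ B') (toLex (Sum.inr p.1)) ∧
      d (toLex (Sum.inr p.1)) = 1 ∧ d (toLex (Sum.inl p.2)) = 1 then (-1 : ℤ) else 1) = 1 := by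
    refine Finset.prod_eq_one fun p _ => if_neg ?_
    rintro ⟨h, -, -⟩
    exact Sum.Lex.not_inr_lt_inl h
  rw [z1, z2, one_mul, mul_one]
  congr 1
  · refine Finset.prod_congr rfl fun p _ => ?_
    simp
  · refine Finset.prod_congr rfl fun p _ => ?_
    simp

end Koszul

section GradedTensor

variable {k : Type*} [CommRing k] {W : Type*} [AddCommGroup W] [Module k W]
  (𝒲 : ℤ → Submodule k W) [DirectSum.Decomposition 𝒲]

/-- The projection of a `ℤ`-graded vector space to its part of parity `ε`. -/
noncomputable def parityProj (ε : ZMod 2) : W →ₗ[k] W :=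
  (DirectSum.toModule k ℤ W fun i => if (i : ZMod 2) = ε then (𝒲 i).subtype else 0) ∘ₗ
    (DirectSum.decomposeLinearEquiv 𝒲).toLinearMap

theorem parityProj_of_mem (ε : ZMod 2) (i : ℤ) {w : W} (hw : w ∈ 𝒲 i) :
    parityProj 𝒲 ε w = if (i : ZMod 2) = ε then w else 0 := by
  lift w to 𝒲 i using hw
  simp only [parityProj, LinearMap.comp_apply, LinearEquiv.coe_coe,
    DirectSum.decomposeLinearEquiv_apply, DirectSum.decompose_coe]
  rw [← DirectSum.lof_eq_of k, DirectSum.toModule_lof]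
  split_ifs <;> rfl

theorem parityProj_parityProj (ε η : ZMod 2) (w : W) :
    parityProj 𝒲 ε (parityProj 𝒲 η w) = if ε = η then parityProj 𝒲 ε w else 0 := by
  induction w using DirectSum.Decomposition.inductionOn 𝒲 with
  | zero => simp
  | @homogeneous i m =>
    rw [parityProj_of_mem 𝒲 η i m.2, parityProj_of_mem 𝒲 ε i m.2]
    by_cases h : (i : ZMod 2) = η
    · rw [if_pos h, parityProj_of_mem 𝒲 ε i m.2, h]
      by_cases h' : η = ε
      · simp [h']
      · simp [h', Ne.symm h']
    · rw [if_neg h, map_zero]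
      by_cases h' : ε = η
      · rw [if_pos h', h', if_neg h]
      · rw [if_neg h']
  | add a b ha hb =>
    rw [map_add, map_add, ha, hb]
    split_ifs
    · rw [map_add]
    · simp

theorem sum_parityProj (w : W) : ∑ ε : ZMod 2, parityProj 𝒲 ε w = w := by
  induction w using DirectSum.Decomposition.inductionOn 𝒲 with
  | zero => simp
  | @homogeneous i m => simp [parityProj_of_mem 𝒲 _ i m.2]
  | add a b ha hb => simp only [map_add, Finset.sum_add_distrib, ha, hb]

variable {S T U : Type} [Fintype S] [LinearOrder S] [LinearOrder T] [LinearOrder U]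

/-- The rearrangement of tensors along a bijection `f` of ordered index sets, with Koszul signs:
on homogeneous vectors, `⨂ w i` is sent to the Koszul sign times `⨂ w (f.symm j)`. -/
noncomputable def koszul (f : S ≃ T) : (⨂[k] _ : S, W) →ₗ[k] (⨂[k] _ : T, W) :=
  ∑ d : S → ZMod 2, (koszulSign f d : k) •
    ((PiTensorProduct.reindex k (fun _ => W) f).toLinearMap ∘ₗ
      PiTensorProduct.map fun i => parityProj 𝒲 (d i))

theorem koszul_tprod (f : S ≃ T) (d : S → ZMod 2) (w : S → W)
    (hw : ∀ i, parityProj 𝒲 (d i) (w i) = w i) :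
    koszul 𝒲 f (PiTensorProduct.tprod k w) =
      (koszulSign f d : k) • PiTensorProduct.tprod k fun j => w (f.symm j) := by
  rw [koszul, LinearMap.sum_apply, Finset.sum_eq_single d]
  · simp only [LinearMap.smul_apply, LinearMap.comp_apply, PiTensorProduct.map_tprod, hw,
      LinearEquiv.coe_coe, PiTensorProduct.reindex_tprod]
  · intro d' _ hd
    obtain ⟨i, hi⟩ := Function.ne_iff.1 hd
    have h0 : parityProj 𝒲 (d' i) (w i) = 0 := by
      rw [← hw i, parityProj_parityProj, if_neg hi]
    simp only [LinearMap.smul_apply, LinearMap.comp_apply, PiTensorProduct.map_tprod]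
    rw [(PiTensorProduct.tprod k).map_coord_zero i h0, map_zero, smul_zero]
  · exact fun h => absurd (Finset.mem_univ _) h

/-- Linear maps out of a tensor power agree if they agree on tensors of vectors of definite
parity. -/
theorem tensor_ext {E : Type*} [AddCommGroup E] [Module k E] {φ ψ : (⨂[k] _ : S, W) →ₗ[k] E}
    (h : ∀ (d : S → ZMod 2) (w : S → W), (∀ i, parityProj 𝒲 (d i) (w i) = w i) →
      φ (PiTensorProduct.tprod k w) = ψ (PiTensorProduct.tprod k w)) : φ = ψ := by
  refine PiTensorProduct.ext (MultilinearMap.ext fun w => ?_)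
  simp only [LinearMap.compMultilinearMap_apply]
  have hw : PiTensorProduct.tprod k w = ∑ d : S → ZMod 2,
      PiTensorProduct.tprod k fun i => parityProj 𝒲 (d i) (w i) := by
    have := (PiTensorProduct.tprod k (s := fun _ : S => W)).map_sum
      fun i (ε : ZMod 2) => parityProj 𝒲 ε (w i)
    rw [← this]
    simp only [sum_parityProj]
  rw [hw, map_sum, map_sum]
  refine Finset.sum_congr rfl fun d _ => h d _ fun i => ?_
  rw [parityProj_parityProj, if_pos rfl]

theorem koszul_refl : koszul 𝒲 (Equiv.refl S) = LinearMap.id := by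
  refine tensor_ext 𝒲 fun d w hw => ?_
  rw [koszul_tprod 𝒲 _ d w hw]
  have : koszulSign (Equiv.refl S) d = 1 := by
    refine Finset.prod_eq_one fun p _ => if_neg ?_
    rintro ⟨h1, h2, -⟩
    exact lt_asymm h1 h2
  simp [this]

theorem koszul_trans [Fintype T] (f : S ≃ T) (g : T ≃ U) :
    koszul 𝒲 (f.trans g) = koszul 𝒲 g ∘ₗ koszul 𝒲 f := by
  refine tensor_ext 𝒲 fun d w hw => ?_
  rw [koszul_tprod 𝒲 _ d w hw, LinearMap.comp_apply, koszul_tprod 𝒲 _ d w hw, map_smul,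
    koszul_tprod 𝒲 g (fun t => d (f.symm t)) _ fun i => hw _, koszulSign_trans, Int.cast_mul,
    mul_smul]
  rfl

/-- `W^{⊗ (A ⊔ B)} ≅ W^{⊗ A} ⊗ W^{⊗ B}`, where `A` is ordered before `B`. -/
noncomputable def splitSum (A B : Type) :
    (⨂[k] _ : A ⊕ₗ B, W) →ₗ[k] (⨂[k] _ : A, W) ⊗[k] (⨂[k] _ : B, W) :=
  (PiTensorProduct.tmulEquiv k W).symm.toLinearMap ∘ₗ
    (PiTensorProduct.reindex k (fun _ => W) (ofLex (α := A ⊕ B))).toLinearMap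

theorem splitSum_tprod (A B : Type) (w : A ⊕ₗ B → W) :
    splitSum (k := k) A B (PiTensorProduct.tprod k w) =
      (PiTensorProduct.tprod k fun a => w (toLex (Sum.inl a))) ⊗ₜ
        (PiTensorProduct.tprod k fun b => w (toLex (Sum.inr b))) := by
  simp only [splitSum, LinearMap.comp_apply, LinearEquiv.coe_coe, PiTensorProduct.reindex_tprod]
  exact PiTensorProduct.tmulEquiv_symm_apply k W _

theorem splitSum_koszul {A B A' B' : Type} [Fintype A] [LinearOrder A] [Fintype B]
    [LinearOrder B] [Fintype A'] [LinearOrder A'] [Fintype B'] [LinearOrder B']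
    (f : A ≃ A') (g : B ≃ B') :
    splitSum A' B' ∘ₗ koszul 𝒲 (S := A ⊕ₗ B) (T := A' ⊕ₗ B')
        ((ofLex.trans (f.sumCongr g)).trans toLex) =
      TensorProduct.map (koszul 𝒲 f) (koszul 𝒲 g) ∘ₗ splitSum A B := by
  refine tensor_ext 𝒲 fun d w hw => ?_
  rw [LinearMap.comp_apply, koszul_tprod 𝒲 _ d w hw, map_smul, splitSum_tprod,
    LinearMap.comp_apply, splitSum_tprod, TensorProduct.map_tmul,
    koszul_tprod 𝒲 f (fun a => d (toLex (Sum.inl a))) _ fun i => hw _,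
    koszul_tprod 𝒲 g (fun b => d (toLex (Sum.inr b))) _ fun i => hw _,
    koszulSign_sumCongr, Int.cast_mul, mul_smul, ← TensorProduct.smul_tmul',
    TensorProduct.tmul_smul]
  rfl

/-- The bijection of `S` with the disjoint union of two complementary subsets `A` and `B`. -/
noncomputable def sideEquiv (A B : Finset S) (h : ∀ x, x ∈ A ↔ x ∉ B) : S ≃ A ⊕ₗ B :=
  (Equiv.ofBijective (fun x : A ⊕ₗ B => Sum.elim (fun a : A => (a : S)) (fun b : B => (b : S))
    (ofLex x)) (by
      constructor
      · intro x y
        induction x using Lex.rec with | _ x => ?_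
        induction y using Lex.rec with | _ y => ?_
        rcases x with ⟨x, hx⟩ | ⟨x, hx⟩ <;> rcases y with ⟨y, hy⟩ | ⟨y, hy⟩ <;>
          intro hxy <;> simp at hxy <;> subst hxy
        · rfl
        · exact absurd hy ((h _).1 hx)
        · exact absurd hx ((h _).1 hy)
        · rfl
      · intro x
        by_cases hx : x ∈ A
        · exact ⟨toLex (Sum.inl ⟨x, hx⟩), rfl⟩
        · exact ⟨toLex (Sum.inr ⟨x, by by_contra hb; exact hx ((h x).2 hb)⟩), rfl⟩)).symm

/-- The unshuffling of a tensor with index set `S` into its part over `A` followed by its part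
over the complement `B` of `A`, with the Koszul sign. -/
noncomputable def unshuffle (A B : Finset S) (h : ∀ x, x ∈ A ↔ x ∉ B) :
    (⨂[k] _ : S, W) →ₗ[k] (⨂[k] _ : A, W) ⊗[k] (⨂[k] _ : B, W) :=
  splitSum A B ∘ₗ koszul 𝒲 (sideEquiv A B h)

theorem unshuffle_koszul [Fintype T] (f : S ≃ T) {A B : Finset S} (h : ∀ x, x ∈ A ↔ x ∉ B)
    {A' B' : Finset T} (h' : ∀ x, x ∈ A' ↔ x ∉ B') (hA : ∀ x, x ∈ A ↔ f x ∈ A')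
    (hB : ∀ x, x ∈ B ↔ f x ∈ B') :
    unshuffle 𝒲 A' B' h' ∘ₗ koszul 𝒲 f =
      TensorProduct.map (koszul 𝒲 (f.subtypeEquiv hA)) (koszul 𝒲 (f.subtypeEquiv hB)) ∘ₗ
        unshuffle 𝒲 A B h := by
  rw [unshuffle, unshuffle, ← LinearMap.comp_assoc, ← splitSum_koszul, LinearMap.comp_assoc,
    LinearMap.comp_assoc, ← koszul_trans, ← koszul_trans]
  congr 2
  ext1 x
  rw [Equiv.trans_apply, ← Equiv.eq_symm_apply]
  by_cases hx : x ∈ A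
  · have : sideEquiv A B h x = toLex (Sum.inl ⟨x, hx⟩) := by
      rw [← Equiv.eq_symm_apply]; rfl
    refine Eq.trans ?_ (congrArg (fun z => (sideEquiv A' B' h').symm
      (((ofLex.trans ((f.subtypeEquiv hA).sumCongr (f.subtypeEquiv hB))).trans toLex) z)) this).symm
    rfl
  · have hxB : x ∈ B := by by_contra hb; exact hx ((h x).2 hb)
    have : sideEquiv A B h x = toLex (Sum.inr ⟨x, hxB⟩) := by
      rw [← Equiv.eq_symm_apply]; rfl
    refine Eq.trans ?_ (congrArg (fun z => (sideEquiv A' B' h').symm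
      (((ofLex.trans ((f.subtypeEquiv hA).sumCongr (f.subtypeEquiv hB))).trans toLex) z)) this).symm
    rfl

end GradedTensor

/-! ### The cofree graph coalgebra -/

section GraphCoalgebra

variable {k : Type*} [CommRing k] {W : Type*} [AddCommGroup W] [Module k W]
  (𝒲 : ℤ → Submodule k W) [DirectSum.Decomposition 𝒲]
variable {S T U : Type} [Fintype S] [LinearOrder S] [Fintype T] [LinearOrder T] [LinearOrder U]

/-- `Gr(S) ⊗ W^{⊗ S}`, where `Gr(S)` is the vector space freely generated by `S`-graphs. -/
abbrev LabelledGraphs (k : Type*) [CommRing k] (W : Type*) [AddCommGroup W] [Module k W]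
    (S : Type) : Type _ :=
  (SGraph S →₀ k) ⊗[k] (⨂[k] _ : S, W)

/-- Simultaneous relabelling of graphs and rearrangement of tensors along a bijection: vertex
`f i` of the new graph carries the vector of vertex `i`, and the Koszul sign is introduced. -/
noncomputable def relabel (f : S ≃ T) : LabelledGraphs k W S →ₗ[k] LabelledGraphs k W T :=
  TensorProduct.map (Finsupp.lmapDomain k k (SGraph.map f)) (koszul 𝒲 f)

theorem relabel_refl : relabel 𝒲 (Equiv.refl S) = LinearMap.id := by
  have : SGraph.map (Equiv.refl S) = id := rfl
  rw [relabel, koszul_refl, this, Finsupp.lmapDomain_id, TensorProduct.map_id]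

theorem relabel_trans (f : S ≃ T) (g : T ≃ U) :
    relabel 𝒲 (f.trans g) = relabel 𝒲 g ∘ₗ relabel 𝒲 f := by
  have : SGraph.map (f.trans g) = SGraph.map g ∘ SGraph.map f := rfl
  rw [relabel, koszul_trans, this, Finsupp.lmapDomain_comp, TensorProduct.map_comp]
  rfl

/-- The action of the symmetric group on `Gr(n) ⊗ W^{⊗ n}`. -/
noncomputable def graphRep (n : ℕ) :
    Representation k (Equiv.Perm (Fin n)) (LabelledGraphs k W (Fin n)) where
  toFun σ := relabel 𝒲 σ
  map_one' := relabel_refl 𝒲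
  map_mul' σ τ := relabel_trans 𝒲 τ σ

/-- The weight `n` part `(Gr(n) ⊗ W^{⊗ n})_{Σ_n}` of `Ḡ(W)`. -/
abbrev GbarN (n : ℕ) : Type _ := Representation.Coinvariants (graphRep 𝒲 n)

/-- The quotient map from `Gr(n) ⊗ W^{⊗ n}` to its coinvariants. -/
noncomputable def mkGbar (n : ℕ) : LabelledGraphs k W (Fin n) →ₗ[k] GbarN 𝒲 n :=
  Representation.Coinvariants.mk (graphRep 𝒲 n)

theorem mkGbar_relabel (n : ℕ) (σ : Equiv.Perm (Fin n)) (x : LabelledGraphs k W (Fin n)) :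
    mkGbar 𝒲 n (relabel 𝒲 σ x) = mkGbar 𝒲 n x :=
  Representation.Coinvariants.mk_self_apply (graphRep 𝒲 n) σ x

/-- `Ḡ(W) = ⨁ n, (Gr(n) ⊗ W^{⊗ n})_{Σ_n}`. -/
abbrev Gbar : Type _ := ⨁ n : ℕ, GbarN 𝒲 n

/-- The class in `Ḡ(W)` of a labelled graph whose vertex set is any finite linearly ordered
set `S`, obtained by numbering the vertices in increasing order. -/
noncomputable def toGbar (S : Type) [Fintype S] [LinearOrder S] :
    LabelledGraphs k W S →ₗ[k] Gbar 𝒲 :=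
  DirectSum.lof k ℕ (GbarN 𝒲) (Fintype.card S) ∘ₗ
    mkGbar 𝒲 (Fintype.card S) ∘ₗ
      relabel 𝒲 (Fintype.orderIsoFinOfCardEq S rfl).symm.toEquiv

theorem toGbar_eq {n : ℕ} (e : S ≃ Fin n) :
    toGbar 𝒲 S = DirectSum.lof k ℕ (GbarN 𝒲) n ∘ₗ
      mkGbar 𝒲 n ∘ₗ relabel 𝒲 e := by
  obtain rfl : Fintype.card S = n := by simpa using Fintype.card_congr e
  rw [toGbar]
  set e₀ := (Fintype.orderIsoFinOfCardEq S rfl).symm.toEquiv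
  have h : e = e₀.trans (e₀.symm.trans e) := by
    rw [← Equiv.trans_assoc, Equiv.self_trans_symm, Equiv.refl_trans]
  rw [h, relabel_trans]
  refine LinearMap.ext fun x => ?_
  simp only [LinearMap.comp_apply]
  congr 1
  exact (mkGbar_relabel 𝒲 _ (e₀.symm.trans e) (relabel 𝒲 e₀ x)).symm

theorem toGbar_relabel (f : S ≃ T) : toGbar 𝒲 T ∘ₗ relabel 𝒲 f = toGbar 𝒲 S := by
  let e : T ≃ Fin (Fintype.card T) := Fintype.equivFin T
  rw [toGbar_eq 𝒲 e, toGbar_eq 𝒲 (f.trans e), relabel_trans]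
  rfl

/-- The class in `Ḡ(W)` of the graph `G` as a function of the vectors on its vertices. -/
noncomputable def graphClass (G : SGraph S) : (⨂[k] _ : S, W) →ₗ[k] Gbar 𝒲 :=
  toGbar 𝒲 S ∘ₗ TensorProduct.mk k _ _ (Finsupp.single G 1)

theorem graphClass_map (f : S ≃ T) (G : SGraph S) :
    graphClass 𝒲 (G.map f) ∘ₗ koszul 𝒲 f = graphClass 𝒲 G := by
  rw [graphClass, graphClass, ← toGbar_relabel 𝒲 f]
  refine LinearMap.ext fun x => ?_
  simp [relabel]

/-- The two terms of the cobracket of `G` which belong to the edge from `a` to `b`: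
`G₁ ⊗ G₂ - G₂ ⊗ G₁` with Koszul signs, where `G₁` is the component of `a` and `G₂` is the
component of `b` after removing the edge. -/
noncomputable def edgeTerm (G : SGraph S) {a b : S} (h : G.Edge a b) :
    (⨂[k] _ : S, W) →ₗ[k] Gbar 𝒲 ⊗[k] Gbar 𝒲 :=
  TensorProduct.map (graphClass 𝒲 (G.piece h a)) (graphClass 𝒲 (G.piece h b)) ∘ₗ
      unshuffle 𝒲 (G.side a b a) (G.side a b b) (G.isCompl_side h) -
    TensorProduct.map (graphClass 𝒲 (G.piece h b)) (graphClass 𝒲 (G.piece h a)) ∘ₗ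
      unshuffle 𝒲 (G.side a b b) (G.side a b a) fun x => by rw [G.isCompl_side h x, not_not]

theorem edgeTerm_map (f : S ≃ T) (G : SGraph S) {a b : S} (h : G.Edge a b)
    (h' : (G.map f).Edge (f a) (f b)) :
    edgeTerm 𝒲 (G.map f) h' ∘ₗ koszul 𝒲 f = edgeTerm 𝒲 G h := by
  have hp : ∀ v, (G.map f).piece h' (f v) =
      (G.piece h v).map (f.subtypeEquiv (SGraph.mem_side_map f G a b v)) := by
    intro v
    ext x y
    change (G.Edge (f.symm x) (f.symm y) ∧ ¬ ((x : T) = f a ∧ (y : T) = f b)) ↔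
      (G.Edge (f.symm x) (f.symm y) ∧ ¬ (f.symm x = a ∧ f.symm y = b))
    rw [Equiv.symm_apply_eq, Equiv.symm_apply_eq]
  have hu : ∀ (u v : S) (hc : ∀ x, x ∈ G.side a b u ↔ x ∉ G.side a b v)
      (hc' : ∀ x, x ∈ (G.map f).side (f a) (f b) (f u) ↔
        x ∉ (G.map f).side (f a) (f b) (f v)),
      (TensorProduct.map (graphClass 𝒲 ((G.map f).piece h' (f u)))
          (graphClass 𝒲 ((G.map f).piece h' (f v))) ∘ₗ unshuffle 𝒲 _ _ hc') ∘ₗ koszul 𝒲 f =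
        TensorProduct.map (graphClass 𝒲 (G.piece h u)) (graphClass 𝒲 (G.piece h v)) ∘ₗ
          unshuffle 𝒲 _ _ hc := by
    intro u v hc hc'
    rw [LinearMap.comp_assoc, unshuffle_koszul 𝒲 f hc hc' (SGraph.mem_side_map f G a b u)
      (SGraph.mem_side_map f G a b v), hp, hp, ← LinearMap.comp_assoc, ← TensorProduct.map_comp,
      graphClass_map, graphClass_map]
  rw [edgeTerm, edgeTerm, LinearMap.sub_comp, hu, hu]

open Classical in
/-- The cobracket on representatives: the sum over all edges `e.1.1 → e.1.2` of the graph. -/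
noncomputable def cobracketRep (S : Type) [Fintype S] [LinearOrder S] :
    LabelledGraphs k W S →ₗ[k] Gbar 𝒲 ⊗[k] Gbar 𝒲 :=
  TensorProduct.lift (Finsupp.linearCombination k fun G : SGraph S =>
    ∑ e : {e : S × S // G.Edge e.1 e.2}, edgeTerm 𝒲 G e.2)

theorem cobracketRep_relabel (f : S ≃ T) :
    cobracketRep 𝒲 T ∘ₗ relabel 𝒲 f = cobracketRep 𝒲 S := by
  classical
  refine TensorProduct.ext (Finsupp.lhom_ext fun G c => LinearMap.ext fun x => ?_)
  change cobracketRep 𝒲 T (relabel 𝒲 f (Finsupp.single G c ⊗ₜ x)) =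
    cobracketRep 𝒲 S (Finsupp.single G c ⊗ₜ x)
  simp only [relabel, TensorProduct.map_tmul, Finsupp.lmapDomain_apply, Finsupp.mapDomain_single, cobracketRep,
    TensorProduct.lift.tmul, Finsupp.linearCombination_single, LinearMap.smul_apply,
    LinearMap.sum_apply]
  congr 1
  symm
  have he : ∀ e : S × S, G.Edge e.1 e.2 ↔
      (G.map f).Edge ((f.prodCongr f) e).1 ((f.prodCongr f) e).2 := by
    intro e
    simp [SGraph.map]
  refine Fintype.sum_equiv (Equiv.subtypeEquiv (p := fun e : S × S => G.Edge e.1 e.2)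
    (q := fun e : T × T => (G.map f).Edge e.1 e.2) (f.prodCongr f) he) _ _ fun e => ?_
  rw [← edgeTerm_map 𝒲 f G e.2 ((he e.1).1 e.2)]
  rfl

/-- The cobracket on the weight `n` part of `Ḡ(W)`. -/
noncomputable def cobracketN (n : ℕ) : GbarN 𝒲 n →ₗ[k] Gbar 𝒲 ⊗[k] Gbar 𝒲 :=
  Representation.Coinvariants.lift (graphRep 𝒲 n) (cobracketRep 𝒲 (Fin n)) fun σ =>
    cobracketRep_relabel 𝒲 σ

/-- The anti-commutative graph cobracket `]·[ : Ḡ(W) → Ḡ(W) ⊗ Ḡ(W)`. -/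
noncomputable def cobracket : Gbar 𝒲 →ₗ[k] Gbar 𝒲 ⊗[k] Gbar 𝒲 :=
  DirectSum.toModule k ℕ _ (cobracketN 𝒲)

/-! ### Arrow-reversing and Arnold relations, and the space `Ē(W)` -/

/-- The arrow-reversing and Arnold expressions in `Gr(S)`. The relation `R` describes the edges
which are common to all graphs of the expression. -/
inductive IsArnoldExpr (k : Type*) [CommRing k] (S : Type) : (SGraph S →₀ k) → Prop
  | arrow (G G' : SGraph S) (R : S → S → Prop) (a b : S)
      (h : ∀ x y, G.Edge x y ↔ R x y ∨ (x = a ∧ y = b))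
      (h' : ∀ x y, G'.Edge x y ↔ R x y ∨ (x = b ∧ y = a)) :
      IsArnoldExpr k S (Finsupp.single G 1 + Finsupp.single G' 1)
  | arnold (G₁ G₂ G₃ : SGraph S) (R : S → S → Prop) (a b c : S)
      (h₁ : ∀ x y, G₁.Edge x y ↔ R x y ∨ (x = a ∧ y = b) ∨ (x = b ∧ y = c))
      (h₂ : ∀ x y, G₂.Edge x y ↔ R x y ∨ (x = b ∧ y = c) ∨ (x = c ∧ y = a))
      (h₃ : ∀ x y, G₃.Edge x y ↔ R x y ∨ (x = c ∧ y = a) ∨ (x = a ∧ y = b)) :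
      IsArnoldExpr k S
        (Finsupp.single G₁ 1 + Finsupp.single G₂ 1 + Finsupp.single G₃ 1)

/-- The weight `n` part of the subspace `Arn(W)` of `Ḡ(W)` which is spanned by the
arrow-reversing and Arnold expressions. -/
noncomputable def arn (n : ℕ) : Submodule k (GbarN 𝒲 n) :=
  Submodule.span k {x | ∃ r : SGraph (Fin n) →₀ k, IsArnoldExpr k (Fin n) r ∧
    ∃ w : ⨂[k] _ : Fin n, W, x = mkGbar 𝒲 n (r ⊗ₜ w)}

/-- `Ē(W)`, the quotient of `Ḡ(W)` by the arrow-reversing and Arnold relations. -/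
abbrev Ebar : Type _ := ⨁ n : ℕ, GbarN 𝒲 n ⧸ arn 𝒲 n

/-- The quotient map `Ḡ(W) → Ē(W)`. -/
noncomputable def toEbar : Gbar 𝒲 →ₗ[k] Ebar 𝒲 :=
  DirectSum.lmap fun n => (arn 𝒲 n).mkQ

/-- The map sending `w₁ ⊗ ⋯ ⊗ wₙ₊₁` to the class of the long graph `1 → 2 → ⋯ → n + 1` with
vertices labelled by `w₁, …, wₙ₊₁`. -/
noncomputable def graphify (n : ℕ) : (⨂[k]^(n + 1) W) →ₗ[k] GbarN 𝒲 (n + 1) :=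
  mkGbar 𝒲 (n + 1) ∘ₗ
    TensorProduct.mk k _ _ (Finsupp.single (SGraph.long n) 1)

/-! ### The cotensor coalgebra -/

/-- The underlying space `⨁ n, W^{⊗ n}` of the cotensor coalgebra. -/
abbrev Cotensor (k : Type*) [CommRing k] (W : Type*) [AddCommGroup W] [Module k W] : Type _ :=
  ⨁ n : ℕ, ⨂[k]^n W

/-- The element of the cotensor coalgebra given by a tensor whose index set is any finite
linearly ordered set. -/
noncomputable def toCotensor (S : Type) [Fintype S] [LinearOrder S] :
    (⨂[k] _ : S, W) →ₗ[k] Cotensor k W :=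
  DirectSum.lof k ℕ (fun n => ⨂[k]^n W) (Fintype.card S) ∘ₗ
    koszul 𝒲 (Fintype.orderIsoFinOfCardEq S rfl).symm.toEquiv

/-- The anti-cocommutative coproduct `Δ - τ Δ` in weight `n`, where `Δ` is deconcatenation and
`τ` is the twisting map with Koszul sign: it sends `w₁ | ⋯ | wₙ` to the sum over `0 ≤ i ≤ n` of
`w₁ | ⋯ | wᵢ ⊗ wᵢ₊₁ | ⋯ | wₙ - (±) wᵢ₊₁ | ⋯ | wₙ ⊗ w₁ | ⋯ | wᵢ`. -/
noncomputable def antiCoprodN (n : ℕ) :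
    (⨂[k]^n W) →ₗ[k] Cotensor k W ⊗[k] Cotensor k W :=
  ∑ i : Fin (n + 1),
    (TensorProduct.map (toCotensor 𝒲 _) (toCotensor 𝒲 _) ∘ₗ
        unshuffle 𝒲 (Finset.univ.filter fun j : Fin n => (j : ℕ) < i)
          (Finset.univ.filter fun j : Fin n => ¬ (j : ℕ) < i) (by simp) -
      TensorProduct.map (toCotensor 𝒲 _) (toCotensor 𝒲 _) ∘ₗ
        unshuffle 𝒲 (Finset.univ.filter fun j : Fin n => ¬ (j : ℕ) < i)
          (Finset.univ.filter fun j : Fin n => (j : ℕ) < i) (by simp))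

/-- The anti-cocommutative coproduct `Δ - τ Δ` on the cotensor coalgebra. -/
noncomputable def antiCoprod : Cotensor k W →ₗ[k] Cotensor k W ⊗[k] Cotensor k W :=
  DirectSum.toModule k ℕ _ (antiCoprodN 𝒲)

end GraphCoalgebra

/-! ### Inductive quotient by the kernel of a cobracket -/

section InductiveQuotient

variable {k : Type*} [CommRing k] {A : ℕ → Type*} [∀ n, AddCommGroup (A n)] [∀ n, Module k (A n)]

/-- The subspaces `K n` of `A n` by which one divides to form the inductive quotient: nothing is
divided out in weight `1`, and for `n ≠ 1` the subspace `K n` is the kernel of the map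
`A n → (⨁ m < n, A m ⧸ K m) ⊗ (⨁ m < n, A m ⧸ K m)` induced by `δ`. -/
noncomputable def inductiveKer (δ : (⨁ n, A n) →ₗ[k] (⨁ n, A n) ⊗[k] (⨁ n, A n)) (n : ℕ) :
    Submodule k (A n) :=
  if n = 1 then ⊥ else
    let q : (⨁ n, A n) →ₗ[k] ((m : Fin n) → A m ⧸ inductiveKer δ m) :=
      LinearMap.pi fun m => (inductiveKer δ m).mkQ ∘ₗ DirectSum.component k ℕ A m
    LinearMap.ker (TensorProduct.map q q ∘ₗ δ ∘ₗ DirectSum.lof k ℕ A n)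
termination_by n
decreasing_by all_goals exact Fin.is_lt _

/-- The inductive quotient of `⨁ n, A n` by the kernel of `δ` into lower weights. -/
abbrev InductiveQuotient (δ : (⨁ n, A n) →ₗ[k] (⨁ n, A n) ⊗[k] (⨁ n, A n)) : Type _ :=
  ⨁ n, A n ⧸ inductiveKer δ n

end InductiveQuotient

/-! The cobracket cuts edges; the key is an operation in the opposite direction. Let `joinE` send
`G₁ ⊗ G₂` to the sum, over all vertices `u` of `G₁` and `v` of `G₂`, of the graph obtained by adding
an edge `u → v`; it is well defined on `Ē(W) ⊗ Ē(W)`. Cutting `G` at an edge `e` and rejoining gives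
the graphs in which `e` is replaced by `u → v`, for all `u`, `v` on different sides of `e`, with a
sign telling in which direction the way from `u` to `v` crosses `e`. For fixed `u ≠ v`, the signed
sum of these graphs over the edges `e` between `u` and `v` is `G` itself modulo the relations
(`sum_passes_smul_relCls`, a cycle form of the Arnold relation). Hence `joinE` after the cobracket
is multiplication by `n (n - 1)` in weight `n` (`joinE_cobracketN`), and in characteristic zero the
kernel lies in `Arn` for `n ≥ 2`.

Conversely the cobracket kills `Arn` modulo relations (`arn_le_ker_cobracketN`). A cut at an edge
common to all graphs of a relation leaves the relation inside one of the two pieces, and the cuts at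
the other edges cancel in pairs by antisymmetry. This gives part 2. Parts 1 and 3 follow by
induction on the weight, because over a field the kernel of `f ⊗ f` depends only on the kernel of
`f` (`inductiveKer_eq_ker`).

For part 4, send a tensor to the long graph which it labels. This map `longMap` is compatible with
the cobrackets, since deconcatenation cuts a long graph at its edges. It is injective in weight 1,
and it is surjective because long graphs span modulo the relations (`graphCls_mem_of_isLong`). By
part 2 and the compatibility its kernels satisfy the recursion that defines the inductive quotient
of `TW`, so the first isomorphism theorem applies. -/

theorem SimpleGraph.Reachable.eq_of_forall_adj {V X : Type*} {H : SimpleGraph V} {f : V → X}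
    (hf : ∀ x y, H.Adj x y → f x = f y) {x y : V} (h : H.Reachable x y) : f x = f y := by
  obtain ⟨p⟩ := h
  induction p with
  | nil => rfl
  | cons hadj _ ih => exact (hf _ _ hadj).trans ih

theorem SimpleGraph.Reachable.of_forall_adj {V : Type*} {H H' : SimpleGraph V}
    (hf : ∀ x y, H.Adj x y → H'.Reachable x y) {x y : V} (h : H.Reachable x y) :
    H'.Reachable x y := by
  obtain ⟨p⟩ := h
  induction p with
  | nil => exact .refl _
  | cons hadj _ ih => exact (hf _ _ hadj).trans ih

/-! ### Constructing trees: potentials, joining two trees, replacing an edge. -/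

namespace SGraph

variable {S T A B : Type}

/-- A relation is the edge relation of a graph if it is connected and if for each of its edges
there is a function that changes along this edge only. -/
def ofPotential (F : S → S → Prop) (hc : (SimpleGraph.fromRel F).Connected)
    (hF : ∀ a b, F a b → ∃ f : S → ℤ, f a ≠ f b ∧
      ∀ x y, F x y → ¬ (x = a ∧ y = b) → f x = f y) : SGraph S where
  Edge := F
  asymm a b hab hba := by
    obtain ⟨f, hne, hf⟩ := hF a b hab
    -- The reversed edge `b → a` would be one of the edges along which `f` is constant.
    refine hne (hf b a hba ?_).symm
    rintro ⟨rfl, -⟩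
    exact hne rfl
  isTree := by
    refine ⟨hc, SimpleGraph.isAcyclic_iff_forall_adj_isBridge.2 ?_⟩
    have key : ∀ a b, F a b → (SimpleGraph.fromRel F).IsBridge s(a, b) := by
      intro a b hab
      rw [SimpleGraph.isBridge_iff]
      intro hr
      obtain ⟨f, hne, hf⟩ := hF a b hab
      refine hne (hr.eq_of_forall_adj fun x y hxy => ?_)
      rw [SimpleGraph.deleteEdges_adj, SimpleGraph.fromRel_adj, Set.mem_singleton_iff,
        Sym2.eq_iff] at hxy
      obtain ⟨⟨-, h | h⟩, hn⟩ := hxy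
      · exact hf x y h fun hh => hn (Or.inl hh)
      · exact (hf y x h fun hh => hn (Or.inr ⟨hh.2, hh.1⟩)).symm
    intro a b hab
    rcases hab.2 with h | h
    · exact key a b h
    · rw [Sym2.eq_swap]
      exact key b a h

theorem cut_adj_of_edge (G : SGraph S) {a b x y : S} (h : G.Edge x y)
    (hn : ¬ (x = a ∧ y = b)) : (G.cut a b).Adj x y :=
  (SimpleGraph.fromRel_adj _ _ _).2 ⟨G.ne_of_edge h, Or.inl ⟨h, hn⟩⟩

theorem not_reachable_cut [Fintype S] (G : SGraph S) {a b : S} (h : G.Edge a b) :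
    ¬ (G.cut a b).Reachable a b := by
  intro hr
  exact (G.isCompl_side h a).1 ((G.mem_side ..).2 (.refl _)) ((G.mem_side ..).2 hr.symm)

open Classical in
/-- The indicator function of the component of `a` after removing the edge from `a` to `b`. -/
noncomputable def chi (G : SGraph S) (a b x : S) : ℤ :=
  if (G.cut a b).Reachable a x then 1 else 0

theorem chi_left (G : SGraph S) (a b : S) : G.chi a b a = 1 :=
  if_pos (.refl _)

theorem chi_right [Fintype S] (G : SGraph S) {a b : S} (h : G.Edge a b) : G.chi a b b = 0 :=
  if_neg (G.not_reachable_cut h)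

theorem chi_eq_of_reachable (G : SGraph S) {a b x y : S} (h : (G.cut a b).Reachable x y) :
    G.chi a b x = G.chi a b y := by
  have : (G.cut a b).Reachable a x ↔ (G.cut a b).Reachable a y :=
    ⟨fun h' => h'.trans h, fun h' => h'.trans h.symm⟩
  simp only [chi]
  congr 1
  exact propext this

theorem chi_eq_of_edge (G : SGraph S) {a b x y : S} (h : G.Edge x y)
    (hn : ¬ (x = a ∧ y = b)) : G.chi a b x = G.chi a b y :=
  G.chi_eq_of_reachable (G.cut_adj_of_edge h hn).reachable

/-- The joining of two graphs by an additional edge from `u` to `v`. -/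
def joinSum [Fintype A] [Fintype B] (G : SGraph A) (H : SGraph B) (u : A) (v : B) :
    SGraph (A ⊕ B) :=
  ofPotential
    (fun x y => (∃ a a', x = .inl a ∧ y = .inl a' ∧ G.Edge a a') ∨
      (∃ b b', x = .inr b ∧ y = .inr b' ∧ H.Edge b b') ∨ (x = .inl u ∧ y = .inr v))
    (by
      set F : A ⊕ B → A ⊕ B → Prop := fun x y => _
      have hl : ∀ a, (SimpleGraph.fromRel F).Reachable (.inl u) (.inl a) := by
        intro a
        refine (G.isTree.1.preconnected u a).map (⟨Sum.inl, ?_⟩ :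
          SimpleGraph.fromRel G.Edge →g SimpleGraph.fromRel F)
        rintro x y ⟨hne, h⟩
        refine ⟨fun e => hne (Sum.inl_injective e), ?_⟩
        exact h.imp (fun h => .inl ⟨x, y, rfl, rfl, h⟩) (fun h => .inl ⟨y, x, rfl, rfl, h⟩)
      have hr : ∀ b, (SimpleGraph.fromRel F).Reachable (.inr v) (.inr b) := by
        intro b
        refine (H.isTree.1.preconnected v b).map (⟨Sum.inr, ?_⟩ :
          SimpleGraph.fromRel H.Edge →g SimpleGraph.fromRel F)
        rintro x y ⟨hne, h⟩
        refine ⟨fun e => hne (Sum.inr_injective e), ?_⟩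
        exact h.imp (fun h => .inr (.inl ⟨x, y, rfl, rfl, h⟩))
          (fun h => .inr (.inl ⟨y, x, rfl, rfl, h⟩))
      have huv : (SimpleGraph.fromRel F).Adj (.inl u) (.inr v) :=
        ⟨Sum.inl_ne_inr, .inl (.inr (.inr ⟨rfl, rfl⟩))⟩
      have hall : ∀ x, (SimpleGraph.fromRel F).Reachable (.inl u) x := by
        rintro (a | b)
        · exact hl a
        · exact huv.reachable.trans (hr b)
      exact { preconnected := fun x y => (hall x).symm.trans (hall y), nonempty := ⟨.inl u⟩ })
    (by
      rintro a b (⟨a, a', rfl, rfl, h⟩ | ⟨b, b', rfl, rfl, h⟩ | ⟨rfl, rfl⟩)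
      -- The second tree hangs on `u`, so the indicator function is extended over it by its value at
      -- `u` and does not change along the joining edge.
      · refine ⟨Sum.elim (G.chi a a') fun _ => G.chi a a' u, ?_, ?_⟩
        · simp [chi_left, G.chi_right h]
        · rintro x y (⟨x, y, rfl, rfl, h'⟩ | ⟨b, b', rfl, rfl, h'⟩ | ⟨rfl, rfl⟩) hn
          · exact G.chi_eq_of_edge h' (by simpa using hn)
          · rfl
          · rfl
      · refine ⟨Sum.elim (fun _ => H.chi b b' v) (H.chi b b'), ?_, ?_⟩
        · simp [chi_left, H.chi_right h]
        · rintro x y (⟨x, y, rfl, rfl, h'⟩ | ⟨x, y, rfl, rfl, h'⟩ | ⟨rfl, rfl⟩) hn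
          · rfl
          · exact H.chi_eq_of_edge h' (by simpa using hn)
          · rfl
      -- For the joining edge the potential tells the two trees apart.
      · refine ⟨Sum.elim (fun _ => 0) fun _ => 1, by simp, ?_⟩
        rintro x y (⟨x, y, rfl, rfl, h'⟩ | ⟨b, b', rfl, rfl, h'⟩ | ⟨rfl, rfl⟩) hn
        · rfl
        · rfl
        · exact absurd ⟨rfl, rfl⟩ hn)

/-- The joining of two graphs by an additional edge from `u` to `v`, where the vertices of the
first graph are ordered before those of the second one. -/
def join [Fintype A] [Fintype B] (G : SGraph A) (H : SGraph B) (u : A) (v : B) :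
    SGraph (A ⊕ₗ B) :=
  (G.joinSum H u v).map toLex

theorem join_edge [Fintype A] [Fintype B] (G : SGraph A) (H : SGraph B) (u : A) (v : B)
    (x y : A ⊕ₗ B) : (G.join H u v).Edge x y ↔
      (∃ a a', x = toLex (.inl a) ∧ y = toLex (.inl a') ∧ G.Edge a a') ∨
      (∃ b b', x = toLex (.inr b) ∧ y = toLex (.inr b') ∧ H.Edge b b') ∨
      (x = toLex (.inl u) ∧ y = toLex (.inr v)) :=
  Iff.rfl

theorem sideEquiv_symm_inl [Fintype S] [LinearOrder S] {A B : Finset S} (h : ∀ x, x ∈ A ↔ x ∉ B)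
    (a : A) :
    (sideEquiv A B h).symm (toLex (.inl a)) = a := rfl

theorem sideEquiv_symm_inr [Fintype S] [LinearOrder S] {A B : Finset S} (h : ∀ x, x ∈ A ↔ x ∉ B)
    (b : B) :
    (sideEquiv A B h).symm (toLex (.inr b)) = b := rfl

/-- The graph obtained by joining graphs on complementary sets of vertices. -/
noncomputable def glue [Fintype S] [LinearOrder S] {A B : Finset S} (h : ∀ x, x ∈ A ↔ x ∉ B)
    (P : SGraph A) (Q : SGraph B) (u : A) (v : B) : SGraph S :=
  (P.join Q u v).map (sideEquiv A B h).symm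

theorem glue_edge [Fintype S] [LinearOrder S] {A B : Finset S} (h : ∀ x, x ∈ A ↔ x ∉ B)
    (P : SGraph A) (Q : SGraph B) (u : A) (v : B) (x y : S) : (glue h P Q u v).Edge x y ↔
      (∃ a a' : A, x = a ∧ y = a' ∧ P.Edge a a') ∨
      (∃ b b' : B, x = b ∧ y = b' ∧ Q.Edge b b') ∨ (x = u ∧ y = v) := by
  change (P.join Q u v).Edge (sideEquiv A B h x) (sideEquiv A B h y) ↔ _
  simp only [join_edge, ← Equiv.eq_symm_apply, sideEquiv_symm_inl, sideEquiv_symm_inr]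

theorem glue_piece_edge [Fintype S] [LinearOrder S] (G : SGraph S) {a b : S} (hab : G.Edge a b)
    {p q : S} (h : ∀ x, x ∈ G.side a b p ↔ x ∉ G.side a b q)
    (u : G.side a b p) (v : G.side a b q) (x y : S) :
    (glue h (G.piece hab p) (G.piece hab q) u v).Edge x y ↔
      (G.Edge x y ∧ ¬ (x = a ∧ y = b)) ∨ (x = u ∧ y = v) := by
  rw [glue_edge, ← or_assoc]
  refine or_congr_left ⟨?_, fun hxy => ?_⟩
  · rintro (⟨x, y, rfl, rfl, h⟩ | ⟨x, y, rfl, rfl, h⟩) <;> exact h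
  · have hr := (G.cut_adj_of_edge hxy.1 hxy.2).reachable
    by_cases hx : x ∈ G.side a b p
    · exact .inl ⟨⟨x, hx⟩, ⟨y, (G.mem_side ..).2 (((G.mem_side ..).1 hx).trans hr)⟩, rfl, rfl, hxy⟩
    · have hx' : x ∈ G.side a b q := by
        by_contra hq
        exact hx ((h x).2 hq)
      exact .inr ⟨⟨x, hx'⟩, ⟨y, (G.mem_side ..).2 (((G.mem_side ..).1 hx').trans hr)⟩,
        rfl, rfl, hxy⟩

/-- An edge may be replaced by any edge between the two components that remain after its
removal. -/
theorem exists_replace [Fintype S] (G : SGraph S) {a b : S} (hab : G.Edge a b) {u v : S}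
    (huv : ¬ (G.cut a b).Reachable u v) : ∃ G' : SGraph S, ∀ x y, G'.Edge x y ↔
      (G.Edge x y ∧ ¬ (x = a ∧ y = b)) ∨ (x = u ∧ y = v) := by
  -- `glue` needs some linear order to be formulated; its edge relation does not depend on the
  -- choice.
  let _ : LinearOrder S := LinearOrder.lift' (Fintype.equivFin S) (Fintype.equivFin S).injective
  have hc := G.isCompl_side hab
  have hc' : ∀ x, x ∈ G.side a b b ↔ x ∉ G.side a b a := fun x => by rw [hc x, not_not]
  by_cases hu : u ∈ G.side a b a
  · have hv : v ∈ G.side a b b := (hc' v).2 fun hv =>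
      huv (((G.mem_side ..).1 hu).symm.trans ((G.mem_side ..).1 hv))
    exact ⟨_, G.glue_piece_edge hab hc ⟨u, hu⟩ ⟨v, hv⟩⟩
  · have hu' := (hc' u).2 hu
    have hv : v ∈ G.side a b a := (hc v).2 fun hv =>
      huv (((G.mem_side ..).1 hu').symm.trans ((G.mem_side ..).1 hv))
    exact ⟨_, G.glue_piece_edge hab hc' ⟨u, hu'⟩ ⟨v, hv⟩⟩

end SGraph

/-! ### Unlabelled graphs modulo the arrow-reversing and Arnold expressions. -/

section Eil

variable (k : Type*) [CommRing k] {S T : Type}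

/-- The quotient of `Gr(S)` by the arrow-reversing and Arnold expressions. -/
abbrev Eil (S : Type) : Type _ :=
  (SGraph S →₀ k) ⧸ Submodule.span k {r | IsArnoldExpr k S r}

/-- The class of a graph modulo the arrow-reversing and Arnold expressions. -/
noncomputable def graphCls (G : SGraph S) : Eil k S :=
  Submodule.Quotient.mk (Finsupp.single G 1)

open Classical in
/-- The class of the graph with a given edge relation, or zero if there is no such graph. -/
noncomputable def relCls (F : S → S → Prop) : Eil k S :=
  if h : ∃ G : SGraph S, ∀ x y, G.Edge x y ↔ F x y then graphCls k h.choose else 0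

variable {k}

theorem relCls_eq (G : SGraph S) {F : S → S → Prop} (h : ∀ x y, G.Edge x y ↔ F x y) :
    relCls k F = graphCls k G := by
  have hex : ∃ G : SGraph S, ∀ x y, G.Edge x y ↔ F x y := ⟨G, h⟩
  rw [relCls, dif_pos hex]
  congr 1
  ext x y
  rw [hex.choose_spec, h]

theorem eil_ext {E : Type*} [AddCommGroup E] [Module k E] {φ ψ : Eil k S →ₗ[k] E}
    (h : ∀ G, φ (graphCls k G) = ψ (graphCls k G)) : φ = ψ := by
  refine Submodule.linearMap_qext _ (Finsupp.lhom_ext fun G c => ?_)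
  have : Finsupp.single G c = c • Finsupp.single G (1 : k) := by simp
  rw [this, map_smul, map_smul]
  exact congrArg _ (h G)

theorem graphCls_arrow (G G' : SGraph S) (R : S → S → Prop) (a b : S)
    (h : ∀ x y, G.Edge x y ↔ R x y ∨ (x = a ∧ y = b))
    (h' : ∀ x y, G'.Edge x y ↔ R x y ∨ (x = b ∧ y = a)) :
    graphCls k G + graphCls k G' = 0 :=
  (Submodule.Quotient.mk_eq_zero _).2 (Submodule.subset_span (.arrow G G' R a b h h'))

theorem graphCls_arnold (G₁ G₂ G₃ : SGraph S) (R : S → S → Prop) (a b c : S)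
    (h₁ : ∀ x y, G₁.Edge x y ↔ R x y ∨ (x = a ∧ y = b) ∨ (x = b ∧ y = c))
    (h₂ : ∀ x y, G₂.Edge x y ↔ R x y ∨ (x = b ∧ y = c) ∨ (x = c ∧ y = a))
    (h₃ : ∀ x y, G₃.Edge x y ↔ R x y ∨ (x = c ∧ y = a) ∨ (x = a ∧ y = b)) :
    graphCls k G₁ + graphCls k G₂ + graphCls k G₃ = 0 :=
  (Submodule.Quotient.mk_eq_zero _).2 (Submodule.subset_span (.arnold G₁ G₂ G₃ R a b c h₁ h₂ h₃))

variable [Fintype S]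

theorem exists_reverse (G : SGraph S) {a b : S} (hab : G.Edge a b) :
    ∃ G' : SGraph S, (∀ x y, G'.Edge x y ↔
      (G.Edge x y ∧ ¬ (x = a ∧ y = b)) ∨ (x = b ∧ y = a)) ∧
      graphCls k G' = - graphCls k G := by
  obtain ⟨G', h⟩ := G.exists_replace hab (u := b) (v := a) fun hr =>
    G.not_reachable_cut hab hr.symm
  refine ⟨G', h, eq_neg_of_add_eq_zero_right
    (graphCls_arrow G G' (fun x y => G.Edge x y ∧ ¬ (x = a ∧ y = b)) a b (fun x y => ?_) h)⟩
  by_cases hh : x = a ∧ y = b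
  · simp [hh, hab]
  · simp [hh]

/-- The Arnold relation, written with the orientations `a → b`, `b → c`, `a → c`. -/
theorem graphCls_triangle (H₁ H₂ H₃ : SGraph S) (R : S → S → Prop) (a b c : S)
    (hR : ¬ R a c) (hab : a ≠ b) (hbc : b ≠ c)
    (h₁ : ∀ x y, H₁.Edge x y ↔ R x y ∨ (x = a ∧ y = b) ∨ (x = b ∧ y = c))
    (h₂ : ∀ x y, H₂.Edge x y ↔ R x y ∨ (x = b ∧ y = c) ∨ (x = a ∧ y = c))
    (h₃ : ∀ x y, H₃.Edge x y ↔ R x y ∨ (x = a ∧ y = c) ∨ (x = a ∧ y = b)) :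
    graphCls k H₁ = graphCls k H₂ + graphCls k H₃ := by
  -- Turning `a → c` into `c → a` in `H₂` and `H₃` produces the cyclic Arnold expression at the cost
  -- of one sign each. The edge removed must not be one of the common edges, whence `hR`.
  obtain ⟨G₂, hG₂, e₂⟩ := exists_reverse (k := k) H₂ ((h₂ a c).2 (by simp))
  obtain ⟨G₃, hG₃, e₃⟩ := exists_reverse (k := k) H₃ ((h₃ a c).2 (by simp))
  have key := graphCls_arnold (k := k) H₁ G₂ G₃ R a b c h₁ (fun x y => ?_) (fun x y => ?_)
  · rw [e₂, e₃] at key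
    rw [add_neg_eq_zero] at key
    rw [← key]
    abel
  · rw [hG₂, h₂]
    grind
  · rw [hG₃, h₃]
    grind

/-- Up to common edges, `H₁`, `H₂`, `H₃` contain the pairs of sides `{uw, uv}`, `{uw, wv}`, `{uv,
wv}` of the triangle `u, w, v`, so this is the Arnold relation. The sign `s` records the orientation
of the side between `u` and `w`. This is the inductive step of the cycle identity. -/
theorem graphCls_step (G G' : SGraph S) {u v w a b c d : S} {s : ℤ}
    (he₀ : (c = u ∧ d = w ∧ s = 1) ∨ (c = w ∧ d = u ∧ s = -1))
    (hcd : G.Edge c d) (hab : G.Edge a b) (hne : ¬ (a = c ∧ b = d)) (hwv : w ≠ v) (huv : u ≠ v)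
    (huv1 : ¬ G.Edge u v) (hwv1 : ¬ (G.Edge w v ∧ ¬ (w = a ∧ v = b)))
    (hG' : ∀ x y, G'.Edge x y ↔ (G.Edge x y ∧ ¬ (x = c ∧ y = d)) ∨ (x = u ∧ y = v))
    (H₁ H₂ H₃ : SGraph S)
    (h₁ : ∀ x y, H₁.Edge x y ↔ (G.Edge x y ∧ ¬ (x = a ∧ y = b)) ∨ (x = u ∧ y = v))
    (h₂ : ∀ x y, H₂.Edge x y ↔ (G.Edge x y ∧ ¬ (x = a ∧ y = b)) ∨ (x = w ∧ y = v))
    (h₃ : ∀ x y, H₃.Edge x y ↔ (G'.Edge x y ∧ ¬ (x = a ∧ y = b)) ∨ (x = w ∧ y = v)) :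
    graphCls k H₁ = graphCls k H₂ - s • graphCls k H₃ := by
  have hcd' := G.ne_of_edge hcd
  let R : S → S → Prop := fun x y => G.Edge x y ∧ ¬ (x = a ∧ y = b) ∧ ¬ (x = c ∧ y = d)
  rcases he₀ with ⟨rfl, rfl, rfl⟩ | ⟨rfl, rfl, rfl⟩
  · have := graphCls_triangle (k := k) H₂ H₃ H₁ R c d v (fun h => huv1 h.1) hcd' hwv
      (fun x y => by rw [h₂]; grind) (fun x y => by rw [h₃, hG']; grind)
      (fun x y => by rw [h₁]; grind)
    rw [this]
    simp
  · have := graphCls_triangle (k := k) H₁ H₃ H₂ R c d v (fun h => hwv1 ⟨h.1, h.2.1⟩) hcd' huv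
      (fun x y => by rw [h₁]; grind) (fun x y => by rw [h₃, hG']; grind)
      (fun x y => by rw [h₂]; grind)
    rw [this]
    simp [add_comm]

end Eil

/-! ### The cycle identity for replacing the edges between two vertices. -/

section Cycle

variable {k : Type*} [CommRing k] {S : Type}

namespace SGraph

/-- The edge relation of the graph in which the edge from `a` to `b` is replaced by an edge from
`u` to `v`. -/
def replaceRel (G : SGraph S) (a b u v : S) (x y : S) : Prop :=
  (G.Edge x y ∧ ¬ (x = a ∧ y = b)) ∨ (x = u ∧ y = v)

open Classical in
/-- The multiplicity with which the edge `e` is traversed on the way from `u` to `v`. -/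
noncomputable def passes (G : SGraph S) (u v : S) (e : S × S) : ℤ :=
  if G.Edge e.1 e.2 then G.chi e.1 e.2 u - G.chi e.1 e.2 v else 0

/-- A path from `u` to `v` never returns to `u`, so after its first step to `w` it avoids the edge
just used. The sign `s` says whether that edge is followed or traversed backwards. -/
theorem exists_first_edge (G : SGraph S) {u v : S} (huv : u ≠ v) :
    ∃ c d w : S, ∃ s : ℤ, ((c = u ∧ d = w ∧ s = 1) ∨ (c = w ∧ d = u ∧ s = -1)) ∧
      G.Edge c d ∧ (G.cut c d).Reachable w v := by
  obtain ⟨p, hp⟩ := G.isTree.1.exists_isPath u v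
  cases p with
  | nil => exact absurd rfl huv
  | @cons _ w _ huw p =>
    rw [SimpleGraph.Walk.cons_isPath_iff] at hp
    have key : ∀ c d, (c = u ∧ d = w) ∨ (c = w ∧ d = u) → (G.cut c d).Reachable w v := by
      intro c d hcd
      refine ⟨p.transfer _ fun e he => ?_⟩
      induction e using Sym2.ind with
      | _ x y =>
        have hx := p.fst_mem_support_of_mem_edges he
        have hy := p.snd_mem_support_of_mem_edges he
        have hxu : x ≠ u := fun h => hp.2 (h ▸ hx)
        have hyu : y ≠ u := fun h => hp.2 (h ▸ hy)
        have hadj := p.adj_of_mem_edges he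
        rw [SimpleGraph.mem_edgeSet]
        rcases hadj.2 with h | h
        · exact G.cut_adj_of_edge h (by grind)
        · exact (G.cut_adj_of_edge h (by grind)).symm
    rcases huw.2 with h | h
    · exact ⟨u, w, w, 1, .inl ⟨rfl, rfl, rfl⟩, h, key _ _ (.inl ⟨rfl, rfl⟩)⟩
    · exact ⟨w, u, w, -1, .inr ⟨rfl, rfl, rfl⟩, h, key _ _ (.inr ⟨rfl, rfl⟩)⟩

/-- The way from `w` to `v` avoids `c → d`, so it survives in `G'` and crosses the same edges in the
same directions. -/
theorem passes_replace [Fintype S] (G G' : SGraph S) {u v w c d : S}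
    (hr : (G.cut c d).Reachable w v) (huv : ¬ G.Edge u v)
    (hG' : ∀ x y, G'.Edge x y ↔ G.replaceRel c d u v x y) (hcd : G.Edge c d) (e : S × S) :
    G'.passes w v e = G.passes w v e := by
  obtain ⟨a, b⟩ := e
  have hG'r : ∀ f : S → ℤ, (∀ x y, G.Edge x y → ¬ (x = c ∧ y = d) → f x = f y) → f w = f v := by
    intro f hf
    refine hr.eq_of_forall_adj fun x y hxy => ?_
    obtain ⟨-, h | h⟩ := hxy
    · exact hf x y h.1 h.2
    · exact (hf y x h.1 h.2).symm
  by_cases h1 : a = c ∧ b = d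
  · obtain ⟨rfl, rfl⟩ := h1
    have hn : ¬ G'.Edge a b := by
      rw [hG', replaceRel]
      rintro (h | ⟨rfl, rfl⟩)
      · exact h.2 ⟨rfl, rfl⟩
      · exact huv hcd
    simp [passes, hn, G.chi_eq_of_reachable hr]
  by_cases h2 : a = u ∧ b = v
  · obtain ⟨rfl, rfl⟩ := h2
    have h3 := hG'r (G'.chi a b) fun x y h h' =>
      G'.chi_eq_of_edge ((hG' x y).2 (.inl ⟨h, h'⟩)) (by rintro ⟨rfl, rfl⟩; exact huv h)
    simp [passes, huv, h3]
  have hiff : G'.Edge a b ↔ G.Edge a b := by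
    rw [hG', replaceRel]
    tauto
  by_cases h : G.Edge a b
  swap
  · simp [passes, hiff, h]
  -- Both indicator functions drop from 1 to 0 along `a → b`, so their difference is constant along
  -- this edge too.
  have h3 := hG'r (fun x => G'.chi a b x - G.chi a b x) fun x y hx hx' => by
    by_cases hxy : x = a ∧ y = b
    · obtain ⟨rfl, rfl⟩ := hxy
      simp [chi_left, chi_right, h, hiff]
    · rw [G'.chi_eq_of_edge ((hG' x y).2 (.inl ⟨hx, hx'⟩)) hxy, G.chi_eq_of_edge hx hxy]
  simp only [passes, hiff, h, if_true]
  linarith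

theorem passes_ne_zero (G : SGraph S) {u v a b : S} (h : G.passes u v (a, b) ≠ 0) :
    G.Edge a b ∧ ¬ (G.cut a b).Reachable u v := by
  by_cases hab : G.Edge a b
  · refine ⟨hab, fun hr => h ?_⟩
    simp [passes, G.chi_eq_of_reachable hr]
  · simp [passes, hab] at h

end SGraph

open SGraph Classical in
/-- Replacing in turn all edges on the way from `u` to `v` by an edge from `u` to `v` yields the
original graph, modulo the arrow-reversing and Arnold expressions. -/
theorem sum_passes_smul_relCls [Fintype S] (G : SGraph S) {u v : S} (huv : u ≠ v) :
    ∑ e : S × S, G.passes u v e • relCls k (G.replaceRel e.1 e.2 u v) = graphCls k G := by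
  -- Induction on the number of edges between `u` and `v`; the graph varies as well, since the step
  -- also uses `G'`.
  induction hn : (Finset.univ.filter fun e => G.passes u v e ≠ 0).card using Nat.strong_induction_on
    generalizing G u v with
  | _ n ih =>
  obtain ⟨c, d, w, s, he₀, hcd, hr⟩ := G.exists_first_edge huv
  have hne := G.ne_of_edge hcd
  have huw : u ≠ w := by grind
  have hs : G.passes u v (c, d) = s := by
    simp only [passes, hcd, if_true]
    rw [← G.chi_eq_of_reachable hr]
    rcases he₀ with ⟨rfl, rfl, rfl⟩ | ⟨rfl, rfl, rfl⟩ <;> simp [chi_left, chi_right, hcd]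
  have hs0 : G.passes w v (c, d) = 0 := by
    simp [passes, G.chi_eq_of_reachable hr]
  have hother : ∀ e, e ≠ (c, d) → G.passes u v e = G.passes w v e := by
    rintro ⟨a, b⟩ he
    have : G.chi a b c = G.chi a b d := G.chi_eq_of_edge hcd (by grind)
    simp only [passes]
    grind
  by_cases hwv : w = v
  · subst hwv
    rw [Finset.sum_eq_single (c, d), hs]
    · rcases he₀ with ⟨rfl, rfl, rfl⟩ | ⟨rfl, rfl, rfl⟩
      · rw [one_smul]
        exact relCls_eq G fun x y => by rw [replaceRel]; grind
      · obtain ⟨G', hG', hc⟩ := exists_reverse (k := k) G hcd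
        rw [relCls_eq G' fun x y => by rw [hG', replaceRel], hc]
        simp
    · intro e _ he
      rw [hother e he]
      simp [passes]
    · simp
  have hnr : ¬ (G.cut c d).Reachable u v := by
    intro h
    have h' := h.trans hr.symm
    rcases he₀ with ⟨rfl, rfl, -⟩ | ⟨rfl, rfl, -⟩
    · exact G.not_reachable_cut hcd h'
    · exact G.not_reachable_cut hcd h'.symm
  have huv1 : ¬ G.Edge u v := fun h => hnr (G.cut_adj_of_edge h (by grind)).reachable
  obtain ⟨G', hG'⟩ := G.exists_replace hcd hnr
  have hp := G.passes_replace G' hr huv1 hG' hcd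
  have hlt : (Finset.univ.filter fun e => G.passes w v e ≠ 0).card < n := by
    rw [← hn]
    refine Finset.card_lt_card ?_
    rw [Finset.ssubset_iff_of_subset]
    · refine ⟨(c, d), ?_, ?_⟩
      · rcases he₀ with ⟨-, -, rfl⟩ | ⟨-, -, rfl⟩ <;> simp [hs]
      · simp [hs0]
    · intro e he
      simp only [Finset.mem_filter, Finset.mem_univ, true_and] at he ⊢
      rw [hother e (by rintro rfl; exact he hs0)]
      exact he
  have ih1 := ih _ hlt G hwv rfl
  have ih2 := ih _ hlt G' hwv (by simp only [hp])
  -- The first edge contributes `s • G'`; for every other edge the Arnold relation in the triangle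
  -- `u, w, v` trades the new edge `u → v` for `w → v`. After summation the induction hypotheses
  -- turn the last two terms into `G` and `-s • G'`, and the copies of `G'` cancel.
  have hterm : ∀ e : S × S, G.passes u v e • relCls k (G.replaceRel e.1 e.2 u v) =
      (if e = (c, d) then s • graphCls k G' else 0) +
        G.passes w v e • relCls k (G.replaceRel e.1 e.2 w v) -
        s • (G'.passes w v e • relCls k (G'.replaceRel e.1 e.2 w v)) := by
    rintro ⟨a, b⟩
    rw [hp]
    by_cases he : (a, b) = (c, d)
    · rw [if_pos he, he, hs, hs0]
      simp only [zero_smul, smul_zero, add_zero, sub_zero]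
      rw [relCls_eq (F := G.replaceRel c d u v) G' hG']
    rw [if_neg he, hother _ he, zero_add]
    by_cases h0 : G.passes w v (a, b) = 0
    · simp [h0]
    obtain ⟨hab, hw⟩ := G.passes_ne_zero h0
    have hu := (G.passes_ne_zero (u := u) (v := v) (a := a) (b := b)
      (by rw [hother _ he]; exact h0)).2
    obtain ⟨hab', hw'⟩ := G'.passes_ne_zero (u := w) (v := v) (a := a) (b := b)
      (by rw [hp]; exact h0)
    obtain ⟨H₁, h₁⟩ := G.exists_replace hab hu
    obtain ⟨H₂, h₂⟩ := G.exists_replace hab hw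
    obtain ⟨H₃, h₃⟩ := G'.exists_replace hab' hw'
    have := graphCls_step (k := k) G G' he₀ hcd hab (by grind) hwv huv huv1
      (fun h => hw (G.cut_adj_of_edge h.1 h.2).reachable) hG' H₁ H₂ H₃ h₁ h₂ h₃
    rw [relCls_eq (F := G.replaceRel a b u v) H₁ h₁, relCls_eq (F := G.replaceRel a b w v) H₂ h₂,
      relCls_eq (F := G'.replaceRel a b w v) H₃ h₃, this, smul_sub, smul_comm]
  rw [Finset.sum_congr rfl fun e _ => hterm e, Finset.sum_sub_distrib, Finset.sum_add_distrib,
    ih1, ← Finset.smul_sum, ih2]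
  simp

end Cycle

/-- The relations are local: embedding the vertices and adding a fixed set `Q` of edges only
enlarges the set of common edges. This covers relabelling, with `Q` empty, and joining with a fixed
graph. -/
theorem IsArnoldExpr.mapDomain {k : Type*} [CommRing k] {S T : Type} (φ : SGraph S → SGraph T)
    (ι : S → T) (hι : Function.Injective ι) (Q : T → T → Prop)
    (hφ : ∀ G x y, (φ G).Edge x y ↔ Q x y ∨ ∃ x' y', x = ι x' ∧ y = ι y' ∧ G.Edge x' y')
    {r : SGraph S →₀ k} (hr : IsArnoldExpr k S r) : IsArnoldExpr k T (r.mapDomain φ) := by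
  cases hr with
  | arrow G G' R a b h h' =>
    rw [Finsupp.mapDomain_add, Finsupp.mapDomain_single, Finsupp.mapDomain_single]
    refine .arrow _ _ (fun x y => Q x y ∨ ∃ x' y', x = ι x' ∧ y = ι y' ∧ R x' y') (ι a) (ι b)
      (fun x y => ?_) (fun x y => ?_)
    · rw [hφ]
      grind
    · rw [hφ]
      grind
  | arnold G₁ G₂ G₃ R a b c h₁ h₂ h₃ =>
    rw [Finsupp.mapDomain_add, Finsupp.mapDomain_add, Finsupp.mapDomain_single,
      Finsupp.mapDomain_single, Finsupp.mapDomain_single]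
    refine .arnold _ _ _ (fun x y => Q x y ∨ ∃ x' y', x = ι x' ∧ y = ι y' ∧ R x' y')
      (ι a) (ι b) (ι c) (fun x y => ?_) (fun x y => ?_) (fun x y => ?_)
    · rw [hφ]
      grind
    · rw [hφ]
      grind
    · rw [hφ]
      grind

/-! ### Labelled graphs with arbitrary ordered vertex sets and their classes in `Ē(W)`. -/

section

variable {k : Type*} [CommRing k] {W : Type*} [AddCommGroup W] [Module k W]
  (𝒲 : ℤ → Submodule k W) [DirectSum.Decomposition 𝒲]
variable {S T : Type} [Fintype S] [LinearOrder S] [Fintype T] [LinearOrder T]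

theorem mkGbar_mem_arn {n : ℕ} {r : SGraph (Fin n) →₀ k} (hr : IsArnoldExpr k (Fin n) r)
    (w : ⨂[k] _ : Fin n, W) : mkGbar 𝒲 n (r ⊗ₜ w) ∈ arn 𝒲 n :=
  Submodule.subset_span ⟨r, hr, w, rfl⟩

theorem toEbar_lof (n : ℕ) (x : GbarN 𝒲 n) :
    toEbar 𝒲 (DirectSum.lof k ℕ (GbarN 𝒲) n x) =
      DirectSum.lof k ℕ (fun n => GbarN 𝒲 n ⧸ arn 𝒲 n) n ((arn 𝒲 n).mkQ x) := by
  rw [toEbar, DirectSum.lmap_lof]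

theorem toEbar_toGbar_arnold {r : SGraph S →₀ k} (hr : IsArnoldExpr k S r)
    (w : ⨂[k] _ : S, W) : toEbar 𝒲 (toGbar 𝒲 S (r ⊗ₜ w)) = 0 := by
  simp only [toGbar, LinearMap.comp_apply, toEbar_lof, relabel, TensorProduct.map_tmul]
  have h := hr.mapDomain (SGraph.map (Fintype.orderIsoFinOfCardEq S rfl).symm.toEquiv) _
    (Fintype.orderIsoFinOfCardEq S rfl).symm.toEquiv.injective (fun _ _ => False)
    (fun G x y => by
      simp only [false_or]
      constructor
      · intro h
        exact ⟨_, _, (Equiv.apply_symm_apply _ x).symm, (Equiv.apply_symm_apply _ y).symm, h⟩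
      · rintro ⟨x, y, rfl, rfl, h⟩
        simpa [SGraph.map] using h)
  have h0 := (Submodule.Quotient.mk_eq_zero _).2 (mkGbar_mem_arn 𝒲 h
    (koszul 𝒲 (Fintype.orderIsoFinOfCardEq S rfl).symm.toEquiv w))
  rw [Submodule.mkQ_apply]
  erw [h0]
  rw [map_zero]

/-- The map `Eil(S) ⊗ W^{⊗ S} → Ē(W)`. -/
noncomputable def eilMap (S : Type) [Fintype S] [LinearOrder S] :
    Eil k S →ₗ[k] (⨂[k] _ : S, W) →ₗ[k] Ebar 𝒲 :=
  Submodule.liftQ _ (TensorProduct.curry (toEbar 𝒲 ∘ₗ toGbar 𝒲 S)) (by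
    rw [Submodule.span_le]
    intro r hr
    exact LinearMap.ext fun w => toEbar_toGbar_arnold 𝒲 hr w)

theorem eilMap_graphCls (G : SGraph S) :
    eilMap 𝒲 S (graphCls k G) = toEbar 𝒲 ∘ₗ graphClass 𝒲 G := rfl

theorem toEbar_toGbar_tmul (r : SGraph S →₀ k) (w : ⨂[k] _ : S, W) :
    toEbar 𝒲 (toGbar 𝒲 S (r ⊗ₜ w)) = eilMap 𝒲 S (Submodule.Quotient.mk r) w := rfl

theorem toGbar_fin (n : ℕ) (x : LabelledGraphs k W (Fin n)) :
    toGbar 𝒲 (Fin n) x = DirectSum.lof k ℕ (GbarN 𝒲) n (mkGbar 𝒲 n x) := by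
  rw [toGbar_eq 𝒲 (Equiv.refl _), relabel_refl]
  rfl

end

theorem labelledGraphs_ext {k : Type*} [CommRing k] {W : Type*} [AddCommGroup W] [Module k W]
    {S : Type} {E : Type*} [AddCommGroup E] [Module k E]
    {φ ψ : LabelledGraphs k W S →ₗ[k] E}
    (h : ∀ G x, φ (Finsupp.single G 1 ⊗ₜ x) = ψ (Finsupp.single G 1 ⊗ₜ x)) : φ = ψ := by
  refine TensorProduct.ext (Finsupp.lhom_ext' fun G =>
    LinearMap.ext_ring (LinearMap.ext fun x => ?_))
  exact h G x

theorem SGraph.join_map {A B A' B' : Type} [Fintype A] [Fintype B] [Fintype A'] [Fintype B']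
    (f : A ≃ A') (g : B ≃ B') (G : SGraph A) (H : SGraph B)
    (u : A) (v : B) :
    (G.map f).join (H.map g) (f u) (g v) =
      (G.join H u v).map (((ofLex.trans (f.sumCongr g)).trans toLex : A ⊕ₗ B ≃ A' ⊕ₗ B')) := by
  ext x y
  obtain ⟨x, rfl⟩ := ((ofLex.trans (f.sumCongr g)).trans toLex : A ⊕ₗ B ≃ A' ⊕ₗ B').surjective x
  obtain ⟨y, rfl⟩ := ((ofLex.trans (f.sumCongr g)).trans toLex : A ⊕ₗ B ≃ A' ⊕ₗ B').surjective y
  change _ ↔ (G.join H u v).Edge (Equiv.symm _ (Equiv.toFun _ x)) (Equiv.symm _ (Equiv.toFun _ y))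
  rw [Equiv.toFun_as_coe, Equiv.symm_apply_apply, Equiv.symm_apply_apply, join_edge, join_edge]
  induction x using Lex.rec with | _ x => ?_
  induction y using Lex.rec with | _ y => ?_
  rcases x with x | x <;> rcases y with y | y <;> simp [SGraph.map]

/-! ### The joining operation `Ē(W) ⊗ Ē(W) → Ē(W)`. -/

section Joining

variable {k : Type*} [CommRing k] {W : Type*} [AddCommGroup W] [Module k W]
  (𝒲 : ℤ → Submodule k W) [DirectSum.Decomposition 𝒲]
variable {S T A B A' B' : Type} [Fintype S] [LinearOrder S] [Fintype T] [LinearOrder T]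
  [Fintype A] [LinearOrder A] [Fintype B] [LinearOrder B]
  [Fintype A'] [LinearOrder A'] [Fintype B'] [LinearOrder B']

/-- `W^{⊗ A} ⊗ W^{⊗ B} ≅ W^{⊗ (A ⊔ B)}`, where `A` is ordered before `B`. -/
noncomputable def mergeSum (A B : Type) :
    (⨂[k] _ : A, W) ⊗[k] (⨂[k] _ : B, W) →ₗ[k] (⨂[k] _ : A ⊕ₗ B, W) :=
  (PiTensorProduct.reindex k (fun _ => W) (ofLex (α := A ⊕ B))).symm.toLinearMap ∘ₗ
    (PiTensorProduct.tmulEquiv k W).toLinearMap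

theorem mergeSum_splitSum (A B : Type) (x : ⨂[k] _ : A ⊕ₗ B, W) :
    mergeSum A B (splitSum A B x) = x := by
  simp only [mergeSum, splitSum, LinearMap.comp_apply, LinearEquiv.coe_coe,
    LinearEquiv.apply_symm_apply, LinearEquiv.symm_apply_apply]

theorem splitSum_mergeSum (A B : Type) (x : (⨂[k] _ : A, W) ⊗[k] (⨂[k] _ : B, W)) :
    splitSum A B (mergeSum A B x) = x := by
  simp only [mergeSum, splitSum, LinearMap.comp_apply, LinearEquiv.coe_coe,
    LinearEquiv.apply_symm_apply, LinearEquiv.symm_apply_apply]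

theorem koszul_mergeSum (f : A ≃ A') (g : B ≃ B') (z : (⨂[k] _ : A, W) ⊗[k] (⨂[k] _ : B, W)) :
    koszul 𝒲 (S := A ⊕ₗ B) (T := A' ⊕ₗ B') ((ofLex.trans (f.sumCongr g)).trans toLex)
      (mergeSum A B z) = mergeSum A' B' (TensorProduct.map (koszul 𝒲 f) (koszul 𝒲 g) z) := by
  have h := LinearMap.congr_fun (splitSum_koszul 𝒲 f g) (mergeSum A B z)
  simp only [LinearMap.comp_apply, splitSum_mergeSum] at h
  rw [← h, mergeSum_splitSum]

/-- The joining of two labelled graphs by an additional edge from the first graph to the second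
one, summed over all possibilities. -/
noncomputable def joinMap (A B : Type) [Fintype A] [LinearOrder A] [Fintype B] [LinearOrder B] :
    LabelledGraphs k W A →ₗ[k] LabelledGraphs k W B →ₗ[k] Ebar 𝒲 :=
  TensorProduct.curry
    (TensorProduct.lift (TensorProduct.lift
      (Finsupp.linearCombination k fun G : SGraph A =>
        Finsupp.linearCombination k fun H : SGraph B =>
          ∑ u : A, ∑ v : B, toEbar 𝒲 ∘ₗ graphClass 𝒲 (G.join H u v) ∘ₗ mergeSum A B)) ∘ₗ
      (TensorProduct.tensorTensorTensorComm k _ _ _ _).toLinearMap)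

theorem joinMap_single (G : SGraph A) (H : SGraph B) (x : ⨂[k] _ : A, W) (y : ⨂[k] _ : B, W) :
    joinMap 𝒲 A B (Finsupp.single G 1 ⊗ₜ x) (Finsupp.single H 1 ⊗ₜ y) =
      ∑ u : A, ∑ v : B, toEbar 𝒲 (graphClass 𝒲 (G.join H u v) (mergeSum A B (x ⊗ₜ y))) := by
  simp [joinMap, LinearMap.sum_apply]

/-- Relabelling permutes the endpoints `u`, `v` over which the sum runs, and the Koszul signs of the
two blocks multiply. Hence the joining descends to coinvariants. -/
theorem joinMap_relabel (f : A ≃ A') (g : B ≃ B') (X : LabelledGraphs k W A)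
    (Y : LabelledGraphs k W B) :
    joinMap 𝒲 A' B' (relabel 𝒲 f X) (relabel 𝒲 g Y) = joinMap 𝒲 A B X Y := by
  have h : (joinMap 𝒲 A' B').compl₁₂ (relabel 𝒲 f) (relabel 𝒲 g) = joinMap 𝒲 A B := by
    refine labelledGraphs_ext fun G x => labelledGraphs_ext fun H y => ?_
    simp only [LinearMap.compl₁₂_apply, relabel, TensorProduct.map_tmul, Finsupp.lmapDomain_apply,
      Finsupp.mapDomain_single]
    rw [joinMap_single, joinMap_single, ← Equiv.sum_comp f]
    refine Finset.sum_congr rfl fun u _ => ?_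
    rw [← Equiv.sum_comp g]
    refine Finset.sum_congr rfl fun v _ => ?_
    rw [SGraph.join_map, ← TensorProduct.map_tmul, ← koszul_mergeSum, ← LinearMap.comp_apply
      (graphClass 𝒲 _), graphClass_map]
  exact LinearMap.congr_fun (LinearMap.congr_fun h X) Y

/-- For fixed `H`, `u`, `v`, joining carries a relation to a relation: the edges of `H` and the new
edge become common edges. -/
theorem joinMap_arnold_left {r : SGraph A →₀ k} (hr : IsArnoldExpr k A r) (x : ⨂[k] _ : A, W) :
    joinMap 𝒲 A B (r ⊗ₜ x) = 0 := by
  refine labelledGraphs_ext fun H y => ?_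
  have key : (joinMap 𝒲 A B (r ⊗ₜ x)) (Finsupp.single H 1 ⊗ₜ y) = ∑ u : A, ∑ v : B,
      toEbar 𝒲 (toGbar 𝒲 _ (r.mapDomain (fun G => G.join H u v) ⊗ₜ mergeSum A B (x ⊗ₜ y))) := by
    -- Both sides are linear in `r`, so the formula holds for arbitrary `r` and is checked on single
    -- graphs.
    clear hr
    induction r using Finsupp.induction_linear with
    | zero => simp
    | add r s hr hs =>
      simp only [Finsupp.mapDomain_add, TensorProduct.add_tmul, map_add, LinearMap.add_apply, hr,
        hs, Finset.sum_add_distrib]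
    | single G c =>
      have : Finsupp.single G c = c • Finsupp.single G (1 : k) := by simp
      simp only [this, ← TensorProduct.smul_tmul', map_smul, LinearMap.smul_apply, joinMap_single,
        Finsupp.mapDomain_smul, Finsupp.mapDomain_single, ← Finset.smul_sum]
      rfl
  rw [key]
  refine Finset.sum_eq_zero fun u _ => Finset.sum_eq_zero fun v _ =>
    toEbar_toGbar_arnold 𝒲 (hr.mapDomain _ (fun a => toLex (.inl a))
      (fun a a' h => Sum.inl_injective (toLex.injective h)) (fun x y =>
        (∃ b b', x = toLex (.inr b) ∧ y = toLex (.inr b') ∧ H.Edge b b') ∨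
        (x = toLex (.inl u) ∧ y = toLex (.inr v))) fun G x y => ?_) _
  rw [SGraph.join_edge, or_comm]

theorem joinMap_arnold_right {r : SGraph B →₀ k} (hr : IsArnoldExpr k B r) (y : ⨂[k] _ : B, W) :
    (joinMap 𝒲 A B).flip (r ⊗ₜ y) = 0 := by
  refine labelledGraphs_ext fun G x => ?_
  have key : (joinMap 𝒲 A B).flip (r ⊗ₜ y) (Finsupp.single G 1 ⊗ₜ x) = ∑ u : A, ∑ v : B,
      toEbar 𝒲 (toGbar 𝒲 _ (r.mapDomain (fun H => G.join H u v) ⊗ₜ mergeSum A B (x ⊗ₜ y))) := by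
    clear hr
    induction r using Finsupp.induction_linear with
    | zero => simp
    | add r s hr hs =>
      simp only [Finsupp.mapDomain_add, TensorProduct.add_tmul, map_add, LinearMap.add_apply, hr,
        hs, Finset.sum_add_distrib]
    | single H c =>
      have : Finsupp.single H c = c • Finsupp.single H (1 : k) := by simp
      simp only [this, ← TensorProduct.smul_tmul', map_smul, LinearMap.smul_apply, joinMap_single,
        LinearMap.flip_apply, Finsupp.mapDomain_smul, Finsupp.mapDomain_single,
        ← Finset.smul_sum]
      rfl
  rw [key]
  refine Finset.sum_eq_zero fun u _ => Finset.sum_eq_zero fun v _ =>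
    toEbar_toGbar_arnold 𝒲 (hr.mapDomain _ (fun b => toLex (.inr b))
      (fun a a' h => Sum.inr_injective (toLex.injective h)) (fun x y =>
        (∃ a a', x = toLex (.inl a) ∧ y = toLex (.inl a') ∧ G.Edge a a') ∨
        (x = toLex (.inl u) ∧ y = toLex (.inr v))) fun H x y => ?_) _
  rw [SGraph.join_edge, or_assoc, or_congr_right or_comm]

/-- The joining of classes of labelled graphs, on coinvariants. -/
noncomputable def joinCoinv (p q : ℕ) : GbarN 𝒲 p →ₗ[k] GbarN 𝒲 q →ₗ[k] Ebar 𝒲 :=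
  (Representation.Coinvariants.lift (graphRep 𝒲 q)
    (Representation.Coinvariants.lift (graphRep 𝒲 p) (joinMap 𝒲 (Fin p) (Fin q)) fun σ =>
      LinearMap.ext fun X => LinearMap.ext fun Y => by
        have := joinMap_relabel 𝒲 σ (Equiv.refl (Fin q)) X Y
        rwa [relabel_refl] at this).flip fun σ =>
    LinearMap.ext fun Y => Representation.Coinvariants.hom_ext (LinearMap.ext fun X => by
      have := joinMap_relabel 𝒲 (Equiv.refl (Fin p)) σ X Y
      rwa [relabel_refl] at this)).flip

theorem joinCoinv_mk (p q : ℕ) (X : LabelledGraphs k W (Fin p)) (Y : LabelledGraphs k W (Fin q)) :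
    joinCoinv 𝒲 p q (mkGbar 𝒲 p X) (mkGbar 𝒲 q Y) = joinMap 𝒲 _ _ X Y := rfl

theorem mkGbar_surjective (n : ℕ) : Function.Surjective (mkGbar 𝒲 n) :=
  Representation.Coinvariants.mk_surjective _

/-- The joining of classes of labelled graphs, modulo the arrow-reversing and Arnold
expressions. -/
noncomputable def joinN (p q : ℕ) :
    (GbarN 𝒲 p ⧸ arn 𝒲 p) →ₗ[k] (GbarN 𝒲 q ⧸ arn 𝒲 q) →ₗ[k] Ebar 𝒲 :=
  (Submodule.liftQ (arn 𝒲 q) (Submodule.liftQ (arn 𝒲 p) (joinCoinv 𝒲 p q) (by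
      rw [arn, Submodule.span_le]
      rintro _ ⟨r, hr, w, rfl⟩
      refine LinearMap.ext fun y => ?_
      obtain ⟨Y, rfl⟩ := mkGbar_surjective 𝒲 q y
      rw [joinCoinv_mk, joinMap_arnold_left 𝒲 hr]
      rfl)).flip (by
    rw [arn, Submodule.span_le]
    rintro _ ⟨r, hr, w, rfl⟩
    refine LinearMap.ext fun x => ?_
    obtain ⟨x, rfl⟩ := Submodule.mkQ_surjective _ x
    obtain ⟨X, rfl⟩ := mkGbar_surjective 𝒲 p x
    exact LinearMap.congr_fun (joinMap_arnold_right 𝒲 hr w) X)).flip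

/-- The joining of two classes of labelled graphs in `Ē(W)` by an additional edge. -/
noncomputable def joinE : Ebar 𝒲 ⊗[k] Ebar 𝒲 →ₗ[k] Ebar 𝒲 :=
  TensorProduct.lift (DirectSum.toModule k ℕ _ fun p =>
    (DirectSum.toModule k ℕ _ fun q => (joinN 𝒲 p q).flip).flip)

theorem joinE_toEbar (X : LabelledGraphs k W A) (Y : LabelledGraphs k W B) :
    joinE 𝒲 (toEbar 𝒲 (toGbar 𝒲 A X) ⊗ₜ toEbar 𝒲 (toGbar 𝒲 B Y)) = joinMap 𝒲 A B X Y := by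
  rw [← joinMap_relabel 𝒲 (Fintype.equivFin A) (Fintype.equivFin B), ← joinCoinv_mk,
    toGbar_eq 𝒲 (Fintype.equivFin A), toGbar_eq 𝒲 (Fintype.equivFin B)]
  simp only [LinearMap.comp_apply, toEbar_lof, joinE, TensorProduct.lift.tmul,
    DirectSum.toModule_lof, LinearMap.flip_apply]
  rfl

end Joining

/-! ### Cutting and rejoining is multiplication by `n (n - 1)`. -/

section Injectivity

variable {k : Type*} [CommRing k] {W : Type*} [AddCommGroup W] [Module k W]
  (𝒲 : ℤ → Submodule k W) [DirectSum.Decomposition 𝒲]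
variable {S : Type} [Fintype S] [LinearOrder S]

/-- Merging the tensor factors and relabelling back to `S` undoes the unshuffling, so all Koszul
signs cancel. -/
theorem joinE_unshuffle {A B : Finset S} (h : ∀ x, x ∈ A ↔ x ∉ B) (P : SGraph A) (Q : SGraph B)
    (x : ⨂[k] _ : S, W) :
    joinE 𝒲 (TensorProduct.map (toEbar 𝒲) (toEbar 𝒲)
      (TensorProduct.map (graphClass 𝒲 P) (graphClass 𝒲 Q) (unshuffle 𝒲 A B h x))) =
      ∑ u : A, ∑ v : B, eilMap 𝒲 S (graphCls k (SGraph.glue h P Q u v)) x := by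
  have key : ∀ z, joinE 𝒲 (TensorProduct.map (toEbar 𝒲) (toEbar 𝒲)
      (TensorProduct.map (graphClass 𝒲 P) (graphClass 𝒲 Q) z)) =
      ∑ u : A, ∑ v : B, toEbar 𝒲 (graphClass 𝒲 (P.join Q u v) (mergeSum A B z)) := by
    intro z
    induction z using TensorProduct.induction_on with
    | zero => simp
    | add a b ha hb => simp only [map_add, ha, hb, Finset.sum_add_distrib]
    | tmul x y =>
      rw [TensorProduct.map_tmul, TensorProduct.map_tmul, ← joinMap_single]
      exact joinE_toEbar 𝒲 _ _
  rw [key, unshuffle]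
  refine Finset.sum_congr rfl fun u _ => Finset.sum_congr rfl fun v _ => ?_
  rw [LinearMap.comp_apply, mergeSum_splitSum, eilMap_graphCls, LinearMap.comp_apply,
    ← graphClass_map 𝒲 (sideEquiv A B h).symm (P.join Q u v), LinearMap.comp_apply,
    ← LinearMap.comp_apply (koszul 𝒲 _) (koszul 𝒲 _), ← koszul_trans, Equiv.self_trans_symm,
    koszul_refl]
  rfl

/-- With `χ` the indicator function of the side of `a`, the coefficient of `g u v` is `χ u (1 - χ v)
- (1 - χ u) χ v = χ u - χ v`. -/
theorem SGraph.sum_side_sub_sum_side {M : Type*} [AddCommGroup M] (G : SGraph S) {a b : S}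
    (hab : G.Edge a b) (g : S → S → M) :
    ∑ u : G.side a b a, ∑ v : G.side a b b, g u v -
      ∑ u : G.side a b b, ∑ v : G.side a b a, g u v =
    ∑ u : S, ∑ v : S, G.passes u v (a, b) • g u v := by
  classical
  have hc := G.isCompl_side hab
  have h1 : ∀ f : S → M, ∑ u : G.side a b a, f u = ∑ u, G.chi a b u • f u := by
    intro f
    rw [Finset.sum_coe_sort (G.side a b a) f, ← Finset.sum_filter_add_sum_filter_not
      Finset.univ (· ∈ G.side a b a) (fun u => G.chi a b u • f u),
      Finset.sum_eq_zero (s := Finset.univ.filter (· ∉ G.side a b a)), add_zero,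
      Finset.filter_mem_eq_inter, Finset.univ_inter]
    · refine Finset.sum_congr rfl fun u hu => ?_
      rw [chi, if_pos ((G.mem_side ..).1 hu), one_smul]
    · intro u hu
      rw [Finset.mem_filter, mem_side] at hu
      rw [chi, if_neg hu.2, zero_smul]
  have h2 : ∀ f : S → M, ∑ u : G.side a b b, f u = ∑ u, f u - ∑ u, G.chi a b u • f u := by
    intro f
    rw [← h1, Finset.sum_coe_sort (G.side a b a) f, Finset.sum_coe_sort (G.side a b b) f,
      eq_sub_iff_add_eq, ← Finset.sum_union]
    · refine Finset.sum_congr (Finset.ext fun x => ?_) fun _ _ => rfl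
      simp [hc x, em]
    · rw [Finset.disjoint_left]
      intro x hx hx'
      exact (hc x).1 hx' hx
  simp only [passes, hab, if_true]
  rw [h1 fun u => ∑ v : G.side a b b, g u v, h2 fun u => ∑ v : G.side a b a, g u v]
  simp only [h1, h2, smul_sub, sub_smul, Finset.sum_sub_distrib, ← Finset.smul_sum]
  abel

theorem joinE_edgeTerm (G : SGraph S) {a b : S} (hab : G.Edge a b) (x : ⨂[k] _ : S, W) :
    joinE 𝒲 (TensorProduct.map (toEbar 𝒲) (toEbar 𝒲) (edgeTerm 𝒲 G hab x)) =
      ∑ u : S, ∑ v : S, G.passes u v (a, b) •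
        eilMap 𝒲 S (relCls k (G.replaceRel a b u v)) x := by
  rw [edgeTerm, LinearMap.sub_apply, map_sub, map_sub, LinearMap.comp_apply,
    LinearMap.comp_apply, joinE_unshuffle, joinE_unshuffle, ← G.sum_side_sub_sum_side hab]
  congr 1
  · refine Finset.sum_congr rfl fun u _ => Finset.sum_congr rfl fun v _ => ?_
    rw [relCls_eq (F := G.replaceRel a b u v) _ (G.glue_piece_edge hab _ u v)]
  · refine Finset.sum_congr rfl fun u _ => Finset.sum_congr rfl fun v _ => ?_
    rw [relCls_eq (F := G.replaceRel a b u v) _ (G.glue_piece_edge hab _ u v)]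

theorem cobracketRep_single (G : SGraph S) (x : ⨂[k] _ : S, W)
    [Fintype {e : S × S // G.Edge e.1 e.2}] :
    cobracketRep 𝒲 S (Finsupp.single G 1 ⊗ₜ x) =
      ∑ e : {e : S × S // G.Edge e.1 e.2}, edgeTerm 𝒲 G e.2 x := by
  simp only [cobracketRep, TensorProduct.lift.tmul, Finsupp.linearCombination_single, one_smul,
    LinearMap.sum_apply]
  exact Finset.sum_congr (by ext; simp) fun _ _ => rfl

/-- After interchanging the sums, the cycle identity applies to each ordered pair of distinct
vertices `u`, `v`. Each such pair contributes one copy of the graph, and pairs with `u = v`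
contribute nothing. -/
theorem joinE_cobracketRep (X : LabelledGraphs k W S) :
    joinE 𝒲 (TensorProduct.map (toEbar 𝒲) (toEbar 𝒲) (cobracketRep 𝒲 S X)) =
      (Fintype.card S * (Fintype.card S - 1) : k) • toEbar 𝒲 (toGbar 𝒲 S X) := by
  classical
  have h : joinE 𝒲 ∘ₗ TensorProduct.map (toEbar 𝒲) (toEbar 𝒲) ∘ₗ cobracketRep 𝒲 S =
      (Fintype.card S * (Fintype.card S - 1) : k) • (toEbar 𝒲 ∘ₗ toGbar 𝒲 S) := by
    refine labelledGraphs_ext fun G x => ?_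
    simp only [LinearMap.comp_apply, LinearMap.smul_apply, toEbar_toGbar_tmul]
    change _ = _ • eilMap 𝒲 S (graphCls k G) x
    have hu : ∀ u : S, ∑ v, ∑ e : S × S, G.passes u v e •
        eilMap 𝒲 S (relCls k (G.replaceRel e.1 e.2 u v)) x =
        (Fintype.card S - 1 : k) • eilMap 𝒲 S (graphCls k G) x := by
      intro u
      rw [← Finset.add_sum_erase _ _ (Finset.mem_univ u), Finset.sum_eq_zero, zero_add,
        Finset.sum_congr rfl (g := fun _ => eilMap 𝒲 S (graphCls k G) x)]
      · rw [Finset.sum_const, Finset.card_erase_of_mem (Finset.mem_univ _), Finset.card_univ,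
          ← Nat.cast_smul_eq_nsmul k, Nat.cast_sub (Fintype.card_pos_iff.2 ⟨u⟩), Nat.cast_one]
      · intro v hv
        rw [← sum_passes_smul_relCls G (Finset.ne_of_mem_erase hv).symm, map_sum,
          LinearMap.sum_apply]
        simp only [map_zsmul, LinearMap.smul_apply]
      · intro e _
        simp [SGraph.passes]
    -- `passes` vanishes off the edges, so the sum over edges extends to all pairs of vertices and
    -- can be interchanged with the sums over `u` and `v`.
    rw [cobracketRep_single, map_sum, map_sum, Finset.sum_congr rfl fun e _ =>
      joinE_edgeTerm 𝒲 G e.2 x, ← Finset.sum_subtype (Finset.univ.filter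
        fun e : S × S => G.Edge e.1 e.2) (by simp) fun e => ∑ u, ∑ v, G.passes u v (e.1, e.2) •
          eilMap 𝒲 S (relCls k (G.replaceRel e.1 e.2 u v)) x, Finset.sum_filter_of_ne]
    · rw [Finset.sum_comm, Finset.sum_congr rfl fun u _ => Finset.sum_comm.trans (hu u)]
      simp [mul_smul, ← Nat.cast_smul_eq_nsmul k]
    · intro e _ he
      by_contra hn
      simp [SGraph.passes, hn] at he
  exact LinearMap.congr_fun h X

theorem cobracketN_mkGbar (n : ℕ) (X : LabelledGraphs k W (Fin n)) :
    cobracketN 𝒲 n (mkGbar 𝒲 n X) = cobracketRep 𝒲 (Fin n) X := rfl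

theorem joinE_cobracketN (n : ℕ) (x : GbarN 𝒲 n) :
    joinE 𝒲 (TensorProduct.map (toEbar 𝒲) (toEbar 𝒲) (cobracketN 𝒲 n x)) =
      (n * (n - 1) : k) •
        DirectSum.lof k ℕ (fun n => GbarN 𝒲 n ⧸ arn 𝒲 n) n ((arn 𝒲 n).mkQ x) := by
  obtain ⟨X, rfl⟩ := mkGbar_surjective 𝒲 n x
  rw [cobracketN_mkGbar, joinE_cobracketRep, toGbar_fin, toEbar_lof, Fintype.card_fin]

end Injectivity

/-- Rejoining recovers `n (n - 1)` times the class in `Ē(W)`, and this factor is invertible for `n ≥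
2`. -/
theorem ker_cobracketN_le_arn {k : Type*} [Field k] [CharZero k] {W : Type*} [AddCommGroup W]
    [Module k W] (𝒲 : ℤ → Submodule k W) [DirectSum.Decomposition 𝒲] {n : ℕ} (hn : 2 ≤ n) :
    LinearMap.ker (TensorProduct.map (toEbar 𝒲) (toEbar 𝒲) ∘ₗ cobracketN 𝒲 n) ≤ arn 𝒲 n := by
  intro x hx
  have h := joinE_cobracketN 𝒲 n x
  rw [LinearMap.mem_ker, LinearMap.comp_apply] at hx
  rw [hx, map_zero] at h
  have h1 : (n * (n - 1) : k) ≠ 0 := by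
    refine mul_ne_zero (by norm_cast; omega) (sub_ne_zero.2 ?_)
    norm_cast
    omega
  have h2 := (smul_eq_zero.1 h.symm).resolve_left h1
  have h3 := DirectSum.of_injective (β := fun n => GbarN 𝒲 n ⧸ arn 𝒲 n) n
    (h2.trans (map_zero _).symm)
  simpa using h3

/-! ### Cuts at the common edges of a relation. -/

section Coideal

variable {k : Type*} [CommRing k] {W : Type*} [AddCommGroup W] [Module k W]
  (𝒲 : ℤ → Submodule k W) [DirectSum.Decomposition 𝒲]
variable {S : Type} [Fintype S] [LinearOrder S]

open Classical in
/-- The connected component of a vertex in the undirected graph underlying a relation. -/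
noncomputable def relComp {S : Type} [Fintype S] (F : S → S → Prop) (v : S) : Finset S :=
  Finset.univ.filter fun x => (SimpleGraph.fromRel F).Reachable v x

theorem mem_relComp {S : Type} [Fintype S] {F : S → S → Prop} {v x : S} :
    x ∈ relComp F v ↔ (SimpleGraph.fromRel F).Reachable v x := by
  simp [relComp]

theorem relComp_eq_of_reachable {S : Type} [Fintype S] {F : S → S → Prop} {u v : S}
    (h : (SimpleGraph.fromRel F).Reachable u v) : relComp F u = relComp F v := by
  ext x
  rw [mem_relComp, mem_relComp]
  exact ⟨fun h' => h.symm.trans h', fun h' => h.trans h'⟩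

theorem relComp_congr {S : Type} [Fintype S] {F F' : S → S → Prop}
    (h : ∀ x y, F x y → (SimpleGraph.fromRel F').Reachable x y)
    (h' : ∀ x y, F' x y → (SimpleGraph.fromRel F).Reachable x y) (v : S) :
    relComp F v = relComp F' v := by
  ext x
  rw [mem_relComp, mem_relComp]
  constructor
  · refine SimpleGraph.Reachable.of_forall_adj fun x y hxy => ?_
    exact hxy.2.elim (h x y) fun e => (h y x e).symm
  · refine SimpleGraph.Reachable.of_forall_adj fun x y hxy => ?_
    exact hxy.2.elim (h' x y) fun e => (h' y x e).symm

open Classical in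
/-- The splitting of a labelled graph with edge relation `F` into its parts over `A` and `B`. -/
noncomputable def splitTerm (F : S → S → Prop) (A B : Finset S) :
    (⨂[k] _ : S, W) →ₗ[k] Ebar 𝒲 ⊗[k] Ebar 𝒲 :=
  if h : ∀ x, x ∈ A ↔ x ∉ B then
    TensorProduct.map (eilMap 𝒲 A (relCls k fun x y : A => F x y))
      (eilMap 𝒲 B (relCls k fun x y : B => F x y)) ∘ₗ unshuffle 𝒲 A B h
  else 0

/-- A splitting is bilinear in its two parts. The part over `B` is the same for all `i` and factors
out of the sum. -/
theorem sum_splitTerm_left {ι : Type*} [Fintype ι] (F : ι → S → S → Prop) (A B : Finset S)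
    (hA : ∑ i, relCls k (fun x y : A => F i x y) = 0)
    (hB : ∀ i j, ∀ x ∈ B, ∀ y ∈ B, F i x y ↔ F j x y) :
    ∑ i, splitTerm 𝒲 (F i) A B = 0 := by
  rcases isEmpty_or_nonempty ι with hι | ⟨⟨j⟩⟩
  · simp
  by_cases h : ∀ x, x ∈ A ↔ x ∉ B
  swap
  · simp [splitTerm, h]
  have hB' : ∀ i, (fun x y : B => F i x y) = fun x y : B => F j x y := fun i =>
    funext₂ fun x y => propext (hB i j x x.2 y y.2)
  simp only [splitTerm, dif_pos h, hB']
  refine LinearMap.ext fun x => ?_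
  simp only [LinearMap.sum_apply, LinearMap.comp_apply, ← TensorProduct.mapBilinear_apply]
  rw [← LinearMap.sum_apply, ← LinearMap.sum_apply, ← map_sum, ← map_sum, hA]
  simp

theorem sum_splitTerm_right {ι : Type*} [Fintype ι] (F : ι → S → S → Prop) (A B : Finset S)
    (hA : ∀ i j, ∀ x ∈ A, ∀ y ∈ A, F i x y ↔ F j x y)
    (hB : ∑ i, relCls k (fun x y : B => F i x y) = 0) :
    ∑ i, splitTerm 𝒲 (F i) A B = 0 := by
  rcases isEmpty_or_nonempty ι with hι | ⟨⟨j⟩⟩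
  · simp
  by_cases h : ∀ x, x ∈ A ↔ x ∉ B
  swap
  · simp [splitTerm, h]
  have hA' : ∀ i, (fun x y : A => F i x y) = fun x y : A => F j x y := fun i =>
    funext₂ fun x y => propext (hA i j x x.2 y y.2)
  simp only [splitTerm, dif_pos h, hA']
  refine LinearMap.ext fun x => ?_
  simp only [LinearMap.sum_apply, LinearMap.comp_apply, ← TensorProduct.mapBilinear_apply]
  rw [← LinearMap.sum_apply, ← map_sum, ← map_sum, hB]
  simp

/-- The antisymmetrized splitting of a labelled graph with edge relation `F` into the components
of two vertices. -/
noncomputable def splitComp (F : S → S → Prop) (p q : S) :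
    (⨂[k] _ : S, W) →ₗ[k] Ebar 𝒲 ⊗[k] Ebar 𝒲 :=
  splitTerm 𝒲 F (relComp F p) (relComp F q) - splitTerm 𝒲 F (relComp F q) (relComp F p)

theorem splitComp_add_swap (F : S → S → Prop) (p q : S) :
    splitComp 𝒲 F p q + splitComp 𝒲 F q p = 0 := by
  simp [splitComp]

/-- The edge puts `b` and `c` into one component, so only antisymmetry is left. This cancels the
cuts at the sides of the triangle in an Arnold expression. -/
theorem splitComp_add_of_edge (F : S → S → Prop) {a b c : S} (hne : b ≠ c) (h : F b c) :
    splitComp 𝒲 F a b + splitComp 𝒲 F c a = 0 := by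
  have : relComp F b = relComp F c := relComp_eq_of_reachable
    (SimpleGraph.Adj.reachable ⟨hne, .inl h⟩)
  simp [splitComp, this]

/-- The edge relation of a graph with the edge from `a` to `b` removed. -/
def SGraph.cutRel {S : Type} (G : SGraph S) (a b x y : S) : Prop :=
  G.Edge x y ∧ ¬ (x = a ∧ y = b)

theorem relComp_cutRel {S : Type} [Fintype S] (G : SGraph S) (a b v : S) :
    relComp (G.cutRel a b) v = G.side a b v := by
  ext x
  rw [mem_relComp, SGraph.mem_side]
  rfl

theorem map_toEbar_edgeTerm (G : SGraph S) {a b : S} (h : G.Edge a b) :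
    TensorProduct.map (toEbar 𝒲) (toEbar 𝒲) ∘ₗ edgeTerm 𝒲 G h =
      splitComp 𝒲 (G.cutRel a b) a b := by
  have hs : ∀ p q (hc : ∀ x, x ∈ G.side a b p ↔ x ∉ G.side a b q),
      splitTerm 𝒲 (G.cutRel a b) (relComp (G.cutRel a b) p) (relComp (G.cutRel a b) q) =
      TensorProduct.map (toEbar 𝒲) (toEbar 𝒲) ∘ₗ TensorProduct.map
        (graphClass 𝒲 (G.piece h p)) (graphClass 𝒲 (G.piece h q)) ∘ₗ unshuffle 𝒲 _ _ hc := by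
    intro p q hc
    rw [relComp_cutRel, relComp_cutRel, splitTerm, dif_pos hc,
      relCls_eq (F := fun x y : G.side a b p => G.cutRel a b x y) (G.piece h p) fun _ _ => Iff.rfl,
      relCls_eq (F := fun x y : G.side a b q => G.cutRel a b x y) (G.piece h q) fun _ _ => Iff.rfl,
      eilMap_graphCls, eilMap_graphCls,
      TensorProduct.map_comp]
    rfl
  rw [edgeTerm, LinearMap.comp_sub, splitComp, hs a b (G.isCompl_side h),
    hs b a fun x => by rw [G.isCompl_side h x, not_not]]

open Classical in
theorem map_toEbar_cobracketRep (G : SGraph S) (x : ⨂[k] _ : S, W) :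
    TensorProduct.map (toEbar 𝒲) (toEbar 𝒲) (cobracketRep 𝒲 S (Finsupp.single G 1 ⊗ₜ x)) =
      ∑ e : S × S, if G.Edge e.1 e.2 then splitComp 𝒲 (G.cutRel e.1 e.2) e.1 e.2 x else 0 := by
  rw [cobracketRep_single, map_sum, ← Finset.sum_filter, Finset.sum_subtype (p := fun e : S × S =>
    G.Edge e.1 e.2) _ (by simp)]
  exact Finset.sum_congr rfl fun e _ => LinearMap.congr_fun (map_toEbar_edgeTerm 𝒲 G e.2) x

/-- A family of graphs differs in a connected set of vertices by an arrow-reversing or Arnold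
expression: the graphs consist of common edges `R` and of the edges `M i`. -/
structure IsVanishingFamily (k : Type*) [CommRing k] {S ι : Type} [Fintype S] [Fintype ι]
    (G : ι → SGraph S) (R : S → S → Prop) (M : ι → S → S → Prop) : Prop where
  edge_iff : ∀ i x y, (G i).Edge x y ↔ R x y ∨ M i x y
  disjoint : ∀ i x y, R x y → ¬ M i x y
  connected : ∃ a, ∀ i j x y, M i x y →
    (SimpleGraph.fromRel (M j)).Reachable a x ∧ (SimpleGraph.fromRel (M j)).Reachable a y
  sum_eq_zero : ∀ (A : Finset S) (P : ι → SGraph A) (R' : A → A → Prop),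
    (∀ i x y, M i x y → x ∈ A ∧ y ∈ A) → (∀ i x y, (P i).Edge x y ↔ R' x y ∨ M i x y) →
    ∑ i, graphCls k (P i) = 0

/-- After the cut at a common edge all graphs of the family have the same components, and the edges
`M i` all lie in the component of one vertex `a`. The parts over that component sum to zero by the
relation; the parts over the other component coincide. -/
theorem IsVanishingFamily.sum_splitComp {ι : Type} [Fintype ι] {G : ι → SGraph S}
    {R : S → S → Prop} {M : ι → S → S → Prop} (h : IsVanishingFamily k G R M) {p q : S}
    (hpq : R p q) : ∑ i, splitComp 𝒲 ((G i).cutRel p q) p q = 0 := by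
  rcases isEmpty_or_nonempty ι with hι | ⟨⟨i₀⟩⟩
  · simp
  have hG : ∀ i, (G i).Edge p q := fun i => (h.edge_iff i p q).2 (.inl hpq)
  let R' : S → S → Prop := fun x y => R x y ∧ ¬ (x = p ∧ y = q)
  have hF : ∀ i x y, (G i).cutRel p q x y ↔ R' x y ∨ M i x y := by
    intro i x y
    have h1 := h.edge_iff i x y
    have h2 := h.disjoint i p q hpq
    simp only [SGraph.cutRel, R']
    grind
  have hne : ∀ i x y, (G i).cutRel p q x y → x ≠ y := fun i x y h => (G i).ne_of_edge h.1
  have hle : ∀ j x y, (SimpleGraph.fromRel (M j)).Reachable x y →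
      (SimpleGraph.fromRel ((G j).cutRel p q)).Reachable x y := fun j x y hr =>
    by
    refine hr.mono fun x y hxy => ?_
    exact ⟨hxy.1, hxy.2.imp (fun e => (hF j x y).2 (.inr e)) fun e => (hF j y x).2 (.inr e)⟩
  obtain ⟨a, ha⟩ := h.connected
  -- An edge of `M i` is bridged in the `j`-th graph by a walk through `a` along edges of `M j`,
  -- none of which is the removed edge.
  have hreach : ∀ i j x y, (G i).cutRel p q x y →
      (SimpleGraph.fromRel ((G j).cutRel p q)).Reachable x y := by
    intro i j x y hxy
    rcases (hF i x y).1 hxy with hR | hM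
    · exact SimpleGraph.Adj.reachable ⟨hne i x y hxy, .inl ((hF j x y).2 (.inl hR))⟩
    · exact (hle j _ _ (ha i j x y hM).1).symm.trans (hle j _ _ (ha i j x y hM).2)
  have hcomp : ∀ i v, relComp ((G i).cutRel p q) v = relComp ((G i₀).cutRel p q) v := fun i v =>
    relComp_congr (hreach i i₀) (hreach i₀ i) v
  have hcompl : ∀ x, x ∈ relComp ((G i₀).cutRel p q) p ↔ x ∉ relComp ((G i₀).cutRel p q) q := by
    simp only [relComp_cutRel]
    exact (G i₀).isCompl_side (hG i₀)
  have hP : ∀ i v, ∃ P : SGraph (relComp ((G i₀).cutRel p q) v),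
      ∀ x y, P.Edge x y ↔ (G i).cutRel p q x y := by
    intro i v
    rw [← hcomp i v, relComp_cutRel]
    exact ⟨(G i).piece (hG i) v, fun _ _ => Iff.rfl⟩
  have hzero : ∀ v, a ∈ relComp ((G i₀).cutRel p q) v →
      ∑ i, relCls k (fun x y : relComp ((G i₀).cutRel p q) v => (G i).cutRel p q x y) = 0 := by
    intro v hv
    choose P hP using fun i => hP i v
    rw [Finset.sum_congr rfl fun i _ => relCls_eq (P i) (hP i)]
    refine h.sum_eq_zero _ P (fun x y => R' x y) (fun i x y hM => ?_)
      fun i x y => (hP i x y).trans (hF i x y)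
    simp only [mem_relComp] at hv ⊢
    exact ⟨hv.trans (hle i₀ _ _ (ha i i₀ x y hM).1), hv.trans (hle i₀ _ _ (ha i i₀ x y hM).2)⟩
  have hsame : ∀ v, a ∉ relComp ((G i₀).cutRel p q) v → ∀ i j,
      ∀ x ∈ relComp ((G i₀).cutRel p q) v, ∀ y ∈ relComp ((G i₀).cutRel p q) v,
      (G i).cutRel p q x y ↔ (G j).cutRel p q x y := by
    intro v hv i j x hx y _
    have hn : ∀ i, ¬ M i x y := fun i hM => hv (by
      rw [mem_relComp] at hx ⊢
      exact hx.trans (hle i₀ _ _ (ha i i₀ x y hM).1).symm)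
    rw [hF, hF]
    simp [hn]
  simp only [splitComp, hcomp, Finset.sum_sub_distrib]
  by_cases hap : a ∈ relComp ((G i₀).cutRel p q) p
  · rw [sum_splitTerm_left 𝒲 _ _ _ (hzero p hap) (hsame q ((hcompl a).1 hap)),
      sum_splitTerm_right 𝒲 _ _ _ (hsame q ((hcompl a).1 hap)) (hzero p hap), sub_zero]
  · have haq : a ∈ relComp ((G i₀).cutRel p q) q := by
      by_contra haq
      exact hap ((hcompl a).2 haq)
    rw [sum_splitTerm_left 𝒲 _ _ _ (hzero q haq) (hsame p hap),
      sum_splitTerm_right 𝒲 _ _ _ (hsame p hap) (hzero q haq), sub_zero]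

open Classical in
-- The contributions of the common edges cancel, which reduces each relation to the few edges in
-- which its graphs differ.
theorem IsVanishingFamily.sum_cobracketRep {ι : Type} [Fintype ι] {G : ι → SGraph S}
    {R : S → S → Prop} {M : ι → S → S → Prop} (h : IsVanishingFamily k G R M)
    (x : ⨂[k] _ : S, W) :
    ∑ i, TensorProduct.map (toEbar 𝒲) (toEbar 𝒲)
      (cobracketRep 𝒲 S (Finsupp.single (G i) 1 ⊗ₜ x)) =
    ∑ i, ∑ e : S × S, if M i e.1 e.2 then
      splitComp 𝒲 ((G i).cutRel e.1 e.2) e.1 e.2 x else 0 := by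
  have key : ∀ i, TensorProduct.map (toEbar 𝒲) (toEbar 𝒲)
      (cobracketRep 𝒲 S (Finsupp.single (G i) 1 ⊗ₜ x)) =
      ∑ e : S × S, (if R e.1 e.2 then splitComp 𝒲 ((G i).cutRel e.1 e.2) e.1 e.2 x else 0) +
      ∑ e : S × S, if M i e.1 e.2 then splitComp 𝒲 ((G i).cutRel e.1 e.2) e.1 e.2 x else 0 := by
    intro i
    rw [map_toEbar_cobracketRep, ← Finset.sum_add_distrib]
    refine Finset.sum_congr rfl fun e _ => ?_
    have h1 := h.edge_iff i e.1 e.2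
    have h2 := h.disjoint i e.1 e.2
    by_cases hR : R e.1 e.2
    · rw [if_pos (h1.2 (.inl hR)), if_pos hR, if_neg (h2 hR), add_zero]
    · by_cases hM : M i e.1 e.2
      · rw [if_pos (h1.2 (.inr hM)), if_neg hR, if_pos hM, zero_add]
      · rw [if_neg fun h => (h1.1 h).elim hR hM, if_neg hR, if_neg hM, zero_add]
  rw [Finset.sum_congr rfl fun i _ => key i, Finset.sum_add_distrib, Finset.sum_comm,
    Finset.sum_eq_zero, zero_add]
  intro e _
  by_cases hR : R e.1 e.2
  · simp only [if_pos hR]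
    rw [← LinearMap.sum_apply, h.sum_splitComp 𝒲 hR, LinearMap.zero_apply]
  · simp [hR]

end Coideal

/-! ### The cobracket vanishes on arrow-reversing and Arnold expressions. -/

section Coideal

variable {k : Type*} [CommRing k] {W : Type*} [AddCommGroup W] [Module k W]
  (𝒲 : ℤ → Submodule k W) [DirectSum.Decomposition 𝒲]
variable {S : Type} [Fintype S] [LinearOrder S]

/-- Cutting the reversed edge in either graph leaves the same two pieces, but in the opposite order.
-/
theorem map_toEbar_cobracketRep_arrow (G G' : SGraph S) (R : S → S → Prop) (a b : S)
    (h : ∀ x y, G.Edge x y ↔ R x y ∨ (x = a ∧ y = b))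
    (h' : ∀ x y, G'.Edge x y ↔ R x y ∨ (x = b ∧ y = a)) (x : ⨂[k] _ : S, W) :
    TensorProduct.map (toEbar 𝒲) (toEbar 𝒲) (cobracketRep 𝒲 S
      ((Finsupp.single G 1 + Finsupp.single G' 1) ⊗ₜ x)) = 0 := by
  classical
  have hG : G.Edge a b := (h a b).2 (.inr ⟨rfl, rfl⟩)
  have hG' : G'.Edge b a := (h' b a).2 (.inr ⟨rfl, rfl⟩)
  have hab := G.ne_of_edge hG
  have hR : ¬ R a b := fun hR => G'.asymm _ _ hG' ((h' a b).2 (.inl hR))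
  have hR' : ¬ R b a := fun hR => G.asymm _ _ hG ((h b a).2 (.inl hR))
  have hv : IsVanishingFamily k ![G, G'] R
      ![fun x y => x = a ∧ y = b, fun x y => x = b ∧ y = a] := by
    refine ⟨?_, ?_, ⟨a, ?_⟩, ?_⟩
    · rw [Fin.forall_fin_two]
      exact ⟨h, h'⟩
    · rw [Fin.forall_fin_two]
      constructor
      · rintro x y hxy ⟨rfl, rfl⟩
        exact hR hxy
      · rintro x y hxy ⟨rfl, rfl⟩
        exact hR' hxy
    · have h0 : ∀ j : Fin 2, (SimpleGraph.fromRel ((![fun x y => x = a ∧ y = b,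
          fun x y => x = b ∧ y = a] : Fin 2 → S → S → Prop) j)).Reachable a b := by
        rw [Fin.forall_fin_two]
        exact ⟨SimpleGraph.Adj.reachable ⟨hab, .inl ⟨rfl, rfl⟩⟩,
          SimpleGraph.Adj.reachable ⟨hab, .inr ⟨rfl, rfl⟩⟩⟩
      rw [Fin.forall_fin_two]
      constructor
      · rintro j x y ⟨rfl, rfl⟩
        exact ⟨.refl _, h0 j⟩
      · rintro j x y ⟨rfl, rfl⟩
        exact ⟨h0 j, .refl _⟩
    · intro A P R' hA hP
      obtain ⟨ha, hb⟩ := hA 0 a b ⟨rfl, rfl⟩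
      rw [Fin.sum_univ_two]
      rw [Fin.forall_fin_two] at hP
      refine graphCls_arrow (P 0) (P 1) R' ⟨a, ha⟩ ⟨b, hb⟩ (fun x y => ?_) fun x y => ?_
      · rw [hP.1]
        simp [Subtype.ext_iff]
      · rw [hP.2]
        simp [Subtype.ext_iff]
  have key := hv.sum_cobracketRep 𝒲 x
  rw [Fin.sum_univ_two, Fin.sum_univ_two] at key
  rw [TensorProduct.add_tmul, map_add, map_add]
  refine key.trans ?_
  have e1 : G.cutRel a b = R := by
    refine funext₂ fun x y => propext ?_
    rw [SGraph.cutRel, h]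
    grind
  have e2 : G'.cutRel b a = R := by
    refine funext₂ fun x y => propext ?_
    rw [SGraph.cutRel, h']
    grind
  rw [Finset.sum_eq_single (a, b), Finset.sum_eq_single (b, a)]
  · simp only [Matrix.cons_val_zero, Matrix.cons_val_one, and_self, if_true, e1, e2]
    rw [← LinearMap.add_apply, splitComp_add_swap, LinearMap.zero_apply]
  · rintro ⟨p, q⟩ - hne
    exact if_neg fun hh => hne (Prod.ext hh.1 hh.2)
  · simp
  · rintro ⟨p, q⟩ - hne
    exact if_neg fun hh => hne (Prod.ext hh.1 hh.2)
  · simp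

/-- An edge `a → b` would close a cycle with `b → c → a`. Thus the common edges of an Arnold
expression contain no side of the triangle. -/
theorem SGraph.not_edge_of_path {S : Type} [Fintype S] (G : SGraph S) {R : S → S → Prop}
    {a b c : S}
    (h : ∀ x y, G.Edge x y ↔ R x y ∨ (x = b ∧ y = c) ∨ (x = c ∧ y = a)) (hab : a ≠ b) :
    ¬ R a b := by
  intro hR
  have hbc : G.Edge b c := (h b c).2 (by simp)
  have hca : G.Edge c a := (h c a).2 (by simp)
  have h1 := G.ne_of_edge hbc
  refine G.not_reachable_cut hbc (SimpleGraph.Reachable.symm ?_)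
  exact (G.cut_adj_of_edge hca (by grind)).reachable.trans
    (G.cut_adj_of_edge ((h a b).2 (.inl hR)) (by grind)).reachable

/-- The two edges in which the three graphs of an Arnold expression differ. -/
def arnoldEdges {S : Type} (a b c : S) : Fin 3 → S → S → Prop :=
  ![fun x y => (x = a ∧ y = b) ∨ (x = b ∧ y = c),
    fun x y => (x = b ∧ y = c) ∨ (x = c ∧ y = a), fun x y => (x = c ∧ y = a) ∨ (x = a ∧ y = b)]

theorem arnoldEdges_subset {S : Type} (a b c : S) : ∀ i x y, arnoldEdges a b c i x y →
    (x = a ∧ y = b) ∨ (x = b ∧ y = c) ∨ (x = c ∧ y = a) := by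
  have h0 : ∀ x y, arnoldEdges a b c 0 x y →
      (x = a ∧ y = b) ∨ (x = b ∧ y = c) ∨ (x = c ∧ y = a) := fun x y h => Or.imp_right Or.inl h
  have h1 : ∀ x y, arnoldEdges a b c 1 x y →
      (x = a ∧ y = b) ∨ (x = b ∧ y = c) ∨ (x = c ∧ y = a) := fun x y h => Or.inr h
  have h2 : ∀ x y, arnoldEdges a b c 2 x y →
      (x = a ∧ y = b) ∨ (x = b ∧ y = c) ∨ (x = c ∧ y = a) :=
    fun x y h => h.elim (fun h => .inr (.inr h)) .inl
  intro i x y h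
  fin_cases i
  · exact h0 x y h
  · exact h1 x y h
  · exact h2 x y h

theorem arnoldEdges_reachable {S : Type} {a b c : S} (hab : a ≠ b) (hbc : b ≠ c) (hca : c ≠ a)
    (j : Fin 3) : (SimpleGraph.fromRel (arnoldEdges a b c j)).Reachable a b ∧
      (SimpleGraph.fromRel (arnoldEdges a b c j)).Reachable a c := by
  have e : ∀ F : S → S → Prop, ∀ x y, x ≠ y → F x y →
      (SimpleGraph.fromRel F).Reachable x y := fun F x y hne h =>
    SimpleGraph.Adj.reachable ⟨hne, .inl h⟩
  fin_cases j
  · have e1 := e (arnoldEdges a b c 0) a b hab (.inl ⟨rfl, rfl⟩)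
    have e2 := e (arnoldEdges a b c 0) b c hbc (.inr ⟨rfl, rfl⟩)
    exact ⟨e1, e1.trans e2⟩
  · have e1 := e (arnoldEdges a b c 1) b c hbc (.inl ⟨rfl, rfl⟩)
    have e2 := e (arnoldEdges a b c 1) c a hca (.inr ⟨rfl, rfl⟩)
    exact ⟨(e1.trans e2).symm, e2.symm⟩
  · have e1 := e (arnoldEdges a b c 2) c a hca (.inl ⟨rfl, rfl⟩)
    have e2 := e (arnoldEdges a b c 2) a b hab (.inr ⟨rfl, rfl⟩)
    exact ⟨e2, e1.symm⟩

theorem isVanishingFamily_arnold {S : Type} [Fintype S] (G₁ G₂ G₃ : SGraph S)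
    (R : S → S → Prop) (a b c : S)
    (h₁ : ∀ x y, G₁.Edge x y ↔ R x y ∨ (x = a ∧ y = b) ∨ (x = b ∧ y = c))
    (h₂ : ∀ x y, G₂.Edge x y ↔ R x y ∨ (x = b ∧ y = c) ∨ (x = c ∧ y = a))
    (h₃ : ∀ x y, G₃.Edge x y ↔ R x y ∨ (x = c ∧ y = a) ∨ (x = a ∧ y = b))
    (hRab : ¬ R a b) (hRbc : ¬ R b c) (hRca : ¬ R c a) :
    IsVanishingFamily k ![G₁, G₂, G₃] R (arnoldEdges a b c) := by
  have hab := G₁.ne_of_edge ((h₁ a b).2 (by simp))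
  have hbc := G₁.ne_of_edge ((h₁ b c).2 (by simp))
  have hca := G₂.ne_of_edge ((h₂ c a).2 (by simp))
  refine ⟨?_, ?_, ⟨a, ?_⟩, ?_⟩
  · intro i x y
    fin_cases i
    · exact h₁ x y
    · exact h₂ x y
    · exact h₃ x y
  · intro i x y hR hh
    rcases arnoldEdges_subset a b c i x y hh with ⟨rfl, rfl⟩ | ⟨rfl, rfl⟩ | ⟨rfl, rfl⟩
    · exact hRab hR
    · exact hRbc hR
    · exact hRca hR
  · intro i j x y hxy
    have h0 := arnoldEdges_reachable hab hbc hca j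
    rcases arnoldEdges_subset a b c i x y hxy with ⟨rfl, rfl⟩ | ⟨rfl, rfl⟩ | ⟨rfl, rfl⟩
    · exact ⟨.refl _, h0.1⟩
    · exact h0
    · exact ⟨h0.2, .refl _⟩
  · intro A P R' hA hP
    obtain ⟨ha, hb⟩ := hA 0 a b (.inl ⟨rfl, rfl⟩)
    obtain ⟨-, hc⟩ := hA 0 b c (.inr ⟨rfl, rfl⟩)
    rw [Fin.sum_univ_three]
    refine graphCls_arnold (P 0) (P 1) (P 2) R' ⟨a, ha⟩ ⟨b, hb⟩ ⟨c, hc⟩ (fun x y => ?_)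
      (fun x y => ?_) fun x y => ?_
    · rw [hP 0]
      simp [arnoldEdges, Subtype.ext_iff]
    · rw [hP 1]
      simp [arnoldEdges, Subtype.ext_iff]
    · rw [hP 2]
      simp [arnoldEdges, Subtype.ext_iff]

/-- The six cuts at sides of the triangle pair up according to the side that remains. For instance,
`G₁` without `a → b` and `G₂` without `c → a` both consist of `R` and `b → c`; both cuts separate
`a` from `{b, c}`, with opposite signs. -/
theorem map_toEbar_cobracketRep_arnold (G₁ G₂ G₃ : SGraph S) (R : S → S → Prop) (a b c : S)
    (h₁ : ∀ x y, G₁.Edge x y ↔ R x y ∨ (x = a ∧ y = b) ∨ (x = b ∧ y = c))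
    (h₂ : ∀ x y, G₂.Edge x y ↔ R x y ∨ (x = b ∧ y = c) ∨ (x = c ∧ y = a))
    (h₃ : ∀ x y, G₃.Edge x y ↔ R x y ∨ (x = c ∧ y = a) ∨ (x = a ∧ y = b))
    (x : ⨂[k] _ : S, W) :
    TensorProduct.map (toEbar 𝒲) (toEbar 𝒲) (cobracketRep 𝒲 S
      ((Finsupp.single G₁ 1 + Finsupp.single G₂ 1 + Finsupp.single G₃ 1) ⊗ₜ x)) = 0 := by
  classical
  have hab := G₁.ne_of_edge ((h₁ a b).2 (by simp))
  have hbc := G₁.ne_of_edge ((h₁ b c).2 (by simp))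
  have hca := G₂.ne_of_edge ((h₂ c a).2 (by simp))
  have hRab : ¬ R a b := G₂.not_edge_of_path h₂ hab
  have hRbc : ¬ R b c := G₃.not_edge_of_path h₃ hbc
  have hRca : ¬ R c a := G₁.not_edge_of_path h₁ hca
  have hv := isVanishingFamily_arnold (k := k) G₁ G₂ G₃ R a b c h₁ h₂ h₃ hRab hRbc hRca
  have key := hv.sum_cobracketRep 𝒲 x
  rw [Fin.sum_univ_three, Fin.sum_univ_three] at key
  rw [TensorProduct.add_tmul, TensorProduct.add_tmul, map_add, map_add, map_add, map_add]
  refine key.trans ?_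
  have hsum : ∀ (i : Fin 3) (p q r : S) (f : S × S → Ebar 𝒲 ⊗[k] Ebar 𝒲), p ≠ q →
      (∀ x y, arnoldEdges a b c i x y ↔ (x = p ∧ y = q) ∨ (x = q ∧ y = r)) →
      ∑ e : S × S, (if arnoldEdges a b c i e.1 e.2 then f e else 0) = f (p, q) + f (q, r) := by
    intro i p q r f hpq hi
    rw [← Finset.sum_filter, ← Finset.sum_pair (fun h => hpq (congrArg Prod.fst h))]
    refine Finset.sum_congr (Finset.ext fun e => ?_) fun _ _ => rfl
    simp [hi, Prod.ext_iff]
  have e1 : G₁.cutRel a b = G₂.cutRel c a := by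
    refine funext₂ fun x y => propext ?_
    rw [SGraph.cutRel, SGraph.cutRel, h₁, h₂]
    grind
  have e2 : G₁.cutRel b c = G₃.cutRel c a := by
    refine funext₂ fun x y => propext ?_
    rw [SGraph.cutRel, SGraph.cutRel, h₁, h₃]
    grind
  have e3 : G₂.cutRel b c = G₃.cutRel a b := by
    refine funext₂ fun x y => propext ?_
    rw [SGraph.cutRel, SGraph.cutRel, h₂, h₃]
    grind
  have f1 := splitComp_add_of_edge 𝒲 (G₁.cutRel a b) (a := a) hbc ⟨by simp [h₁], by grind⟩
  nth_rw 2 [e1] at f1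
  have f2 := splitComp_add_of_edge 𝒲 (G₁.cutRel b c) (a := c) hab ⟨by simp [h₁], by grind⟩
  nth_rw 1 [e2] at f2
  have f3 := splitComp_add_of_edge 𝒲 (G₂.cutRel b c) (a := b) hca ⟨by simp [h₂], by grind⟩
  nth_rw 2 [e3] at f3
  rw [hsum 0 a b c _ hab fun _ _ => Iff.rfl, hsum 1 b c a _ hbc fun _ _ => Iff.rfl,
    hsum 2 c a b _ hca fun _ _ => Iff.rfl]
  have f1' := LinearMap.congr_fun f1 x
  have f2' := LinearMap.congr_fun f2 x
  have f3' := LinearMap.congr_fun f3 x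
  rw [LinearMap.add_apply, LinearMap.zero_apply] at f1' f2' f3'
  calc _ = (splitComp 𝒲 (G₁.cutRel a b) a b x + splitComp 𝒲 (G₂.cutRel c a) c a x) +
      (splitComp 𝒲 (G₃.cutRel c a) c a x + splitComp 𝒲 (G₁.cutRel b c) b c x) +
      (splitComp 𝒲 (G₂.cutRel b c) b c x + splitComp 𝒲 (G₃.cutRel a b) a b x) := by
        simp only [Matrix.cons_val_zero, Matrix.cons_val_one, Matrix.cons_val_two]
        abel
    _ = 0 := by rw [f1', f2', f3']; simp

theorem arn_le_ker_cobracketN (n : ℕ) : arn 𝒲 n ≤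
    LinearMap.ker (TensorProduct.map (toEbar 𝒲) (toEbar 𝒲) ∘ₗ cobracketN 𝒲 n) := by
  rw [arn, Submodule.span_le]
  rintro _ ⟨r, hr, w, rfl⟩
  rw [SetLike.mem_coe, LinearMap.mem_ker, LinearMap.comp_apply, cobracketN_mkGbar]
  cases hr with
  | arrow G G' R a b h h' => exact map_toEbar_cobracketRep_arrow 𝒲 G G' R a b h h' w
  | arnold G₁ G₂ G₃ R a b c h₁ h₂ h₃ =>
    exact map_toEbar_cobracketRep_arnold 𝒲 G₁ G₂ G₃ R a b c h₁ h₂ h₃ w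

end Coideal

/-! ### Linear algebra of the inductive quotient. -/

section LinearAlgebra

variable {k : Type*} [Field k]

theorem LinearMap.exists_comp_eq_of_ker_le {V X Y : Type*} [AddCommGroup V] [Module k V]
    [AddCommGroup X] [Module k X] [AddCommGroup Y] [Module k Y] (f : V →ₗ[k] X) (g : V →ₗ[k] Y)
    (h : LinearMap.ker f ≤ LinearMap.ker g) : ∃ φ : X →ₗ[k] Y, φ ∘ₗ f = g := by
  obtain ⟨s, hs⟩ := ((LinearMap.ker f).liftQ f le_rfl).exists_leftInverse_of_injective
    (Submodule.ker_liftQ_eq_bot _ _ _ le_rfl)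
  refine ⟨(LinearMap.ker f).liftQ g h ∘ₗ s, LinearMap.ext fun x => ?_⟩
  have hx := LinearMap.congr_fun hs (Submodule.Quotient.mk x)
  simp only [LinearMap.comp_apply, Submodule.liftQ_apply, LinearMap.id_apply] at hx
  rw [LinearMap.comp_apply, LinearMap.comp_apply, hx, Submodule.liftQ_apply]

/-- Over a field `g` factors through `f`. Consequently the kernel of `f ⊗ f` depends only on that of
`f`, and the quotients by `K` may be replaced by any graded map with the same kernels. -/
theorem TensorProduct.ker_map_self_le {V X Y : Type*} [AddCommGroup V] [Module k V]
    [AddCommGroup X] [Module k X] [AddCommGroup Y] [Module k Y] (f : V →ₗ[k] X) (g : V →ₗ[k] Y)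
    (h : LinearMap.ker f ≤ LinearMap.ker g) :
    LinearMap.ker (TensorProduct.map f f) ≤ LinearMap.ker (TensorProduct.map g g) := by
  obtain ⟨φ, rfl⟩ := f.exists_comp_eq_of_ker_le g h
  rw [TensorProduct.map_comp]
  exact LinearMap.ker_le_ker_comp _ _

/-- The projection of a graded vector space to its part of weights `< n`. -/
noncomputable def weightTrunc (k : Type*) [CommRing k] (B : ℕ → Type*) [∀ n, AddCommGroup (B n)]
    [∀ n, Module k (B n)] (n : ℕ) : (⨁ n, B n) →ₗ[k] (⨁ n, B n) :=
  DirectSum.lmap fun m => if m < n then LinearMap.id else 0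

variable {A B : ℕ → Type*} [∀ n, AddCommGroup (A n)] [∀ n, Module k (A n)]
  [∀ n, AddCommGroup (B n)] [∀ n, Module k (B n)]

/-- A criterion for a graded map to have the same kernel as the projection to the inductive
quotient. -/
theorem inductiveKer_eq_ker (δ : (⨁ n, A n) →ₗ[k] (⨁ n, A n) ⊗[k] (⨁ n, A n))
    (π : ∀ n, A n →ₗ[k] B n) (h1 : LinearMap.ker (π 1) = ⊥)
    (hker : ∀ n, n ≠ 1 → LinearMap.ker (π n) = LinearMap.ker
      (TensorProduct.map (DirectSum.lmap π) (DirectSum.lmap π) ∘ₗ δ ∘ₗ DirectSum.lof k ℕ A n))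
    (htrunc : ∀ n x, TensorProduct.map (weightTrunc k B n) (weightTrunc k B n)
      (TensorProduct.map (DirectSum.lmap π) (DirectSum.lmap π) (δ (DirectSum.lof k ℕ A n x))) =
      TensorProduct.map (DirectSum.lmap π) (DirectSum.lmap π) (δ (DirectSum.lof k ℕ A n x)))
    (n : ℕ) : inductiveKer δ n = LinearMap.ker (π n) := by
  induction n using Nat.strong_induction_on with
  | _ n ih =>
  rw [inductiveKer]
  split_ifs with hn
  · rw [hn, h1]
  rw [hker n hn]
  set q : (⨁ n, A n) →ₗ[k] ((m : Fin n) → A m ⧸ inductiveKer δ m) :=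
    LinearMap.pi fun m => (inductiveKer δ m).mkQ ∘ₗ DirectSum.component k ℕ A m with hq
  -- By the induction hypothesis both maps test the vanishing of `π m` on the components of weight
  -- `m < n`.
  have hqker : LinearMap.ker q = LinearMap.ker (weightTrunc k B n ∘ₗ DirectSum.lmap π) := by
    ext x
    have e1 : x ∈ LinearMap.ker q ↔ ∀ m : Fin n, π m (x m) = 0 := by
      rw [LinearMap.mem_ker, hq, funext_iff]
      refine forall_congr' fun m => ?_
      rw [LinearMap.pi_apply, LinearMap.comp_apply, Submodule.mkQ_apply, Pi.zero_apply,
        Submodule.Quotient.mk_eq_zero, ih m m.2, LinearMap.mem_ker]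
      rfl
    have e2 : x ∈ LinearMap.ker (weightTrunc k B n ∘ₗ DirectSum.lmap π) ↔
        ∀ m, (if m < n then LinearMap.id else (0 : B m →ₗ[k] B m)) (π m (x m)) = 0 := by
      rw [LinearMap.mem_ker, DFinsupp.ext_iff]
      refine forall_congr' fun m => ?_
      simp only [weightTrunc, LinearMap.comp_apply, DirectSum.lmap_apply]
      rfl
    rw [e1, e2]
    constructor
    · intro h m
      split_ifs with hm
      · exact h ⟨m, hm⟩
      · rfl
    · intro h m
      have := h m
      rwa [if_pos m.2] at this
  have hle := TensorProduct.ker_map_self_le _ _ hqker.le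
  have hge := TensorProduct.ker_map_self_le _ _ hqker.ge
  ext x
  simp only [LinearMap.mem_ker, LinearMap.comp_apply]
  -- The image of `δ` under `π ⊗ π` already lives in weights `< n`, so truncating it loses nothing.
  rw [← htrunc n x, ← LinearMap.comp_apply (TensorProduct.map (weightTrunc k B n) _),
    ← TensorProduct.map_comp]
  exact ⟨fun h => hle h, fun h => hge h⟩

end LinearAlgebra

/-! ### Weights of the cobracket, and the weights 0 and 1. -/

section Graphs

variable {k : Type*} [CommRing k] {W : Type*} [AddCommGroup W] [Module k W]
  (𝒲 : ℤ → Submodule k W) [DirectSum.Decomposition 𝒲]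

theorem weightTrunc_toEbar_toGbar {S : Type} [Fintype S] [LinearOrder S] {n : ℕ}
    (h : Fintype.card S < n) (X : LabelledGraphs k W S) :
    weightTrunc k (fun n => GbarN 𝒲 n ⧸ arn 𝒲 n) n (toEbar 𝒲 (toGbar 𝒲 S X)) =
      toEbar 𝒲 (toGbar 𝒲 S X) := by
  simp only [toGbar, LinearMap.comp_apply, toEbar_lof]
  rw [weightTrunc, DirectSum.lmap_lof, if_pos h, LinearMap.id_apply]

/-- Both components left by the removal of an edge are nonempty, so each has fewer than `n`
vertices. -/
theorem weightTrunc_cobracketN (n : ℕ) (x : GbarN 𝒲 n) :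
    TensorProduct.map (weightTrunc k (fun n => GbarN 𝒲 n ⧸ arn 𝒲 n) n)
      (weightTrunc k (fun n => GbarN 𝒲 n ⧸ arn 𝒲 n) n)
      (TensorProduct.map (toEbar 𝒲) (toEbar 𝒲) (cobracketN 𝒲 n x)) =
    TensorProduct.map (toEbar 𝒲) (toEbar 𝒲) (cobracketN 𝒲 n x) := by
  classical
  obtain ⟨X, rfl⟩ := mkGbar_surjective 𝒲 n x
  rw [cobracketN_mkGbar]
  simp only [← LinearMap.comp_apply]
  refine LinearMap.congr_fun (labelledGraphs_ext fun G w => ?_) X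
  simp only [LinearMap.comp_apply, cobracketRep_single, map_sum]
  refine Finset.sum_congr rfl fun e _ => ?_
  have hc := G.isCompl_side e.2
  have hlt : ∀ p q, (∀ x, x ∈ G.side e.1.1 e.1.2 p ↔ x ∉ G.side e.1.1 e.1.2 q) →
      Fintype.card (G.side e.1.1 e.1.2 p) < n := by
    intro p q h
    rw [Fintype.card_coe]
    conv_rhs => rw [← Fintype.card_fin n, ← Finset.card_univ]
    refine Finset.card_lt_card ((Finset.ssubset_univ_iff).2 fun hu => ?_)
    exact (h q).1 (hu ▸ Finset.mem_univ q) ((G.mem_side ..).2 (.refl _))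
  have key : ∀ p q (h : ∀ x, x ∈ G.side e.1.1 e.1.2 p ↔ x ∉ G.side e.1.1 e.1.2 q)
      (h' : ∀ x, x ∈ G.side e.1.1 e.1.2 q ↔ x ∉ G.side e.1.1 e.1.2 p) z,
      TensorProduct.map (weightTrunc k (fun n => GbarN 𝒲 n ⧸ arn 𝒲 n) n)
        (weightTrunc k (fun n => GbarN 𝒲 n ⧸ arn 𝒲 n) n)
        (TensorProduct.map (toEbar 𝒲) (toEbar 𝒲) (TensorProduct.map
          (graphClass 𝒲 (G.piece e.2 p)) (graphClass 𝒲 (G.piece e.2 q)) z)) =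
      TensorProduct.map (toEbar 𝒲) (toEbar 𝒲) (TensorProduct.map
          (graphClass 𝒲 (G.piece e.2 p)) (graphClass 𝒲 (G.piece e.2 q)) z) := by
    intro p q h h' z
    induction z using TensorProduct.induction_on with
    | zero => simp
    | add a b ha hb => simp only [map_add, ha, hb]
    | tmul a b =>
      simp only [TensorProduct.map_tmul, graphClass, LinearMap.comp_apply]
      rw [weightTrunc_toEbar_toGbar 𝒲 (hlt p q h), weightTrunc_toEbar_toGbar 𝒲 (hlt q p h')]
  rw [edgeTerm, LinearMap.sub_apply, map_sub, map_sub, LinearMap.comp_apply,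
    LinearMap.comp_apply, key _ _ hc fun x => by rw [hc x, not_not],
    key _ _ (fun x => by rw [hc x, not_not]) hc]

/-- A graph with one vertex has no edge and so enters no relation; this matches the convention `K¹ =
0`. -/
theorem arn_one : arn 𝒲 1 = ⊥ := by
  rw [arn, Submodule.span_eq_bot]
  rintro _ ⟨r, hr, w, rfl⟩
  exfalso
  cases hr with
  | arrow G G' R a b h h' =>
    exact G.ne_of_edge ((h a b).2 (.inr ⟨rfl, rfl⟩)) (Subsingleton.elim _ _)
  | arnold G₁ G₂ G₃ R a b c h₁ h₂ h₃ =>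
    exact G₁.ne_of_edge ((h₁ a b).2 (.inr (.inl ⟨rfl, rfl⟩))) (Subsingleton.elim _ _)

theorem labelledGraphs_fin_zero (X : LabelledGraphs k W (Fin 0)) : X = 0 := by
  have : (LinearMap.id : LabelledGraphs k W (Fin 0) →ₗ[k] _) = 0 :=
    labelledGraphs_ext fun G x => (G.isTree.1.nonempty.elim Fin.elim0)
  exact LinearMap.congr_fun this X

end Graphs

/-! ### The kernel of the cobracket and the inductive quotient of `Ḡ(W)`. -/

section MainParts

variable {k : Type*} [Field k] [CharZero k] {W : Type*} [AddCommGroup W] [Module k W]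
  (𝒲 : ℤ → Submodule k W) [DirectSum.Decomposition 𝒲]

theorem ker_cobracketN_eq_arn {n : ℕ} (hn : n ≠ 1) :
    LinearMap.ker (TensorProduct.map (toEbar 𝒲) (toEbar 𝒲) ∘ₗ cobracketN 𝒲 n) = arn 𝒲 n := by
  refine le_antisymm ?_ (arn_le_ker_cobracketN 𝒲 n)
  rcases Nat.eq_zero_or_pos n with rfl | hpos
  · intro x _
    obtain ⟨X, rfl⟩ := mkGbar_surjective 𝒲 0 x
    rw [labelledGraphs_fin_zero X, map_zero]
    exact Submodule.zero_mem _
  · exact ker_cobracketN_le_arn 𝒲 (by omega)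

theorem inductiveKer_cobracket (n : ℕ) : inductiveKer (cobracket 𝒲) n = arn 𝒲 n := by
  have hlof : ∀ n, cobracket 𝒲 ∘ₗ DirectSum.lof k ℕ (GbarN 𝒲) n = cobracketN 𝒲 n := fun n =>
    LinearMap.ext fun x => DirectSum.toModule_lof k n x
  rw [inductiveKer_eq_ker (cobracket 𝒲) (fun n => (arn 𝒲 n).mkQ), Submodule.ker_mkQ]
  · rw [Submodule.ker_mkQ, arn_one]
  · intro n hn
    rw [hlof, Submodule.ker_mkQ]
    exact (ker_cobracketN_eq_arn 𝒲 hn).symm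
  · intro n x
    rw [← LinearMap.comp_apply (cobracket 𝒲), hlof]
    exact weightTrunc_cobracketN 𝒲 n x

end MainParts

/-! ### Long graphs span modulo the relations. -/

section Spanning

variable {k : Type*} [CommRing k] {S : Type}

/-- A graph is long if it is isomorphic to one of the graphs `0 → 1 → ⋯ → m`. -/
def SGraph.IsLong (G : SGraph S) : Prop :=
  ∃ (m : ℕ) (e : S ≃ Fin (m + 1)), G.map e = SGraph.long m

/-- Two graphs agree if all edges of the first one are edges of the second one. -/
theorem SGraph.edge_of_edge [Finite S] (G H : SGraph S) (h : ∀ x y, H.Edge x y → G.Edge x y)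
    {x y : S} (hxy : G.Edge x y) : H.Edge x y := by
  have hmin := (SimpleGraph.isTree_iff_minimal_connected.1 G.isTree).2 H.isTree.1
    (fun x y hxy => ⟨hxy.1, hxy.2.imp (h x y) (h y x)⟩)
  rcases (hmin (show (SimpleGraph.fromRel G.Edge).Adj x y from
    ⟨G.ne_of_edge hxy, .inl hxy⟩)).2 with h' | h'
  · exact h'
  · exact absurd (h y x h') (G.asymm x y hxy)

/-- A chain through all vertices is a long graph contained in `G`, and a tree has no proper
connected spanning subgraph. -/
theorem SGraph.isLong_of_isChain [Finite S] (G : SGraph S) (L : List S) (hL : L.IsChain G.Edge)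
    (hn : L.Nodup) (hall : ∀ x, x ∈ L) : G.IsLong := by
  classical
  obtain ⟨v⟩ := G.isTree.1.nonempty
  obtain ⟨m, hm⟩ : ∃ m, L.length = m + 1 :=
    Nat.exists_eq_succ_of_ne_zero (List.length_pos_of_mem (hall v)).ne'
  let e : S ≃ Fin (m + 1) := (hn.getEquivOfForallMemList L hall).symm.trans (finCongr hm)
  have he : ∀ i : Fin (m + 1), e.symm i = L[(i : ℕ)]'(by omega) := fun i => rfl
  have hle : ∀ x y, (SGraph.long m).Edge x y → (G.map e).Edge x y := by
    intro x y hxy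
    change G.Edge (e.symm x) (e.symm y)
    have hxy' : (x : ℕ) + 1 = y := hxy
    rw [he, he]
    simp only [← hxy']
    exact List.isChain_iff_getElem.1 hL x (by omega)
  refine ⟨m, e, SGraph.ext (funext₂ fun x y => propext ⟨fun h => ?_, hle x y⟩)⟩
  exact SGraph.edge_of_edge _ _ hle h

/-- Otherwise membership in `L` would be constant along edges, hence on the whole connected graph.
-/
theorem SGraph.exists_adj_of_not_mem (G : SGraph S) {L : List S} {v w : S} (hv : v ∈ L)
    (hw : w ∉ L) : ∃ p ∈ L, ∃ l ∉ L, G.Edge p l ∨ G.Edge l p := by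
  by_contra! hcon
  have : ∀ x y, (SimpleGraph.fromRel G.Edge).Adj x y → (x ∈ L) = (y ∈ L) := by
    intro x y hxy
    refine propext ⟨fun hx => ?_, fun hy => ?_⟩
    · by_contra hy
      exact hxy.2.elim (hcon x hx y hy).1 (hcon x hx y hy).2
    · by_contra hx
      exact hxy.2.elim (hcon y hy x hx).2 (hcon y hy x hx).1
  have h := (G.isTree.1.preconnected v w).eq_of_forall_adj this
  exact hw (h ▸ hv)

variable [Fintype S]

/-- Modulo the arrow-reversing and Arnold expressions, two edges `p → q`, `p → l` with the same
source may be replaced by `p → q → l` or `p → l → q`. -/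
theorem graphCls_fork (G : SGraph S) {p q l : S} (hpq : G.Edge p q) (hpl : G.Edge p l)
    (hql : q ≠ l) : ∃ H₁ H₂ : SGraph S,
      (∀ x y, H₁.Edge x y ↔ (G.Edge x y ∧ ¬ (x = p ∧ y = l)) ∨ (x = q ∧ y = l)) ∧
      (∀ x y, H₂.Edge x y ↔ (G.Edge x y ∧ ¬ (x = p ∧ y = q)) ∨ (x = l ∧ y = q)) ∧
      graphCls k G = graphCls k H₁ + graphCls k H₂ := by
  have hp := G.ne_of_edge hpq
  have hnql : ¬ G.Edge q l := fun h => by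
    have h1 := (G.cut_adj_of_edge hpq (a := p) (b := l) (by grind)).reachable
    have h2 := (G.cut_adj_of_edge h (a := p) (b := l) (by grind)).reachable
    exact G.not_reachable_cut hpl (h1.trans h2)
  obtain ⟨H₁, h₁⟩ := G.exists_replace hpl (u := q) (v := l) fun h =>
    G.not_reachable_cut hpl ((G.cut_adj_of_edge hpq (by grind)).reachable.trans h)
  -- `H₃` contains `p → l` and `q → l`. The triangle `p, q, l` gives `H₁ = H₃ + G`, and reversing `q
  -- → l` turns `H₃` into `-H₂`.
  obtain ⟨H₃, h₃⟩ := G.exists_replace hpq (u := q) (v := l) fun h =>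
    G.not_reachable_cut hpq ((G.cut_adj_of_edge hpl (by grind)).reachable.trans h.symm)
  obtain ⟨H₂, h₂, hc⟩ := exists_reverse (k := k) H₃ ((h₃ q l).2 (.inr ⟨rfl, rfl⟩))
  refine ⟨H₁, H₂, h₁, fun x y => ?_, ?_⟩
  · rw [h₂, h₃]
    grind
  · have := graphCls_triangle (k := k) H₁ H₃ G
      (fun x y => G.Edge x y ∧ ¬ (x = p ∧ y = q) ∧ ¬ (x = p ∧ y = l)) p q l (by simp) hp hql
      (fun x y => by rw [h₁]; grind) (fun x y => by rw [h₃]; grind) (fun x y => by grind)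
    rw [hc, this]
    abel

/-- The vertex `l` branches off a chain at `p`. Resolving the fork either inserts `l` right after
`p`, which lengthens the chain, or moves the branching point one step along the chain. At the end of
the chain `l` simply extends it. -/
theorem graphCls_mem_of_fork (N : Submodule k (Eil k S)) {d : ℕ}
    (ih : ∀ (G : SGraph S) (L : List S), L.IsChain G.Edge → L.Nodup → d < L.length →
      graphCls k G ∈ N)
    (ys : List S) : ∀ (G : SGraph S) (xs : List S) (p l : S), (xs ++ p :: ys).IsChain G.Edge →
      (l :: (xs ++ p :: ys)).Nodup → d ≤ (xs ++ p :: ys).length → G.Edge p l →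
      graphCls k G ∈ N := by
  induction ys with
  | nil =>
    intro G xs p l hL hn hd hpl
    refine ih G (xs ++ [p, l]) ?_ (by grind) (by simp at hd ⊢; omega)
    rw [List.isChain_append_cons_cons]
    exact ⟨hL, hpl, List.isChain_singleton _⟩
  | cons q ys ihy =>
    intro G xs p l hL hn hd hpl
    have hL' := hL
    rw [List.isChain_append_cons_cons] at hL'
    obtain ⟨hx, hpq, hy⟩ := hL'
    have hql : q ≠ l := by grind
    obtain ⟨H₁, H₂, h₁, h₂, h⟩ := graphCls_fork (k := k) G hpq hpl hql
    rw [h]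
    refine N.add_mem ?_ ?_
    · refine ihy H₁ (xs ++ [p]) q l ?_ (by simpa using hn) (by simpa using hd)
        ((h₁ q l).2 (.inr ⟨rfl, rfl⟩))
      rw [List.append_assoc, List.singleton_append]
      refine List.IsChain.imp_of_mem_imp (fun x y hx hy hxy => (h₁ x y).2 (.inl ⟨hxy, ?_⟩)) hL
      rintro ⟨-, rfl⟩
      grind
    · refine ih H₂ (xs ++ p :: l :: q :: ys) ?_ (by grind) (by simp at hd ⊢; omega)
      rw [List.isChain_append_cons_cons, List.isChain_cons_cons]
      refine ⟨?_, (h₂ p l).2 (.inl ⟨hpl, fun h => hql h.2.symm⟩), (h₂ l q).2 (.inr ⟨rfl, rfl⟩), ?_⟩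
      · refine List.IsChain.imp_of_mem_imp (fun x y hx hy hxy => (h₂ x y).2 (.inl ⟨hxy, ?_⟩)) hx
        rintro ⟨-, rfl⟩
        grind
      · refine List.IsChain.imp_of_mem_imp (fun x y hx hy hxy => (h₂ x y).2 (.inl ⟨hxy, ?_⟩)) hy
        rintro ⟨rfl, -⟩
        grind

/-- Induction on the number of vertices missed by a directed chain: connectedness provides a vertex
attached to the chain, and resolving forks absorbs it. -/
theorem graphCls_mem_of_isChain (N : Submodule k (Eil k S))
    (hN : ∀ G : SGraph S, G.IsLong → graphCls k G ∈ N) (d : ℕ) : ∀ (G : SGraph S) (L : List S),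
      L.IsChain G.Edge → L.Nodup → L ≠ [] → Fintype.card S - L.length = d →
      graphCls k G ∈ N := by
  induction d using Nat.strong_induction_on with
  | _ d ih =>
  intro G L hL hn hne hd
  by_cases hall : ∀ x, x ∈ L
  · exact hN G (G.isLong_of_isChain L hL hn hall)
  push Not at hall
  obtain ⟨w, hw⟩ := hall
  obtain ⟨v, hv⟩ := List.exists_mem_of_ne_nil L hne
  obtain ⟨p, hp, l, hl, hpl⟩ := G.exists_adj_of_not_mem hv hw
  have hcard : ∀ L' : List S, L'.Nodup → L'.length ≤ Fintype.card S := fun L' h =>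
    h.length_le_card
  have hlt := hcard (l :: L) (List.nodup_cons.2 ⟨hl, hn⟩)
  rw [List.length_cons] at hlt
  obtain ⟨xs, ys, rfl⟩ := List.append_of_mem hp
  have key := graphCls_mem_of_fork N (d := (xs ++ p :: ys).length)
    (fun G' L' h1 h2 h3 => ih (Fintype.card S - L'.length) (by omega) G' L' h1 h2
      (by rintro rfl; simp at h3) rfl) ys
  rcases hpl with hpl | hlp
  · exact key G xs p l hL (List.nodup_cons.2 ⟨hl, hn⟩) le_rfl hpl
  · obtain ⟨G', h', hc⟩ := exists_reverse (k := k) G hlp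
    have := key G' xs p l (List.IsChain.imp_of_mem_imp (fun x y hx hy hxy =>
      (h' x y).2 (.inl ⟨hxy, by rintro ⟨rfl, -⟩; exact hl hx⟩)) hL)
      (List.nodup_cons.2 ⟨hl, hn⟩) le_rfl ((h' p l).2 (.inr ⟨rfl, rfl⟩))
    rw [hc] at this
    exact (N.neg_mem_iff).1 this

/-- The long graphs span all graphs modulo the arrow-reversing and Arnold expressions. -/
theorem graphCls_mem_of_isLong (N : Submodule k (Eil k S))
    (hN : ∀ G : SGraph S, G.IsLong → graphCls k G ∈ N) (G : SGraph S) : graphCls k G ∈ N := by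
  obtain ⟨v⟩ := G.isTree.1.nonempty
  exact graphCls_mem_of_isChain N hN _ G [v] (List.isChain_singleton _) (List.nodup_singleton _)
    (by simp) rfl

end Spanning

/-! ### The cotensor coalgebra maps onto `Ē(W)`. -/

section Cotensor

variable {k : Type*} [CommRing k] {W : Type*} [AddCommGroup W] [Module k W]
  (𝒲 : ℤ → Submodule k W) [DirectSum.Decomposition 𝒲]

/-- The map which sends a tensor to the class in `Ē(W)` of the long graph it labels. -/
noncomputable def longMap : ∀ n : ℕ, (⨂[k]^n W) →ₗ[k] GbarN 𝒲 n ⧸ arn 𝒲 n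
  -- There is no tree without vertices, so the target vanishes in weight 0.
  | 0 => 0
  | n + 1 => (arn 𝒲 (n + 1)).mkQ ∘ₗ graphify 𝒲 n

theorem toCotensor_eq {S : Type} [Fintype S] [LinearOrder S] {n : ℕ} (e : S ≃o Fin n) :
    toCotensor (k := k) 𝒲 S =
      DirectSum.lof k ℕ (fun n => ⨂[k]^n W) n ∘ₗ koszul 𝒲 e.toEquiv := by
  obtain rfl : Fintype.card S = n := by simpa using Fintype.card_congr e.toEquiv
  rw [toCotensor, Subsingleton.elim (Fintype.orderIsoFinOfCardEq S rfl).symm e]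

theorem longMap_toCotensor_of_isEmpty (S : Type) [Fintype S] [LinearOrder S] [IsEmpty S]
    (x : ⨂[k] _ : S, W) : DirectSum.lmap (longMap 𝒲) (toCotensor 𝒲 S x) = 0 := by
  let e : S ≃o Fin 0 := ⟨Equiv.equivOfIsEmpty _ _, fun {a} => isEmptyElim a⟩
  rw [toCotensor_eq 𝒲 e, LinearMap.comp_apply, DirectSum.lmap_lof, longMap, LinearMap.zero_apply,
    map_zero]

theorem lof_mkQ_graphify (m : ℕ) (x : ⨂[k] _ : Fin (m + 1), W) :
    DirectSum.lof k ℕ (fun n => GbarN 𝒲 n ⧸ arn 𝒲 n) (m + 1)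
      ((arn 𝒲 (m + 1)).mkQ (graphify 𝒲 m x)) = toEbar 𝒲 (graphClass 𝒲 (SGraph.long m) x) := by
  rw [← toEbar_lof, graphClass, LinearMap.comp_apply, toGbar_fin]
  rfl

theorem toEbar_graphClass_of_map_eq_long {S : Type} [Fintype S] [LinearOrder S] {m : ℕ}
    (e : S ≃ Fin (m + 1)) (G : SGraph S) (h : G.map e = SGraph.long m) (x : ⨂[k] _ : S, W) :
    toEbar 𝒲 (graphClass 𝒲 G x) = DirectSum.lof k ℕ (fun n => GbarN 𝒲 n ⧸ arn 𝒲 n) (m + 1)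
      (longMap 𝒲 (m + 1) (koszul 𝒲 e x)) := by
  rw [← graphClass_map 𝒲 e, h, longMap]
  exact (lof_mkQ_graphify 𝒲 m _).symm

theorem longMap_toCotensor {S : Type} [Fintype S] [LinearOrder S] {m : ℕ} (e : S ≃o Fin (m + 1))
    {F : S → S → Prop} (hF : ∀ x y, F x y ↔ (e x : ℕ) + 1 = e y) :
    DirectSum.lmap (longMap 𝒲) ∘ₗ toCotensor 𝒲 S = eilMap 𝒲 S (relCls k F) := by
  refine LinearMap.ext fun x => ?_
  have h : ((SGraph.long m).map e.symm.toEquiv).map e.toEquiv = SGraph.long m := by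
    ext x y
    change (SGraph.long m).Edge (e (e.symm x)) (e (e.symm y)) ↔ _
    simp
  rw [relCls_eq ((SGraph.long m).map e.symm.toEquiv) fun x y => (hF x y).symm, eilMap_graphCls,
    LinearMap.comp_apply, LinearMap.comp_apply, toEbar_graphClass_of_map_eq_long 𝒲 e.toEquiv _ h,
    toCotensor_eq 𝒲 e, LinearMap.comp_apply, DirectSum.lmap_lof]

/-- An interval of `Fin n` is order isomorphic to some `Fin p`. -/
def intervalIso {n : ℕ} (A : Finset (Fin n)) (l p : ℕ) (hlp : l + p ≤ n)
    (hA : ∀ x : Fin n, x ∈ A ↔ l ≤ x ∧ (x : ℕ) < l + p) : A ≃o Fin p where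
  toFun x := ⟨x - l, by have := (hA x).1 x.2; omega⟩
  invFun j := ⟨⟨l + j, by omega⟩, (hA _).2 ⟨by simp, by simp⟩⟩
  left_inv x := by
    have := (hA x).1 x.2
    ext
    simp only
    omega
  right_inv j := by simp
  map_rel_iff' {x y} := by
    have := (hA x).1 x.2
    have := (hA y).1 y.2
    rw [Equiv.coe_fn_mk, Fin.mk_le_mk, ← Subtype.coe_le_coe, Fin.le_def]
    omega

/-- Deconcatenation produces intervals, and a long graph restricted to an interval is again long. -/
theorem longMap_toCotensor_interval {n : ℕ} (A : Finset (Fin n)) (l p : ℕ) (hlp : l + (p + 1) ≤ n)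
    (hA : ∀ x : Fin n, x ∈ A ↔ l ≤ x ∧ (x : ℕ) < l + (p + 1)) {F : Fin n → Fin n → Prop}
    (hF : ∀ x ∈ A, ∀ y ∈ A, F x y ↔ (x : ℕ) + 1 = y) :
    DirectSum.lmap (longMap 𝒲) ∘ₗ toCotensor 𝒲 A =
      eilMap 𝒲 A (relCls k fun x y : A => F x y) := by
  refine longMap_toCotensor 𝒲 (intervalIso A l (p + 1) hlp hA) fun x y => ?_
  have hx := (hA x).1 x.2
  have hy := (hA y).1 y.2
  rw [hF x x.2 y y.2]
  change _ ↔ (x : ℕ) - l + 1 = y - l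
  omega

theorem SGraph.side_long {m i : ℕ} (hi : i < m) :
    (SGraph.long m).side ⟨i, by omega⟩ ⟨i + 1, by omega⟩ ⟨i, by omega⟩ =
      Finset.univ.filter (fun j : Fin (m + 1) => (j : ℕ) < i + 1) ∧
    (SGraph.long m).side ⟨i, by omega⟩ ⟨i + 1, by omega⟩ ⟨i + 1, by omega⟩ =
      Finset.univ.filter (fun j : Fin (m + 1) => ¬ (j : ℕ) < i + 1) := by
  have hE : (SGraph.long m).Edge ⟨i, by omega⟩ ⟨i + 1, by omega⟩ := rfl
  have hc := (SGraph.long m).isCompl_side hE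
  -- Being at most `i` is constant along every edge other than `i → i + 1`, hence on the components
  -- of the cut.
  have h1 : ∀ v x, x ∈ (SGraph.long m).side ⟨i, by omega⟩ ⟨i + 1, by omega⟩ v →
      ((v : ℕ) < i + 1) = ((x : ℕ) < i + 1) := by
    intro v x hx
    rw [mem_side] at hx
    refine hx.eq_of_forall_adj (f := fun v : Fin (m + 1) => (v : ℕ) < i + 1) ?_
    have h2 : ∀ x y : Fin (m + 1), (x : ℕ) + 1 = y →
        ¬ (x = ⟨i, by omega⟩ ∧ y = ⟨i + 1, by omega⟩) →
        ((x : ℕ) < i + 1) = ((y : ℕ) < i + 1) := by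
      intro x y hxy hn
      rw [Fin.ext_iff, Fin.ext_iff] at hn
      simp only at hn
      refine propext ⟨fun h => ?_, fun h => ?_⟩ <;> omega
    rintro x y ⟨-, h | h⟩
    · exact h2 x y h.1 h.2
    · exact (h2 y x h.1 h.2).symm
  have ha : ∀ x, x ∈ (SGraph.long m).side ⟨i, by omega⟩ ⟨i + 1, by omega⟩ ⟨i, by omega⟩ ↔
      (x : ℕ) < i + 1 := by
    intro x
    constructor
    · intro hx
      rw [← h1 _ x hx]
      simp
    · intro hx
      rw [hc]
      intro hb
      rw [← h1 _ x hb] at hx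
      simp at hx
  constructor
  · ext x
    simp [ha]
  · ext x
    have := ha x
    rw [hc] at this
    simp only [Finset.mem_filter, Finset.mem_univ, true_and]
    tauto

/-- Deconcatenating after position `i` and cutting the edge `i → i + 1` give the same two intervals,
and the same unshuffles, so the Koszul signs agree. -/
theorem map_longMap_antiCoprodN_term {m i : ℕ} (hi : i < m) (A B : Finset (Fin (m + 1)))
    (hA : A = Finset.univ.filter (fun j : Fin (m + 1) => (j : ℕ) < i + 1))
    (hB : B = Finset.univ.filter (fun j : Fin (m + 1) => ¬ (j : ℕ) < i + 1))
    (h : ∀ x, x ∈ A ↔ x ∉ B) (h' : ∀ x, x ∈ B ↔ x ∉ A) (x : ⨂[k] _ : Fin (m + 1), W) :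
    TensorProduct.map (DirectSum.lmap (longMap 𝒲)) (DirectSum.lmap (longMap 𝒲))
      ((TensorProduct.map (toCotensor 𝒲 A) (toCotensor 𝒲 B) ∘ₗ unshuffle 𝒲 A B h -
        TensorProduct.map (toCotensor 𝒲 B) (toCotensor 𝒲 A) ∘ₗ unshuffle 𝒲 B A h') x) =
      splitComp 𝒲 ((SGraph.long m).cutRel ⟨i, by omega⟩ ⟨i + 1, by omega⟩)
        ⟨i, by omega⟩ ⟨i + 1, by omega⟩ x := by
  have e : ∀ x y : Fin (m + 1),
      (SGraph.long m).cutRel ⟨i, by omega⟩ ⟨i + 1, by omega⟩ x y ↔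
      (x : ℕ) + 1 = y ∧ ¬ ((x : ℕ) = i ∧ (y : ℕ) = i + 1) := by
    intro x y
    rw [SGraph.cutRel, Fin.ext_iff, Fin.ext_iff]
    rfl
  have eA := longMap_toCotensor_interval (k := k) 𝒲 A 0 i (by omega)
    (by simp [hA]) (F := (SGraph.long m).cutRel ⟨i, by omega⟩ ⟨i + 1, by omega⟩)
    (by
      intro x hx y hy
      simp only [hA, Finset.mem_filter, Finset.mem_univ, true_and] at hx hy
      rw [e]
      omega)
  have eB := longMap_toCotensor_interval (k := k) 𝒲 B (i + 1) (m - i - 1) (by omega)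
    (by
      intro x
      simp only [hB, Finset.mem_filter, Finset.mem_univ, true_and]
      omega) (F := (SGraph.long m).cutRel ⟨i, by omega⟩ ⟨i + 1, by omega⟩)
    (by
      intro x hx y hy
      simp only [hB, Finset.mem_filter, Finset.mem_univ, true_and] at hx hy
      rw [e]
      omega)
  rw [splitComp, relComp_cutRel, relComp_cutRel, (SGraph.side_long hi).1, (SGraph.side_long hi).2,
    ← hA, ← hB, splitTerm, splitTerm, dif_pos h, dif_pos h', ← eA, ← eB, TensorProduct.map_comp,
    TensorProduct.map_comp, LinearMap.sub_apply, map_sub]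
  rfl

theorem map_longMap_of_isEmpty_left (A B : Type) [Fintype A] [LinearOrder A] [Fintype B]
    [LinearOrder B] [IsEmpty A] (z : (⨂[k] _ : A, W) ⊗[k] (⨂[k] _ : B, W)) :
    TensorProduct.map (DirectSum.lmap (longMap 𝒲)) (DirectSum.lmap (longMap 𝒲))
      (TensorProduct.map (toCotensor 𝒲 A) (toCotensor 𝒲 B) z) = 0 := by
  induction z using TensorProduct.induction_on with
  | zero => simp
  | add a b ha hb => simp only [map_add, ha, hb, add_zero]
  | tmul a b =>
    rw [TensorProduct.map_tmul, TensorProduct.map_tmul, longMap_toCotensor_of_isEmpty,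
      TensorProduct.zero_tmul]

theorem map_longMap_of_isEmpty_right (A B : Type) [Fintype A] [LinearOrder A] [Fintype B]
    [LinearOrder B] [IsEmpty B] (z : (⨂[k] _ : A, W) ⊗[k] (⨂[k] _ : B, W)) :
    TensorProduct.map (DirectSum.lmap (longMap 𝒲)) (DirectSum.lmap (longMap 𝒲))
      (TensorProduct.map (toCotensor 𝒲 A) (toCotensor 𝒲 B) z) = 0 := by
  induction z using TensorProduct.induction_on with
  | zero => simp
  | add a b ha hb => simp only [map_add, ha, hb, add_zero]
  | tmul a b =>
    rw [TensorProduct.map_tmul, TensorProduct.map_tmul, longMap_toCotensor_of_isEmpty 𝒲 B,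
      TensorProduct.tmul_zero]

/-- The extreme terms of the deconcatenation have a factor of weight 0, which `longMap` kills. -/
theorem map_longMap_antiCoprodN_end {n : ℕ} (A B : Finset (Fin n)) (hAB : A = ∅ ∨ B = ∅)
    (h : ∀ x, x ∈ A ↔ x ∉ B) (h' : ∀ x, x ∈ B ↔ x ∉ A) (x : ⨂[k] _ : Fin n, W) :
    TensorProduct.map (DirectSum.lmap (longMap 𝒲)) (DirectSum.lmap (longMap 𝒲))
      ((TensorProduct.map (toCotensor 𝒲 A) (toCotensor 𝒲 B) ∘ₗ unshuffle 𝒲 A B h -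
        TensorProduct.map (toCotensor 𝒲 B) (toCotensor 𝒲 A) ∘ₗ unshuffle 𝒲 B A h') x) = 0 := by
  rw [LinearMap.sub_apply, map_sub, LinearMap.comp_apply, LinearMap.comp_apply]
  rcases hAB with rfl | rfl
  · rw [map_longMap_of_isEmpty_left, map_longMap_of_isEmpty_right, sub_zero]
  · rw [map_longMap_of_isEmpty_right, map_longMap_of_isEmpty_left, sub_zero]

theorem map_longMap_antiCoprodN_zero (x : ⨂[k]^0 W) :
    TensorProduct.map (DirectSum.lmap (longMap 𝒲)) (DirectSum.lmap (longMap 𝒲))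
      (antiCoprodN 𝒲 0 x) = 0 := by
  rw [antiCoprodN, LinearMap.sum_apply, map_sum]
  exact Finset.sum_eq_zero fun i _ => map_longMap_antiCoprodN_end 𝒲 _ _
    (.inl (Finset.eq_empty_of_isEmpty _)) _ _ x

/-- The map from the cotensor coalgebra to `Ē(W)` is compatible with the cobrackets. -/
theorem map_longMap_antiCoprodN_succ (m : ℕ) (x : ⨂[k]^(m + 1) W) :
    TensorProduct.map (DirectSum.lmap (longMap 𝒲)) (DirectSum.lmap (longMap 𝒲))
      (antiCoprodN 𝒲 (m + 1) x) =
    TensorProduct.map (toEbar 𝒲) (toEbar 𝒲) (cobracketN 𝒲 (m + 1) (graphify 𝒲 m x)) := by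
  classical
  have hr : cobracketN 𝒲 (m + 1) (graphify 𝒲 m x) =
      cobracketRep 𝒲 _ (Finsupp.single (SGraph.long m) 1 ⊗ₜ x) := rfl
  rw [hr, map_toEbar_cobracketRep, antiCoprodN, LinearMap.sum_apply, map_sum, Fin.sum_univ_succ,
    Fin.sum_univ_castSucc, map_longMap_antiCoprodN_end 𝒲 _ _ (.inl (by simp)),
    map_longMap_antiCoprodN_end 𝒲 _ _ (.inr (by simp [Fin.is_le])), zero_add, add_zero,
    ← Finset.sum_filter]
  -- With the summands `0` and `m + 1` gone, the inner summand of index `i + 1` matches the edge `i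
  -- → i + 1`.
  refine Finset.sum_bij (fun i _ => (⟨i, by omega⟩, ⟨i + 1, by omega⟩)) ?_ ?_ ?_ ?_
  · intro i _
    rw [Finset.mem_filter]
    exact ⟨Finset.mem_univ _, rfl⟩
  · intro i _ j _ hij
    simpa [Fin.ext_iff] using hij
  · rintro ⟨p, q⟩ he
    have hpq : (p : ℕ) + 1 = q := (Finset.mem_filter.1 he).2
    exact ⟨⟨p, by omega⟩, Finset.mem_univ _, Prod.ext rfl (Fin.ext hpq)⟩
  · intro i _
    exact map_longMap_antiCoprodN_term 𝒲 i.2 _ _ rfl rfl _ _ x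

/-- In weight 1 there are no relations and the symmetric group is trivial, so forgetting the graph
gives a retraction `ρ`. -/
theorem longMap_one_injective : LinearMap.ker (longMap (k := k) 𝒲 1) = ⊥ := by
  rw [LinearMap.ker_eq_bot']
  intro x hx
  rw [longMap, LinearMap.comp_apply, Submodule.mkQ_apply, Submodule.Quotient.mk_eq_zero, arn_one,
    Submodule.mem_bot] at hx
  let ρ : GbarN 𝒲 1 →ₗ[k] ⨂[k]^1 W := Representation.Coinvariants.lift (graphRep 𝒲 1)
    (TensorProduct.lift (Finsupp.linearCombination k fun _ => LinearMap.id)) fun σ => by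
      rw [Subsingleton.elim σ 1, map_one]
      rfl
  have h : ρ (graphify 𝒲 0 x) = x := by
    change TensorProduct.lift (Finsupp.linearCombination k fun _ => LinearMap.id)
      (Finsupp.single (SGraph.long 0) (1 : k) ⊗ₜ[k] x) = x
    simp
  rw [← h, hx, map_zero]

theorem eilMap_mem_range_longMap {n : ℕ} (c : Eil k (Fin n)) (w : ⨂[k] _ : Fin n, W) :
    eilMap 𝒲 (Fin n) c w ∈ LinearMap.range
      (DirectSum.lof k ℕ (fun n => GbarN 𝒲 n ⧸ arn 𝒲 n) n ∘ₗ longMap 𝒲 n) := by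
  -- With the labels `w` fixed, the classes of graphs mapped into the range form a submodule; it
  -- suffices that it contains the long graphs.
  let N : Submodule k (Eil k (Fin n)) := (LinearMap.range
    (DirectSum.lof k ℕ (fun n => GbarN 𝒲 n ⧸ arn 𝒲 n) n ∘ₗ longMap 𝒲 n)).comap
      ((eilMap 𝒲 (Fin n)).flip w)
  have hN : ∀ G : SGraph (Fin n), graphCls k G ∈ N := by
    refine graphCls_mem_of_isLong N ?_
    rintro G ⟨m, e, h⟩
    obtain rfl : n = m + 1 := by simpa using Fintype.card_congr e
    exact ⟨_, (toEbar_graphClass_of_map_eq_long 𝒲 e G h w).symm⟩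
  have htop : N.mkQ = 0 := eil_ext fun G => by
    rw [Submodule.mkQ_apply, (Submodule.Quotient.mk_eq_zero N).2 (hN G), LinearMap.zero_apply]
  exact (Submodule.Quotient.mk_eq_zero N).1 (LinearMap.congr_fun htop c)

theorem longMap_surjective (n : ℕ) : Function.Surjective (longMap (k := k) 𝒲 n) := by
  intro y
  obtain ⟨y, rfl⟩ := Submodule.mkQ_surjective _ y
  obtain ⟨X, rfl⟩ := mkGbar_surjective 𝒲 n y
  rw [← LinearMap.mem_range]
  induction X using TensorProduct.induction_on with
  | zero => simp
  | add a b ha hb =>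
    rw [map_add, map_add]
    exact Submodule.add_mem _ ha hb
  | tmul r w =>
    obtain ⟨x, hx⟩ := eilMap_mem_range_longMap 𝒲 (Submodule.Quotient.mk r) w
    rw [← toEbar_toGbar_tmul, toGbar_fin, toEbar_lof] at hx
    exact ⟨x, DirectSum.of_injective (β := fun n => GbarN 𝒲 n ⧸ arn 𝒲 n) n hx⟩

end Cotensor

/-! ### The inductive quotient of the cotensor coalgebra. -/

section MainTheorem

variable {k : Type*} [Field k] [CharZero k] {W : Type*} [AddCommGroup W] [Module k W]
  (𝒲 : ℤ → Submodule k W) [DirectSum.Decomposition 𝒲]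

/-- `longMap` intertwines the cobrackets, so the kernel criterion and the weight bound for `Ḡ(W)`
pull back along `graphify`; in weight 0 everything is killed. -/
theorem inductiveKer_antiCoprod (n : ℕ) :
    inductiveKer (antiCoprod (k := k) 𝒲) n = LinearMap.ker (longMap 𝒲 n) := by
  have hlof : ∀ n x, antiCoprod 𝒲 (DirectSum.lof k ℕ (fun n => ⨂[k]^n W) n x) =
      antiCoprodN 𝒲 n x := fun n x => by rw [antiCoprod, DirectSum.toModule_lof]
  refine inductiveKer_eq_ker _ _ (longMap_one_injective 𝒲) (fun n hn => ?_) (fun n x => ?_) n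
  · ext x
    simp only [LinearMap.mem_ker, LinearMap.comp_apply, hlof]
    cases n with
    | zero => simp [map_longMap_antiCoprodN_zero, longMap]
    | succ m =>
      have h := SetLike.ext_iff.1 (ker_cobracketN_eq_arn 𝒲 hn) (graphify 𝒲 m x)
      rw [LinearMap.mem_ker, LinearMap.comp_apply] at h
      rw [map_longMap_antiCoprodN_succ, h, longMap, LinearMap.comp_apply, Submodule.mkQ_apply,
        Submodule.Quotient.mk_eq_zero]
  · rw [hlof]
    cases n with
    | zero => rw [map_longMap_antiCoprodN_zero, map_zero]
    | succ m =>
      rw [map_longMap_antiCoprodN_succ]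
      exact weightTrunc_cobracketN 𝒲 (m + 1) _

end MainTheorem

theorem mainTheorem4 {k : Type*} [Field k] [CharZero k] {W : Type*} [AddCommGroup W] [Module k W]
    (𝒲 : ℤ → Submodule k W) [DirectSum.Decomposition 𝒲] :
    (∀ n, inductiveKer (cobracket 𝒲) n = arn 𝒲 n) ∧
    (∀ n, n ≠ 1 → LinearMap.ker
      (TensorProduct.map (toEbar 𝒲) (toEbar 𝒲) ∘ₗ cobracketN 𝒲 n) = arn 𝒲 n) ∧
    (∃ Φ : Ebar 𝒲 ≃ₗ[k] InductiveQuotient (cobracket 𝒲), ∀ (n : ℕ) (x : GbarN 𝒲 n),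
      Φ (DirectSum.lof k ℕ _ n ((arn 𝒲 n).mkQ x)) =
        DirectSum.lof k ℕ _ n ((inductiveKer (cobracket 𝒲) n).mkQ x)) ∧
    (∃ Ψ : Ebar 𝒲 ≃ₗ[k] InductiveQuotient (antiCoprod 𝒲), ∀ (n : ℕ) (x : ⨂[k]^(n + 1) W),
      Ψ (DirectSum.lof k ℕ _ (n + 1) ((arn 𝒲 (n + 1)).mkQ (graphify 𝒲 n x))) =
        DirectSum.lof k ℕ _ (n + 1) ((inductiveKer (antiCoprod 𝒲) (n + 1)).mkQ x)) := by
  refine ⟨inductiveKer_cobracket 𝒲, fun n hn => ker_cobracketN_eq_arn 𝒲 hn, ?_, ?_⟩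
  · refine ⟨DirectSum.congrLinearEquiv fun n =>
      Submodule.quotEquivOfEq _ _ (inductiveKer_cobracket 𝒲 n).symm, fun n x => ?_⟩
    rw [DirectSum.coe_congrLinearEquiv, DirectSum.lmap_lof]
    rfl
  -- The inverse of the isomorphism which the surjection `longMap` induces on the quotient by its
  -- kernel.
  · let e : ∀ n, (GbarN 𝒲 n ⧸ arn 𝒲 n) ≃ₗ[k] (⨂[k]^n W) ⧸ inductiveKer (antiCoprod 𝒲) n :=
      fun n => ((Submodule.quotEquivOfEq _ _ (inductiveKer_antiCoprod 𝒲 n)).trans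
        ((longMap 𝒲 n).quotKerEquivOfSurjective (longMap_surjective 𝒲 n))).symm
    refine ⟨DirectSum.congrLinearEquiv e, fun n x => ?_⟩
    rw [DirectSum.coe_congrLinearEquiv, DirectSum.lmap_lof]
    congr 1
    exact (LinearEquiv.symm_apply_eq _).2 rfl
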